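/- **Notation.** Let $n,N,k$ be positive integers with $k>n+1$, and let $\chi$ be a Dirichlet character modulo $N$. Write elements of $Sp_n(\mathbb Z)$ in $n\times n$ blocks $\begin{pmatrix}A&B\\C&D\end{pmatrix}$. Put $$\Gamma_\infty^+=\{C=0,\ \det A=1\},\qquad \Gamma_0(N)=\{C\equiv 0 \pmod N\},\qquad \Gamma(N)=\{\gamma\equiv I \pmod N\},$$ all inside $Sp_n(\mathbb Z)$, and $\chi(\gamma)=\chi(\det D)$ for $\gamma\in\Gamma_0(N)$. Let $G_\pm=\mathrm{diag}(-1,1,\dots,1)$ and $\gamma_\pm=\begin{pmatrix}G_\pm&0\\0&G_\pm\end{pmatrix}$. For a function $f$ on the Siegel upper half-space $\mathfrak h_n=\{X+iY:\ X,Y \text{ real symmetric } n\times n \text{ matrices},\ Y>0\}$ and $\gamma\in Sp_n(\mathbb Z)$ put $(f|\gamma)(\tau)=\det(C\tau+D)^{-k}f((A\tau+B)(C\tau+D)^{-1})$. Let $$\mathbb E^*=\sum_{\delta^*}1|\delta^*,$$ where $\delta^*\in\Gamma(N)$ varies so that $\Gamma_\infty^+\Gamma(N)$ is the disjoint union of the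 cosets $\Gamma_\infty^+\delta^*$ (the sum converges absolutely since $k>n+1$). For $\gamma\in Sp_n(\mathbb Z)$ let $$\Gamma_\gamma^+=\{\delta\in\Gamma_0(N):\ \Gamma_\infty^+\Gamma(N)\gamma\delta=\Gamma_\infty^+\Gamma(N)\gamma\}$$ and $$\mathbb E_\gamma=\frac{1}{2[\Gamma_\gamma^+:\Gamma(N)]}\Big(\sum_\beta\overline\chi(\beta)\,\mathbb E^*|\gamma\beta+\sum_\beta\overline\chi(\gamma_\pm\beta)\,\mathbb E^*|\gamma_\pm\gamma\beta\Big),$$ where $\beta$ runs over representatives of $\Gamma(N)\backslash\Gamma_0(N)$. For a prime $q$, let $\mathrm{rank}_q$ denote the rank over $\mathbb Z/q\mathbb Z$, and write $q\,\|\,N$ if $q\mid N$ and $q^2\nmid N$; in that case let $\chi_q$ be the component modulo $q$ of $\chi$, i.e. the character modulo $q$ in the unique factorisation $\chi=\chi_q\chi_{N/q}$ into characters modulo $q$ and modulo $N/q$. The condition $\chi_q^2=1$ means that $\chi_q^2$ is the trivial character modulo $q$. Let $M_\sigma$ be an integral symmetric $n\times n$ matrix such that for every prime $q\,\|\,N$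 there is $d=d(q)$, $0\le d\le n$, with $M_\sigma\equiv\begin{pmatrix}I_d&0\\0&0\end{pmatrix}\pmod q$, and such that $M_\sigma$ is diagonal if $N$ is square-free. Let $\gamma_\sigma=\begin{pmatrix}I&0\\M_\sigma&I\end{pmatrix}$ and $\mathbb E_\sigma=\mathbb E_{\gamma_\sigma}$. **Proposition 3.6.** Suppose that $\chi(-1)=(-1)^k$, and that either $N>2$ or $k$ is even. 1. Suppose $\mathbb E_\sigma\neq0$ and $q$ is a prime with $q\,\|\,N$. If $0<\mathrm{rank}_qM_\sigma<n$, then $\chi_q^2=1$. 2. Suppose $N$ is square-free. Then $\mathbb E_\sigma\ne0$ if and only if $\chi_q^2=1$ for all primes $q\mid N$ such that $0<\mathrm{rank}_qM_\sigma<n$. -/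

import Mathlib

open Matrix
open scoped Pointwise

namespace SiegelEis

noncomputable section

/-- The integral symplectic group `Sp_n(ℤ)`, with elements written in `n × n` blocks. -/
abbrev Sp (n : ℕ) : Type := Matrix.symplecticGroup (Fin n) ℤ

variable {n : ℕ}

/-- The four `n × n` blocks of `γ = (A B; C D)`. -/
def blockA (γ : Sp n) : Matrix (Fin n) (Fin n) ℤ := (γ : Matrix (Fin n ⊕ Fin n) (Fin n ⊕ Fin n) ℤ).toBlocks₁₁

def blockB (γ : Sp n) : Matrix (Fin n) (Fin n) ℤ := (γ : Matrix (Fin n ⊕ Fin n) (Fin n ⊕ Fin n) ℤ).toBlocks₁₂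

def blockC (γ : Sp n) : Matrix (Fin n) (Fin n) ℤ := (γ : Matrix (Fin n ⊕ Fin n) (Fin n ⊕ Fin n) ℤ).toBlocks₂₁

def blockD (γ : Sp n) : Matrix (Fin n) (Fin n) ℤ := (γ : Matrix (Fin n ⊕ Fin n) (Fin n ⊕ Fin n) ℤ).toBlocks₂₂

theorem coe_eq_blocks (γ : Sp n) :
    (γ : Matrix (Fin n ⊕ Fin n) (Fin n ⊕ Fin n) ℤ)
      = fromBlocks (blockA γ) (blockB γ) (blockC γ) (blockD γ) :=
  (fromBlocks_toBlocks _).symm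

theorem blockA_mul (γ δ : Sp n) :
    blockA (γ * δ) = blockA γ * blockA δ + blockB γ * blockC δ := by
  rw [blockA, Submonoid.coe_mul, coe_eq_blocks γ, coe_eq_blocks δ, fromBlocks_multiply,
    toBlocks_fromBlocks₁₁]

theorem blockC_mul (γ δ : Sp n) :
    blockC (γ * δ) = blockC γ * blockA δ + blockD γ * blockC δ := by
  rw [blockC, Submonoid.coe_mul, coe_eq_blocks γ, coe_eq_blocks δ, fromBlocks_multiply,
    toBlocks_fromBlocks₂₁]

theorem blockC_one : blockC (1 : Sp n) = 0 := by
  rw [blockC, Submonoid.coe_one, ← fromBlocks_one, toBlocks_fromBlocks₂₁]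

theorem blockA_one : blockA (1 : Sp n) = 1 := by
  rw [blockA, Submonoid.coe_one, ← fromBlocks_one, toBlocks_fromBlocks₁₁]

theorem blockC_inv (γ : Sp n) : blockC γ⁻¹ = -(blockC γ)ᵀ := by
  rw [blockC, SymplecticGroup.coe_inv, coe_eq_blocks γ, J, fromBlocks_transpose, fromBlocks_neg,
    fromBlocks_multiply, fromBlocks_multiply, toBlocks_fromBlocks₂₁]
  simp

/-- `Γ₀(N)`: the symplectic matrices `(A B; C D)` with `C ≡ 0 (mod N)`. -/
def Gamma0 (n N : ℕ) : Subgroup (Sp n) where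
  carrier := {γ | (blockC γ).map (Int.cast : ℤ → ZMod N) = 0}
  one_mem' := by
    simp only [Set.mem_ofPred_eq, blockC_one]
    ext i j; simp
  mul_mem' := by
    intro a b ha hb
    have h : ∀ X : Matrix (Fin n) (Fin n) ℤ,
        X.map (Int.cast : ℤ → ZMod N) = (Int.castRingHom (ZMod N)).mapMatrix X := fun _ => rfl
    simp only [Set.mem_ofPred_eq, h] at ha hb ⊢
    rw [blockC_mul, map_add, map_mul, map_mul, ha, hb, zero_mul, mul_zero, add_zero]
  inv_mem' := by
    intro a ha
    have h : ∀ i j, ((blockC a i j : ℤ) : ZMod N) = 0 := fun i j => congrFun (congrFun ha i) j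
    simp only [Set.mem_ofPred_eq, blockC_inv]
    ext i j
    simp [h]

/-- `Γ_∞⁺`: the symplectic matrices `(A B; 0 D)` with `det A = 1`. -/
def GammaInfPlus (n : ℕ) : Subgroup (Sp n) where
  carrier := {γ | blockC γ = 0 ∧ (blockA γ).det = 1}
  one_mem' := ⟨blockC_one, by rw [blockA_one, det_one]⟩
  mul_mem' := by
    rintro a b ⟨ha, ha'⟩ ⟨hb, hb'⟩
    refine ⟨?_, ?_⟩
    · rw [blockC_mul, ha, hb, zero_mul, mul_zero, add_zero]
    · rw [blockA_mul, hb, mul_zero, add_zero, det_mul, ha', hb', one_mul]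
  inv_mem' := by
    rintro a ⟨ha, ha'⟩
    have hc : blockC a⁻¹ = 0 := by rw [blockC_inv, ha, transpose_zero, neg_zero]
    refine ⟨hc, ?_⟩
    have h := blockA_mul a a⁻¹
    rw [mul_inv_cancel, blockA_one, hc, mul_zero, add_zero] at h
    have h2 := congrArg det h
    rw [det_one, det_mul, ha', one_mul] at h2
    exact h2.symm

/-- Reduction modulo `N` of symplectic matrices. -/
def reduceMod (n N : ℕ) : Sp n →* Matrix (Fin n ⊕ Fin n) (Fin n ⊕ Fin n) (ZMod N) :=
  ((Int.castRingHom (ZMod N)).mapMatrix : _ →+* _).toMonoidHom.comp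
    (Matrix.symplecticGroup (Fin n) ℤ).subtype

/-- The principal congruence subgroup `Γ(N)`: the symplectic matrices `γ ≡ I (mod N)`. -/
def GammaN (n N : ℕ) : Subgroup (Sp n) := (reduceMod n N).ker

/-- The `n × n` matrix `G_± = diag(-1, 1, …, 1)`. -/
def Gpm (n : ℕ) : Matrix (Fin n) (Fin n) ℤ :=
  diagonal fun i => if (i : ℕ) = 0 then -1 else 1

theorem Gpm_mul_self : Gpm n * Gpm n = 1 := by
  rw [Gpm, diagonal_mul_diagonal, ← diagonal_one]
  congr 1
  funext i
  split_ifs <;> simp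

/-- The symplectic matrix `γ_± = (G_± 0; 0 G_±)`. -/
def gammaPM (n : ℕ) : Sp n :=
  ⟨fromBlocks (Gpm n) 0 0 (Gpm n), by
    have h : (Gpm n)ᵀ = Gpm n := diagonal_transpose _
    rw [SymplecticGroup.mem_iff, J, fromBlocks_transpose, fromBlocks_multiply, fromBlocks_multiply]
    simp [h, Gpm_mul_self]⟩

/-- The symplectic matrix `(I 0; M I)` attached to an integral symmetric matrix `M`. -/
def gammaLower (M : Matrix (Fin n) (Fin n) ℤ) (hM : M.IsSymm) : Sp n :=
  ⟨fromBlocks 1 0 M 1, by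
    rw [SymplecticGroup.mem_iff, J, fromBlocks_transpose, fromBlocks_multiply, fromBlocks_multiply]
    simp [hM.eq]⟩

/-- `Γ_γ⁺`: the stabiliser in `Γ₀(N)` of the set `Γ_∞⁺ Γ(N) γ` under right multiplication. -/
def GammaStab (N : ℕ) (γ : Sp n) : Subgroup (Sp n) where
  carrier := {δ | δ ∈ Gamma0 n N ∧
    (GammaInfPlus n : Set (Sp n)) * (GammaN n N : Set (Sp n)) * {γ * δ}
      = (GammaInfPlus n : Set (Sp n)) * (GammaN n N : Set (Sp n)) * {γ}}
  one_mem' := ⟨one_mem _, by rw [mul_one]⟩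
  mul_mem' := by
    rintro a b ⟨ha, ha'⟩ ⟨hb, hb'⟩
    refine ⟨mul_mem ha hb, ?_⟩
    rw [← mul_assoc γ a b, ← Set.singleton_mul_singleton, ← mul_assoc, ha', mul_assoc,
      Set.singleton_mul_singleton, hb']
  inv_mem' := by
    rintro a ⟨ha, ha'⟩
    refine ⟨inv_mem ha, ?_⟩
    rw [← Set.singleton_mul_singleton, ← mul_assoc, ← ha', mul_assoc,
      Set.singleton_mul_singleton, mul_inv_cancel_right, ha']

/-- The Siegel upper half-space of degree `n`: symmetric complex matrices `X + iY` with `Y > 0`. -/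
def HalfSpace (n : ℕ) : Type :=
  {τ : Matrix (Fin n) (Fin n) ℂ // τ.IsSymm ∧ (τ.map Complex.im).PosDef}

/-- The factor `det (C τ + D)` for `γ = (A B; C D)`. -/
def detFactor (γ : Sp n) (τ : Matrix (Fin n) (Fin n) ℂ) : ℂ :=
  ((blockC γ).map (Int.cast : ℤ → ℂ) * τ + (blockD γ).map (Int.cast : ℤ → ℂ)).det

/-- The fractional linear action `(A τ + B)(C τ + D)⁻¹`. It is only used on the Siegel upper
half-space, where `C τ + D` is invertible and which it preserves. -/
def moebius (γ : Sp n) (τ : Matrix (Fin n) (Fin n) ℂ) : Matrix (Fin n) (Fin n) ℂ :=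
  ((blockA γ).map (Int.cast : ℤ → ℂ) * τ + (blockB γ).map (Int.cast : ℤ → ℂ)) *
    ((blockC γ).map (Int.cast : ℤ → ℂ) * τ + (blockD γ).map (Int.cast : ℤ → ℂ))⁻¹

/-- The weight `k` slash operator `(f | γ)(τ) = det (C τ + D)^{-k} f(γ τ)` for `γ ∈ Sp_n(ℤ)`
(the factor `(det γ)^{k/2}` is `1`). Functions on the half-space are represented by functions of a
complex matrix, and only their values on the half-space matter. -/
def slash (k : ℕ) (f : Matrix (Fin n) (Fin n) ℂ → ℂ) (γ : Sp n) :
    Matrix (Fin n) (Fin n) ℂ → ℂ :=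
  fun τ => (detFactor γ τ ^ k)⁻¹ * f (moebius γ τ)

/-- The set of right cosets `H \ K` for subgroups `H`, `K` of a group, i.e. the cosets
`(H ∩ K) δ` with `δ ∈ K`, which correspond to the cosets `H δ` with `δ ∈ K`. -/
abbrev RightCosets {G : Type*} [Group G] (H K : Subgroup G) : Type _ :=
  Quotient (QuotientGroup.rightRel (H.subgroupOf K))

/-- A representative in `K` of a right coset. -/
def rep {G : Type*} [Group G] {H K : Subgroup G} (c : RightCosets H K) : G :=
  ((Quotient.out c : K) : G)

/-- `𝔼* = ∑_{δ*} 1 | δ*`, where `δ* ∈ Γ(N)` varies so that `Γ_∞⁺ Γ(N)` is the disjoint union of the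
`Γ_∞⁺ δ*`. The terms do not depend on the representatives. -/
def Estar (n k N : ℕ) : Matrix (Fin n) (Fin n) ℂ → ℂ :=
  fun τ => ∑' c : RightCosets (GammaInfPlus n) (GammaN n N), slash k (fun _ => 1) (rep c) τ

/-- The value `χ(δ) = χ(det D)` for `δ = (A B; C D)` (used for `δ ∈ Γ₀(N)`). -/
def charVal {N : ℕ} (χ : DirichletCharacter ℂ N) (δ : Sp n) : ℂ :=
  χ (((blockD δ).det : ℤ) : ZMod N)

/-- `𝔼'_γ = ∑_β χ̄(β) 𝔼* | γ β + ∑_β χ̄(γ_± β) 𝔼* | γ_± γ β`, where `β` runs over representatives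
of the finite set `Γ(N) \ Γ₀(N)`. -/
def Eprime (k : ℕ) {N : ℕ} (χ : DirichletCharacter ℂ N) (γ : Sp n) :
    Matrix (Fin n) (Fin n) ℂ → ℂ :=
  fun τ =>
    (∑ᶠ c : RightCosets (GammaN n N) (Gamma0 n N),
      starRingEnd ℂ (charVal χ (rep c)) * slash k (Estar n k N) (γ * rep c) τ) +
    ∑ᶠ c : RightCosets (GammaN n N) (Gamma0 n N),
      starRingEnd ℂ (charVal χ (gammaPM n * rep c)) *
        slash k (Estar n k N) (gammaPM n * γ * rep c) τ

/-- The Siegel Eisenstein series `𝔼_γ = (2 [Γ_γ⁺ : Γ(N)])⁻¹ 𝔼'_γ` of degree `n`, weight `k`,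
level `N` and character `χ`, as a function on the Siegel upper half-space. -/
def eisenstein (k : ℕ) {N : ℕ} (χ : DirichletCharacter ℂ N) (γ : Sp n) : HalfSpace n → ℂ :=
  fun τ => (2 * ((GammaN n N).relIndex (GammaStab N γ) : ℂ))⁻¹ * Eprime k χ γ τ.1

/-- The rank over `ℤ/qℤ` of an integral matrix. -/
def rankMod (q : ℕ) (M : Matrix (Fin n) (Fin n) ℤ) : ℕ :=
  (M.map (Int.cast : ℤ → ZMod q)).rank

/-- `d` exactly divides `N`: `d ∣ N` and `d` is coprime to `N / d`. For a prime `q` this is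
`q ‖ N`. -/
def ExactDvd (d N : ℕ) : Prop := d ∣ N ∧ Nat.Coprime d (N / d)

theorem exactDvd_of_squarefree {d N : ℕ} (hN : Squarefree N) (h : d ∣ N) : ExactDvd d N := by
  obtain ⟨e, rfl⟩ := h
  have hd : 0 < d := Nat.pos_of_ne_zero fun h0 => hN.ne_zero (by simp [h0])
  exact ⟨dvd_mul_right d e, by
    rw [Nat.mul_div_cancel_left e hd]; exact Nat.coprime_of_squarefree_mul hN⟩

/-- For `d` exactly dividing `N`, the map on units `(ℤ/d)ˣ → (ℤ/N)ˣ` sending `u` to the class that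
is `u` modulo `d` and `1` modulo `N / d`. -/
def unitsEmbed {d N : ℕ} (h : ExactDvd d N) : (ZMod d)ˣ →* (ZMod N)ˣ :=
  (Units.map ((ZMod.chineseRemainder h.2).symm.trans
      (ZMod.ringEquivCongr (Nat.mul_div_cancel' h.1))).toRingHom.toMonoidHom).comp
    (MulEquiv.prodUnits.symm.toMonoidHom.comp (MonoidHom.inl (ZMod d)ˣ (ZMod (N / d))ˣ))

/-- The component `χ_d` modulo `d` in the factorisation `χ = χ_d χ_{N/d}` of a character modulo `N`,
for `d` exactly dividing `N`. -/
def component {d N : ℕ} (χ : DirichletCharacter ℂ N) (h : ExactDvd d N) :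
    DirichletCharacter ℂ d :=
  MulChar.ofUnitHom (χ.toUnitHom.comp (unitsEmbed h))

/-- The conditions on the matrices `M_σ` in the chosen representatives `γ_σ = (I 0; M_σ I)` of
`Γ_∞ \ Sp_n(ℤ) / Γ₀(N)`: `M` is symmetric, it is congruent to some `(I_d 0; 0 0)` modulo each prime
`q ‖ N`, and it is diagonal if `N` is square-free. -/
structure IsRepMatrix (N : ℕ) (M : Matrix (Fin n) (Fin n) ℤ) : Prop where
  isSymm : M.IsSymm
  congr_mod : ∀ q : ℕ, q.Prime → ExactDvd q N → ∃ d ≤ n,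
    M.map (Int.cast : ℤ → ZMod q) = diagonal fun i : Fin n => if (i : ℕ) < d then 1 else 0
  isDiag : Squarefree N → M.IsDiag

end

end SiegelEis

/-!
The Eisenstein series `𝔼_σ` is analysed through the terms `𝔼* | h γ_σ β` of its two defining sums,
`h ∈ {1, γ_±}` and `β ∈ Γ(N) \ Γ₀(N)`.

*Necessity.* If `δ ∈ Γ₀(N)` and `γ_σ δ γ_σ⁻¹ ∈ Γ_∞⁺`, translating `β` by `δ` multiplies both sums by
`χ̄(δ)`, because `𝔼*` is invariant under `Γ_∞⁺` and `γ_±` normalises `Γ_∞⁺`. So `𝔼_σ ≠ 0` forces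
`χ(δ) = 1` (`charVal_eq_one_of_eisenstein_ne_zero`). When `0 < rank_q M_σ < n`, every square of a
unit modulo `q` is realised by such a `δ`, with `det D ≡ 1` modulo `N / q`; the outcome is
`component_sq_eq_one_of_eisenstein_ne_zero`.

*Sufficiency.* Conversely, if `N` is square-free and `χ_q² = 1` at the primes of intermediate rank,
then `χ(δ) = χ(ε)` whenever `γ_σ δ γ_σ⁻¹` is modulo `N` of the form `(A, B; 0, D)` with
`det A = ε = ±1` (`charVal_eq_of_conj`): modulo `q` the blocks of `γ_σ δ γ_σ⁻¹` are triangular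
with respect to the support of the diagonal matrix `M_σ`, so that for `δ` itself `det D` is `ε` times
a square, which is `1` if `M_σ` is invertible or zero modulo `q` (`det_sub_diagonal_mul`).
The constant term of `𝔼_σ` at the cusp of `γ_σ`, i.e. the limit of `2 [Γ_γ⁺ : Γ(N)]` times
`𝔼_σ | γ_σ⁻¹` at `i y I` as `y → ∞`, is a sum over the `δ* h γ_σ β γ_σ⁻¹` with vanishing block `C`.
Together with `χ(-1) = (-1)ᵏ`, the identity for `χ(δ)` shows that each of them contributes exactly
`1` (`conj_charVal_mul_constTerm`), and `β = 1` does occur. So the constant term is positive.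

*Convergence.* Taking the limit termwise needs the absolute convergence of `𝔼*` for `k > n + 1`.
Since `|det (i y C + D)|` increases with `y ≥ 1`, it is enough to treat the point `i I`. There the
classes of bottom rows `(C, D)` correspond to Lagrangian subspaces of `ℚ²ⁿ`, and
`∑ |det (iC + D)|⁻ᵏ` over them is bounded by induction on `n` (`heightZeta_ne_top`). A Lagrangian in
degree `n + 1` reduces to one in degree `n`, spanned by the bottom rows of some `g`, together with
rational parameters `φ ∈ ℚⁿ` and `t ∈ ℚ` (`exists_step`). The Schur complement formula gives
`|det (iC + D)| = |det V| |det (i C_g + D_g)| |i + t + φᵀ τ φ|` with `τ = g (i I)` and an integral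
matrix `V` whose determinant is divisible by `q² b`, where `q` is the denominator of `φ` and `b`
that of `q² t` (`dvd_det_of_denominators`). The sum over the numerator of `t` is a Riemann sum, and
the sum over the numerators of `φ` counts lattice points by integer parts, with covolume at most
`|det (i C_g + D_g)|` (`tsum_gramForm_le`); this costs one power of the height, whence the
recursion from `(n, k - 1)` and `(n, k)` to `(n + 1, k)`.
-/

namespace SiegelEis

/-! ### Block relations for symplectic matrices -/

section Blocks

variable {n : ℕ} (R : Type*) [CommRing R] (γ δ : Sp n)

/-- The reduction or extension of an integral matrix to a ring `R`. -/
abbrev castMat (M : Matrix (Fin n) (Fin n) ℤ) : Matrix (Fin n) (Fin n) R :=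
  M.map (Int.cast : ℤ → R)

theorem castMat_eq (M : Matrix (Fin n) (Fin n) ℤ) :
    castMat R M = (Int.castRingHom R).mapMatrix M := rfl

theorem castMat_mul (M M' : Matrix (Fin n) (Fin n) ℤ) :
    castMat R (M * M') = castMat R M * castMat R M' := by
  simp only [castMat_eq, map_mul]

theorem castMat_add (M M' : Matrix (Fin n) (Fin n) ℤ) :
    castMat R (M + M') = castMat R M + castMat R M' := by
  simp only [castMat_eq, map_add]

theorem castMat_sub (M M' : Matrix (Fin n) (Fin n) ℤ) :
    castMat R (M - M') = castMat R M - castMat R M' := by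
  simp only [castMat_eq, map_sub]

theorem castMat_one : castMat R (1 : Matrix (Fin n) (Fin n) ℤ) = 1 := by
  simp only [castMat_eq, map_one]

theorem castMat_zero : castMat R (0 : Matrix (Fin n) (Fin n) ℤ) = 0 := by
  simp only [castMat_eq, map_zero]

theorem castMat_transpose (M : Matrix (Fin n) (Fin n) ℤ) :
    castMat R Mᵀ = (castMat R M)ᵀ := rfl

theorem castMat_det (M : Matrix (Fin n) (Fin n) ℤ) :
    (castMat R M).det = ((M.det : ℤ) : R) :=
  ((Int.castRingHom R).map_det M).symm

theorem blocks_relations_left :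
    blockA γ * (blockB γ)ᵀ = blockB γ * (blockA γ)ᵀ ∧
    blockC γ * (blockD γ)ᵀ = blockD γ * (blockC γ)ᵀ ∧
    blockA γ * (blockD γ)ᵀ - blockB γ * (blockC γ)ᵀ = 1 := by
  have h := SymplecticGroup.mem_iff.1 γ.2
  rw [coe_eq_blocks γ, J, fromBlocks_transpose, fromBlocks_multiply, fromBlocks_multiply,
    fromBlocks_inj] at h
  simp only [mul_zero, mul_one, zero_add, add_zero, mul_neg, neg_mul] at h
  obtain ⟨h1, h2, h3, h4⟩ := h
  refine ⟨?_, ?_, ?_⟩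
  · rw [← sub_eq_zero, ← neg_eq_zero, ← h1]; abel
  · rw [← sub_eq_zero, ← neg_eq_zero, ← h4]; abel
  · rw [← neg_inj, ← h2]; abel

theorem blocks_relations_right :
    (blockA γ)ᵀ * blockC γ = (blockC γ)ᵀ * blockA γ ∧
    (blockB γ)ᵀ * blockD γ = (blockD γ)ᵀ * blockB γ ∧
    (blockA γ)ᵀ * blockD γ - (blockC γ)ᵀ * blockB γ = 1 := by
  have h := SymplecticGroup.mem_iff'.1 γ.2
  rw [coe_eq_blocks γ, J, fromBlocks_transpose, fromBlocks_multiply, fromBlocks_multiply,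
    fromBlocks_inj] at h
  simp only [mul_zero, mul_one, zero_add, add_zero, mul_neg, neg_mul] at h
  obtain ⟨h1, h2, h3, h4⟩ := h
  refine ⟨?_, ?_, ?_⟩
  · rw [← sub_eq_zero, ← neg_eq_zero, ← h1]; abel
  · rw [← sub_eq_zero, ← neg_eq_zero, ← h4]; abel
  · rw [← neg_inj, ← h2]; abel

theorem blockB_mul :
    blockB (γ * δ) = blockA γ * blockB δ + blockB γ * blockD δ := by
  rw [blockB, Submonoid.coe_mul, coe_eq_blocks γ, coe_eq_blocks δ, fromBlocks_multiply,
    toBlocks_fromBlocks₁₂]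

theorem blockD_mul :
    blockD (γ * δ) = blockC γ * blockB δ + blockD γ * blockD δ := by
  rw [blockD, Submonoid.coe_mul, coe_eq_blocks γ, coe_eq_blocks δ, fromBlocks_multiply,
    toBlocks_fromBlocks₂₂]

theorem coe_inv_eq_blocks : ((γ⁻¹ : Sp n) : Matrix (Fin n ⊕ Fin n) (Fin n ⊕ Fin n) ℤ)
    = fromBlocks (blockD γ)ᵀ (-(blockB γ)ᵀ) (-(blockC γ)ᵀ) (blockA γ)ᵀ := by
  rw [SymplecticGroup.coe_inv, coe_eq_blocks γ, J, fromBlocks_transpose, fromBlocks_neg,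
    fromBlocks_multiply, fromBlocks_multiply]
  simp

theorem blockA_inv : blockA γ⁻¹ = (blockD γ)ᵀ := by
  rw [blockA, coe_inv_eq_blocks, toBlocks_fromBlocks₁₁]

theorem blockD_inv : blockD γ⁻¹ = (blockA γ)ᵀ := by
  rw [blockD, coe_inv_eq_blocks, toBlocks_fromBlocks₂₂]

/-- The lower left block of `γ δ⁻¹` measures the failure of the Lagrangians spanned by the bottom
rows of `γ` and `δ` to coincide. -/
theorem blockC_mul_inv :
    blockC (γ * δ⁻¹) = blockC γ * (blockD δ)ᵀ - blockD γ * (blockC δ)ᵀ := by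
  rw [blockC_mul, blockA_inv, blockC_inv, mul_neg, sub_eq_add_neg]

theorem cast_AB : castMat R (blockA γ) * (castMat R (blockB γ))ᵀ
    = castMat R (blockB γ) * (castMat R (blockA γ))ᵀ := by
  simpa only [castMat_mul, castMat_transpose] using
    congrArg (castMat R) (blocks_relations_left γ).1

theorem cast_CD : castMat R (blockC γ) * (castMat R (blockD γ))ᵀ
    = castMat R (blockD γ) * (castMat R (blockC γ))ᵀ := by
  simpa only [castMat_mul, castMat_transpose] using
    congrArg (castMat R) (blocks_relations_left γ).2.1

theorem cast_AD : castMat R (blockA γ) * (castMat R (blockD γ))ᵀ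
    - castMat R (blockB γ) * (castMat R (blockC γ))ᵀ = 1 := by
  simpa only [castMat_mul, castMat_sub, castMat_one, castMat_transpose] using
    congrArg (castMat R) (blocks_relations_left γ).2.2

theorem cast_DA : castMat R (blockD γ) * (castMat R (blockA γ))ᵀ
    - castMat R (blockC γ) * (castMat R (blockB γ))ᵀ = 1 := by
  have h := congrArg transpose (cast_AD R γ)
  rwa [transpose_sub, transpose_mul, transpose_mul, transpose_transpose, transpose_transpose,
    transpose_one] at h

theorem cast_AtC : (castMat R (blockA γ))ᵀ * castMat R (blockC γ)
    = (castMat R (blockC γ))ᵀ * castMat R (blockA γ) := by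
  simpa only [castMat_mul, castMat_transpose] using
    congrArg (castMat R) (blocks_relations_right γ).1

theorem cast_BtD : (castMat R (blockB γ))ᵀ * castMat R (blockD γ)
    = (castMat R (blockD γ))ᵀ * castMat R (blockB γ) := by
  simpa only [castMat_mul, castMat_transpose] using
    congrArg (castMat R) (blocks_relations_right γ).2.1

theorem cast_AtD : (castMat R (blockA γ))ᵀ * castMat R (blockD γ)
    - (castMat R (blockC γ))ᵀ * castMat R (blockB γ) = 1 := by
  simpa only [castMat_mul, castMat_sub, castMat_one, castMat_transpose] using
    congrArg (castMat R) (blocks_relations_right γ).2.2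

theorem cast_DtA : (castMat R (blockD γ))ᵀ * castMat R (blockA γ)
    - (castMat R (blockB γ))ᵀ * castMat R (blockC γ) = 1 := by
  have h := congrArg transpose (cast_AtD R γ)
  rwa [transpose_sub, transpose_mul, transpose_mul, transpose_transpose, transpose_transpose,
    transpose_one] at h

/-- If the lower left block vanishes in `R`, the diagonal blocks are transposed inverses. -/
theorem cast_det_mul_of_blockC (h : castMat R (blockC γ) = 0) :
    ((blockA γ).det : R) * ((blockD γ).det : R) = 1 := by
  have := cast_AD R γ
  rw [h, transpose_zero, mul_zero, sub_zero] at this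
  rw [← castMat_det, ← castMat_det, ← det_transpose (castMat R (blockD γ)), ← det_mul, this,
    det_one]

end Blocks

/-! ### The action on the Siegel upper half-space -/

section HalfSpaceAction

variable {n : ℕ}

/-- The numerator `A τ + B` of the fractional linear action. -/
abbrev numer (γ : Sp n) (τ : Matrix (Fin n) (Fin n) ℂ) : Matrix (Fin n) (Fin n) ℂ :=
  castMat ℂ (blockA γ) * τ + castMat ℂ (blockB γ)

/-- The denominator `C τ + D` of the fractional linear action. -/
abbrev denom (γ : Sp n) (τ : Matrix (Fin n) (Fin n) ℂ) : Matrix (Fin n) (Fin n) ℂ :=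
  castMat ℂ (blockC γ) * τ + castMat ℂ (blockD γ)

theorem detFactor_eq (γ : Sp n) (τ : Matrix (Fin n) (Fin n) ℂ) :
    detFactor γ τ = (denom γ τ).det := rfl

theorem moebius_eq (γ : Sp n) (τ : Matrix (Fin n) (Fin n) ℂ) :
    moebius γ τ = numer γ τ * (denom γ τ)⁻¹ := rfl

theorem castMat_conjTranspose (M : Matrix (Fin n) (Fin n) ℤ) :
    (castMat ℂ M)ᴴ = (castMat ℂ M)ᵀ := by
  ext i j; simp [conjTranspose_apply]

theorem numer_denom_symm (γ : Sp n) {τ : Matrix (Fin n) (Fin n) ℂ} (hτ : τ.IsSymm) :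
    (denom γ τ)ᵀ * numer γ τ = (numer γ τ)ᵀ * denom γ τ := by
  have h1 := cast_AtC ℂ γ
  have h2 := cast_BtD ℂ γ
  have h3 := cast_AtD ℂ γ
  have h4 := cast_DtA ℂ γ
  simp only [numer, denom, transpose_add, transpose_mul, hτ.eq]
  set A := castMat ℂ (blockA γ)
  set B := castMat ℂ (blockB γ)
  set C := castMat ℂ (blockC γ)
  set D := castMat ℂ (blockD γ)
  have e1 : (τ * Cᵀ + Dᵀ) * (A * τ + B) - (τ * Aᵀ + Bᵀ) * (C * τ + D)
      = τ * (Cᵀ * A - Aᵀ * C) * τ + (Dᵀ * A - Bᵀ * C) * τ - τ * (Aᵀ * D - Cᵀ * B)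
        + (Dᵀ * B - Bᵀ * D) := by noncomm_ring
  rw [← sub_eq_zero, e1, h1, h2, h3, h4]
  simp

/-- The Hermitian form preserved by the symplectic group, evaluated at `(τ; 1)`. -/
theorem denom_conj_mul_numer (γ : Sp n) (τ : Matrix (Fin n) (Fin n) ℂ) :
    (denom γ τ)ᴴ * numer γ τ - (numer γ τ)ᴴ * denom γ τ = τ - τᴴ := by
  have h1 := cast_AtC ℂ γ
  have h2 := cast_BtD ℂ γ
  have h3 := cast_AtD ℂ γ
  have h4 := cast_DtA ℂ γ
  simp only [numer, denom, conjTranspose_add, conjTranspose_mul, castMat_conjTranspose]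
  set A := castMat ℂ (blockA γ)
  set B := castMat ℂ (blockB γ)
  set C := castMat ℂ (blockC γ)
  set D := castMat ℂ (blockD γ)
  have e1 : (τᴴ * Cᵀ + Dᵀ) * (A * τ + B) - (τᴴ * Aᵀ + Bᵀ) * (C * τ + D)
      = τᴴ * (Cᵀ * A - Aᵀ * C) * τ + (Dᵀ * A - Bᵀ * C) * τ - τᴴ * (Aᵀ * D - Cᵀ * B)
        + (Dᵀ * B - Bᵀ * D) := by noncomm_ring
  rw [e1, h1, h2, h3, h4]
  simp

/-- The complex form of the condition defining the half-space. -/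
theorem posDef_im_iff {τ : Matrix (Fin n) (Fin n) ℂ} (hτ : τ.IsSymm) :
    (τ.map Complex.im).PosDef ↔ ∀ x : Fin n → ℂ, x ≠ 0 →
      0 < (star x ⬝ᵥ ((τ - τᴴ) *ᵥ x)).im := by
  have key : ∀ x : Fin n → ℂ, (star x ⬝ᵥ ((τ - τᴴ) *ᵥ x)).im
      = 2 * ((fun i => (x i).re) ⬝ᵥ ((τ.map Complex.im) *ᵥ fun i => (x i).re)
        + (fun i => (x i).im) ⬝ᵥ ((τ.map Complex.im) *ᵥ fun i => (x i).im)) := by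
    intro x
    have hs : ∀ i j, τ i j = τ j i := fun i j => congrFun (congrFun hτ.eq j) i
    have h1 : star x ⬝ᵥ ((τ - τᴴ) *ᵥ x)
        = ∑ i, ∑ j, star (x i) * (2 * Complex.I * ((τ i j).im : ℂ)) * x j := by
      simp only [dotProduct, mulVec, Finset.mul_sum, Pi.star_apply]
      refine Finset.sum_congr rfl fun i _ => Finset.sum_congr rfl fun j _ => ?_
      rw [Matrix.sub_apply, conjTranspose_apply, hs j i, mul_assoc]
      congr 2
      apply Complex.ext <;> simp
      ring
    rw [h1]
    simp only [dotProduct, mulVec, Finset.mul_sum, Matrix.map_apply, Complex.im_sum]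
    simp only [← Finset.sum_add_distrib, mul_add, Finset.mul_sum]
    refine Finset.sum_congr rfl fun i _ => Finset.sum_congr rfl fun j _ => ?_
    simp [Complex.mul_im, Complex.mul_re]
    ring
  constructor
  · intro h x hx
    rw [key]
    have hp := h.posSemidef
    by_cases hre : (fun i => (x i).re) = 0
    · have him : (fun i => (x i).im) ≠ 0 := by
        intro him
        apply hx
        ext i
        exact Complex.ext (congrFun hre i) (congrFun him i)
      have h1 := hp.dotProduct_mulVec_nonneg (fun i => (x i).re)
      have h2 := h.dotProduct_mulVec_pos him
      simp only [star_trivial] at h1 h2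
      linarith
    · have h1 := h.dotProduct_mulVec_pos hre
      have h2 := hp.dotProduct_mulVec_nonneg (fun i => (x i).im)
      simp only [star_trivial] at h1 h2
      linarith
  · intro h
    refine Matrix.PosDef.of_dotProduct_mulVec_pos ?_ ?_
    · ext i j
      simp only [conjTranspose_apply, map_apply, star_trivial]
      rw [← congrFun (congrFun hτ.eq i) j, transpose_apply]
    · intro x hx
      have h1 := h (fun i => (x i : ℂ)) (by
        intro h0; apply hx; ext i; simpa using congrFun h0 i)
      rw [key] at h1
      simp only [Complex.ofReal_re, Complex.ofReal_im] at h1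
      have h3 : (fun _ : Fin n => (0 : ℝ)) = 0 := rfl
      simp only [h3, zero_dotProduct, add_zero] at h1
      rw [star_trivial]
      linarith

theorem denom_mulVec_ne_zero (γ : Sp n) (τ : HalfSpace n) {x : Fin n → ℂ} (hx : x ≠ 0) :
    denom γ τ.1 *ᵥ x ≠ 0 := by
  intro h0
  have h1 := (posDef_im_iff τ.2.1).1 τ.2.2 x hx
  rw [← denom_conj_mul_numer γ, sub_mulVec, ← mulVec_mulVec, ← mulVec_mulVec, h0, mulVec_zero,
    sub_zero, dotProduct_mulVec, ← star_mulVec, h0, star_zero, zero_dotProduct] at h1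
  simp at h1

theorem detFactor_ne_zero (γ : Sp n) (τ : HalfSpace n) : detFactor γ τ.1 ≠ 0 := by
  intro h
  obtain ⟨v, hv, hv0⟩ := exists_mulVec_eq_zero_iff.2 (detFactor_eq γ τ.1 ▸ h)
  exact denom_mulVec_ne_zero γ τ hv hv0

theorem moebius_mul_denom (γ : Sp n) (τ : HalfSpace n) :
    moebius γ τ.1 * denom γ τ.1 = numer γ τ.1 := by
  rw [moebius_eq, Matrix.mul_assoc, nonsing_inv_mul _ (detFactor_ne_zero γ τ).isUnit, mul_one]

theorem moebius_isSymm (γ : Sp n) (τ : HalfSpace n) : (moebius γ τ.1).IsSymm := by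
  have hu : IsUnit (denom γ τ.1).det := (detFactor_ne_zero γ τ).isUnit
  have h := numer_denom_symm γ τ.2.1
  rw [← moebius_mul_denom γ τ, transpose_mul, ← Matrix.mul_assoc] at h
  have h2 := congrArg (fun X => X * (denom γ τ.1)⁻¹) h
  simp only [Matrix.mul_assoc, mul_nonsing_inv _ hu, mul_one] at h2
  have h3 := congrArg (fun X => ((denom γ τ.1)ᵀ)⁻¹ * X) h2
  have hu' : IsUnit ((denom γ τ.1)ᵀ).det := by rwa [det_transpose]
  simp only [← Matrix.mul_assoc, nonsing_inv_mul _ hu', one_mul] at h3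
  exact h3.symm

/-- `(C τ + D)ᴴ (γτ - (γτ)ᴴ) (C τ + D) = τ - τᴴ`. -/
theorem denom_conj_moebius (γ : Sp n) (τ : HalfSpace n) :
    (denom γ τ.1)ᴴ * (moebius γ τ.1 - (moebius γ τ.1)ᴴ) * denom γ τ.1 = τ.1 - τ.1ᴴ := by
  rw [← denom_conj_mul_numer γ τ.1, ← moebius_mul_denom γ τ, conjTranspose_mul]
  noncomm_ring

theorem moebius_mem (γ : Sp n) (τ : HalfSpace n) :
    (moebius γ τ.1).IsSymm ∧ ((moebius γ τ.1).map Complex.im).PosDef := by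
  refine ⟨moebius_isSymm γ τ, (posDef_im_iff (moebius_isSymm γ τ)).2 fun x hx => ?_⟩
  have hu : IsUnit (denom γ τ.1).det := (detFactor_ne_zero γ τ).isUnit
  set y := (denom γ τ.1)⁻¹ *ᵥ x with hy
  have hxy : x = denom γ τ.1 *ᵥ y := by
    rw [hy, mulVec_mulVec, mul_nonsing_inv _ hu, one_mulVec]
  have hy0 : y ≠ 0 := by
    intro h; apply hx; rw [hxy, h, mulVec_zero]
  have h1 := (posDef_im_iff τ.2.1).1 τ.2.2 y hy0
  rw [← denom_conj_moebius γ τ, ← mulVec_mulVec, ← hxy, ← mulVec_mulVec, dotProduct_mulVec,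
    ← star_mulVec, ← hxy] at h1
  exact h1

/-- The action of `Sp_n(ℤ)` on the Siegel upper half-space. -/
noncomputable def act (γ : Sp n) (τ : HalfSpace n) : HalfSpace n := ⟨moebius γ τ.1, moebius_mem γ τ⟩

theorem denom_mul (γ δ : Sp n) (τ : HalfSpace n) :
    denom (γ * δ) τ.1 = denom γ (moebius δ τ.1) * denom δ τ.1 := by
  rw [denom, blockC_mul, blockD_mul, castMat_add, castMat_add, castMat_mul, castMat_mul,
    castMat_mul, castMat_mul, denom, add_mul (_ * moebius δ τ.1), Matrix.mul_assoc,
    moebius_mul_denom]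
  simp only [numer, denom]
  noncomm_ring

theorem numer_mul (γ δ : Sp n) (τ : HalfSpace n) :
    numer (γ * δ) τ.1 = numer γ (moebius δ τ.1) * denom δ τ.1 := by
  rw [numer, blockA_mul, blockB_mul, castMat_add, castMat_add, castMat_mul, castMat_mul,
    castMat_mul, castMat_mul, numer, add_mul (_ * moebius δ τ.1), Matrix.mul_assoc,
    moebius_mul_denom]
  simp only [numer, denom]
  noncomm_ring

theorem detFactor_mul (γ δ : Sp n) (τ : HalfSpace n) :
    detFactor (γ * δ) τ.1 = detFactor γ (act δ τ).1 * detFactor δ τ.1 := by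
  rw [detFactor_eq, denom_mul, det_mul]; rfl

theorem moebius_mul (γ δ : Sp n) (τ : HalfSpace n) :
    moebius (γ * δ) τ.1 = moebius γ (act δ τ).1 := by
  have hu : IsUnit (denom δ τ.1).det := (detFactor_ne_zero δ τ).isUnit
  rw [moebius_eq, numer_mul, denom_mul, Matrix.mul_inv_rev, ← Matrix.mul_assoc,
    Matrix.mul_assoc (numer γ _), mul_nonsing_inv _ hu, mul_one]
  rfl

theorem slash_mul (k : ℕ) (f : Matrix (Fin n) (Fin n) ℂ → ℂ) (γ δ : Sp n) (τ : HalfSpace n) :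
    slash k f (γ * δ) τ.1 = (detFactor δ τ.1 ^ k)⁻¹ * slash k f γ (act δ τ).1 := by
  simp only [slash, detFactor_mul, moebius_mul, mul_pow, mul_inv]
  ring

end HalfSpaceAction

/-! ### Sums over right cosets -/

section Cosets

variable {G : Type*} [Group G] {H K : Subgroup G}

theorem rep_mem (c : RightCosets H K) : rep c ∈ K := (Quotient.out c : K).2

/-- The class in `H \ K` of an element of `K`. -/
def cosetOf (H : Subgroup G) {K : Subgroup G} (x : K) : RightCosets H K := Quotient.mk _ x

theorem cosetOf_eq_iff {x y : K} :
    cosetOf H x = cosetOf H y ↔ (x : G) * (y : G)⁻¹ ∈ H := by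
  rw [cosetOf, cosetOf, eq_comm, Quotient.eq, QuotientGroup.rightRel_apply,
    Subgroup.mem_subgroupOf]
  rfl

theorem cosetOf_rep (c : RightCosets H K) : cosetOf H ⟨rep c, rep_mem c⟩ = c :=
  Quotient.out_eq c

theorem apply_rep_cosetOf {α : Type*} {F : G → α}
    (hF : ∀ h ∈ H, ∀ g ∈ K, F (h * g) = F g) (x : K) : F (rep (cosetOf H x)) = F x := by
  have h := cosetOf_eq_iff.1 (cosetOf_rep (cosetOf H x))
  have := hF _ h x x.2
  rwa [inv_mul_cancel_right] at this

/-- A permutation of `K` that respects the cosets of `H` permutes `H \ K`. -/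
def cosetEquiv (σ : K ≃ K)
    (hσ : ∀ x y : K, (x : G) * (y : G)⁻¹ ∈ H ↔ (σ x : G) * (σ y : G)⁻¹ ∈ H) :
    RightCosets H K ≃ RightCosets H K :=
  Quotient.congr σ fun x y => by
    change (QuotientGroup.rightRel _) x y ↔ (QuotientGroup.rightRel _) (σ x) (σ y)
    rw [QuotientGroup.rightRel_apply, QuotientGroup.rightRel_apply, Subgroup.mem_subgroupOf,
      Subgroup.mem_subgroupOf]
    exact hσ y x

theorem apply_rep_cosetEquiv {α : Type*} {F : G → α}
    (hF : ∀ h ∈ H, ∀ g ∈ K, F (h * g) = F g) (σ : K ≃ K)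
    (hσ : ∀ x y : K, (x : G) * (y : G)⁻¹ ∈ H ↔ (σ x : G) * (σ y : G)⁻¹ ∈ H)
    (c : RightCosets H K) :
    F (rep (cosetEquiv σ hσ c)) = F (σ ⟨rep c, rep_mem c⟩) := by
  conv_lhs => rw [← cosetOf_rep c]
  exact apply_rep_cosetOf hF (σ ⟨rep c, rep_mem c⟩)

end Cosets

/-! ### Congruence subgroups and the character -/

section Congruence

variable {n N : ℕ}

theorem mem_Gamma0 {γ : Sp n} : γ ∈ Gamma0 n N ↔ castMat (ZMod N) (blockC γ) = 0 := Iff.rfl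

theorem mem_GammaN {γ : Sp n} : γ ∈ GammaN n N ↔
    castMat (ZMod N) (blockA γ) = 1 ∧ castMat (ZMod N) (blockB γ) = 0 ∧
    castMat (ZMod N) (blockC γ) = 0 ∧ castMat (ZMod N) (blockD γ) = 1 := by
  rw [GammaN, MonoidHom.mem_ker]
  change (γ : Matrix (Fin n ⊕ Fin n) (Fin n ⊕ Fin n) ℤ).map (Int.cast : ℤ → ZMod N) = 1 ↔ _
  rw [coe_eq_blocks γ, fromBlocks_map, ← fromBlocks_one, fromBlocks_inj]

theorem GammaN_le_Gamma0 : GammaN n N ≤ Gamma0 n N := fun _ h => (mem_GammaN.1 h).2.2.1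

instance GammaN_normal : (GammaN n N).Normal := by
  unfold GammaN; infer_instance

instance GammaN_finiteIndex [NeZero N] : (GammaN n N).FiniteIndex := by
  have h : GammaN n N = (reduceMod n N).toHomUnits.ker := by
    ext x
    rw [GammaN, MonoidHom.mem_ker, MonoidHom.mem_ker, ← Units.val_inj]
    rfl
  rw [h]
  infer_instance

instance finite_rightCosets [NeZero N] :
    Finite (RightCosets (GammaN n N) (Gamma0 n N)) :=
  Finite.of_equiv _ (QuotientGroup.quotientRightRelEquivQuotientLeftRel _).symm

theorem relIndex_ne_zero [NeZero N] (K : Subgroup (Sp n)) : (GammaN n N).relIndex K ≠ 0 :=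
  (inferInstance : ((GammaN n N).subgroupOf K).FiniteIndex).index_ne_zero

theorem charVal_mul (χ : DirichletCharacter ℂ N) {a b : Sp n} (ha : a ∈ Gamma0 n N) :
    charVal χ (a * b) = charVal χ a * charVal χ b := by
  have h : ((blockD (a * b)).det : ZMod N)
      = ((blockD a).det : ZMod N) * ((blockD b).det : ZMod N) := by
    rw [← castMat_det, ← castMat_det, ← castMat_det, blockD_mul, castMat_add, castMat_mul,
      castMat_mul, mem_Gamma0.1 ha, zero_mul, zero_add, det_mul]
  rw [charVal, h, map_mul]; rfl

theorem charVal_GammaN (χ : DirichletCharacter ℂ N) {a : Sp n} (ha : a ∈ GammaN n N) :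
    charVal χ a = 1 := by
  rw [charVal, ← castMat_det, (mem_GammaN.1 ha).2.2.2, det_one, map_one]

theorem detFactor_GammaInfPlus_mul {p : Sp n} (hp : p ∈ GammaInfPlus n) (γ : Sp n)
    (τ : Matrix (Fin n) (Fin n) ℂ) : detFactor (p * γ) τ = detFactor γ τ := by
  have hD : castMat ℂ (blockC p) = 0 := by rw [hp.1, castMat_zero]
  have h1 : ((blockD p).det : ℂ) = 1 := by
    have := cast_det_mul_of_blockC ℂ p hD
    rwa [hp.2, Int.cast_one, one_mul] at this
  rw [detFactor_eq, denom, blockC_mul, blockD_mul, hp.1, zero_mul, zero_mul, zero_add, zero_add,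
    castMat_mul, castMat_mul, Matrix.mul_assoc, ← mul_add, det_mul, castMat_det, h1, one_mul]
  rfl

theorem blockA_gammaPM : blockA (gammaPM n) = Gpm n := by
  rw [blockA, gammaPM, toBlocks_fromBlocks₁₁]

theorem blockC_gammaPM : blockC (gammaPM n) = 0 := by
  rw [blockC, gammaPM, toBlocks_fromBlocks₂₁]

theorem blockD_gammaPM : blockD (gammaPM n) = Gpm n := by
  rw [blockD, gammaPM, toBlocks_fromBlocks₂₂]

theorem gammaPM_mem_Gamma0 : gammaPM n ∈ Gamma0 n N := by
  rw [mem_Gamma0, blockC_gammaPM, castMat_zero]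

theorem gammaPM_conj_mem {p : Sp n} (hp : p ∈ GammaInfPlus n) :
    gammaPM n * p * (gammaPM n)⁻¹ ∈ GammaInfPlus n := by
  refine ⟨?_, ?_⟩
  · rw [blockC_mul, blockC_mul, blockC_inv, hp.1, blockC_gammaPM]
    simp
  · have h2 : (Gpm n)ᵀ = Gpm n := diagonal_transpose _
    rw [blockA_mul, blockA_mul, blockC_inv, blockC_gammaPM, hp.1, blockA_inv, blockD_gammaPM,
      blockA_gammaPM, h2]
    simp only [mul_zero, add_zero, transpose_zero, neg_zero]
    rw [det_mul_right_comm, Gpm_mul_self, one_mul, hp.2]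

end Congruence

/-! ### Invariance of `𝔼*` -/

section Estar

variable {n k N : ℕ}

/-- `𝔼* | g` is the sum of `1 | δ* g`, whether or not the series converges. -/
theorem slash_Estar (g : Sp n) (τ : HalfSpace n) :
    slash k (Estar n k N) g τ.1
      = ∑' c : RightCosets (GammaInfPlus n) (GammaN n N), (detFactor (rep c * g) τ.1 ^ k)⁻¹ := by
  rw [slash, Estar, ← tsum_mul_left]
  refine tsum_congr fun c => ?_
  rw [slash, detFactor_mul, mul_one, mul_pow, mul_inv, mul_comm]
  rfl

theorem slash_Estar_GammaN_mul {ν : Sp n} (hν : ν ∈ GammaN n N) (g : Sp n) (τ : HalfSpace n) :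
    slash k (Estar n k N) (ν * g) τ.1 = slash k (Estar n k N) g τ.1 := by
  rw [slash_Estar, slash_Estar]
  set F : Sp n → ℂ := fun x => (detFactor (x * g) τ.1 ^ k)⁻¹ with hFdef
  have hF : ∀ h ∈ GammaInfPlus n, ∀ x ∈ GammaN n N, F (h * x) = F x := by
    intro h hh x _
    simp only [hFdef, mul_assoc, detFactor_GammaInfPlus_mul hh]
  rw [← (cosetEquiv (H := GammaInfPlus n) (Equiv.mulRight (⟨ν, hν⟩ : GammaN n N))
    (fun x y => by simp [mul_assoc])).tsum_eq (fun c => F (rep c))]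
  refine tsum_congr fun c => ?_
  rw [apply_rep_cosetEquiv hF]
  simp [hFdef, mul_assoc]

theorem slash_Estar_GammaInfPlus_mul {p : Sp n} (hp : p ∈ GammaInfPlus n) (g : Sp n)
    (τ : HalfSpace n) :
    slash k (Estar n k N) (p * g) τ.1 = slash k (Estar n k N) g τ.1 := by
  rw [slash_Estar, slash_Estar]
  set F : Sp n → ℂ := fun x => (detFactor (x * g) τ.1 ^ k)⁻¹ with hFdef
  have hF : ∀ h ∈ GammaInfPlus n, ∀ x ∈ GammaN n N, F (h * x) = F x := by
    intro h hh x _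
    simp only [hFdef, mul_assoc, detFactor_GammaInfPlus_mul hh]
  let σ : GammaN n N ≃ GammaN n N := ((MulAut.conjNormal (p⁻¹) : MulAut (GammaN n N))).toEquiv
  have hσ : ∀ x : GammaN n N, (σ x : Sp n) = p⁻¹ * x * p := fun x => by
    simp [σ]
  rw [← (cosetEquiv (H := GammaInfPlus n) σ (fun x y => by
    rw [hσ, hσ]
    have e : p⁻¹ * (x : Sp n) * p * (p⁻¹ * (y : Sp n) * p)⁻¹ = p⁻¹ * (x * (y : Sp n)⁻¹) * p := by
      group
    rw [e]
    constructor
    · intro h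
      exact mul_mem (mul_mem (inv_mem hp) h) hp
    · intro h
      have := mul_mem (mul_mem hp h) (inv_mem hp)
      have e2 : p * (p⁻¹ * (x * (y : Sp n)⁻¹) * p) * p⁻¹ = x * (y : Sp n)⁻¹ := by group
      rwa [e2] at this)).tsum_eq (fun c => F (rep c))]
  refine tsum_congr fun c => ?_
  rw [apply_rep_cosetEquiv hF, hσ]
  simp only [hFdef, mul_assoc, detFactor_GammaInfPlus_mul (inv_mem hp)]

/-- One of the two finite sums defining `𝔼'_γ`: they are the cases `h = 1` and `h = γ_±`. -/
noncomputable def twistedSum (k : ℕ) (χ : DirichletCharacter ℂ N) (h γ : Sp n)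
    (τ : Matrix (Fin n) (Fin n) ℂ) : ℂ :=
  ∑ᶠ c : RightCosets (GammaN n N) (Gamma0 n N),
    starRingEnd ℂ (charVal χ (h * rep c)) * slash k (Estar n k N) (h * γ * rep c) τ

theorem Eprime_eq (χ : DirichletCharacter ℂ N) (γ : Sp n) (τ : Matrix (Fin n) (Fin n) ℂ) :
    Eprime k χ γ τ = twistedSum k χ 1 γ τ + twistedSum k χ (gammaPM n) γ τ := by
  simp only [Eprime, twistedSum, one_mul]

/-- Translating the summation variable by an element `δ` of the stabiliser multiplies the sum by
`χ̄(δ)`. -/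
theorem twistedSum_eq_mul (χ : DirichletCharacter ℂ N) {h γ δ : Sp n} (hh : h ∈ Gamma0 n N)
    (hδ : δ ∈ Gamma0 n N) (hp : h * (γ * δ * γ⁻¹) * h⁻¹ ∈ GammaInfPlus n) (τ : HalfSpace n) :
    twistedSum k χ h γ τ.1 = starRingEnd ℂ (charVal χ δ) * twistedSum k χ h γ τ.1 := by
  set F : Sp n → ℂ := fun β =>
    starRingEnd ℂ (charVal χ (h * β)) * slash k (Estar n k N) (h * γ * β) τ.1 with hFdef
  have hF : ∀ ν ∈ GammaN n N, ∀ β ∈ Gamma0 n N, F (ν * β) = F β := by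
    intro ν hν β _
    have e : h * γ * (ν * β) = h * γ * ν * (h * γ)⁻¹ * (h * γ * β) := by group
    simp only [hFdef]
    rw [e, slash_Estar_GammaN_mul (GammaN_normal.conj_mem ν hν _), charVal_mul χ hh,
      charVal_mul χ hh, charVal_mul χ (GammaN_le_Gamma0 hν), charVal_GammaN χ hν, one_mul]
  have hδF : ∀ β ∈ Gamma0 n N, F (δ * β) = starRingEnd ℂ (charVal χ δ) * F β := by
    intro β _
    have e : h * γ * (δ * β) = h * (γ * δ * γ⁻¹) * h⁻¹ * (h * γ * β) := by group
    simp only [hFdef]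
    rw [e, slash_Estar_GammaInfPlus_mul hp, charVal_mul χ hh,
      charVal_mul χ hh, charVal_mul χ hδ]
    simp only [map_mul]
    ring
  have hσ : ∀ x y : Gamma0 n N, (x : Sp n) * (y : Sp n)⁻¹ ∈ GammaN n N ↔
      (Equiv.mulLeft (⟨δ, hδ⟩ : Gamma0 n N) x : Sp n)
        * (Equiv.mulLeft (⟨δ, hδ⟩ : Gamma0 n N) y : Sp n)⁻¹ ∈ GammaN n N := by
    intro x y
    have e : (δ * x : Sp n) * (δ * y)⁻¹ = δ * (x * (y : Sp n)⁻¹) * δ⁻¹ := by group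
    change _ ↔ (δ * x : Sp n) * (δ * y)⁻¹ ∈ _
    rw [e]
    refine ⟨fun H => GammaN_normal.conj_mem _ H _, fun H => ?_⟩
    have := GammaN_normal.conj_mem _ H δ⁻¹
    rwa [inv_inv, show δ⁻¹ * (δ * (x * (y : Sp n)⁻¹) * δ⁻¹) * δ = x * (y : Sp n)⁻¹ by
      group] at this
  calc twistedSum k χ h γ τ.1
      = ∑ᶠ c : RightCosets (GammaN n N) (Gamma0 n N), F (rep c) := rfl
    _ = ∑ᶠ c : RightCosets (GammaN n N) (Gamma0 n N), F (rep (cosetEquiv _ hσ c)) :=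
      (finsum_comp_equiv (cosetEquiv _ hσ) (f := fun c => F (rep c))).symm
    _ = ∑ᶠ c : RightCosets (GammaN n N) (Gamma0 n N),
          starRingEnd ℂ (charVal χ δ) • F (rep c) := by
      refine finsum_congr fun c => ?_
      rw [apply_rep_cosetEquiv hF]
      exact hδF _ (rep_mem c)
    _ = starRingEnd ℂ (charVal χ δ) * twistedSum k χ h γ τ.1 := (smul_finsum _ _).symm

/-- If `𝔼_γ` does not vanish, then `χ` is trivial on the `δ ∈ Γ₀(N)` with
`γ δ γ⁻¹ ∈ Γ_∞⁺`. -/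
theorem charVal_eq_one_of_eisenstein_ne_zero {χ : DirichletCharacter ℂ N} {γ : Sp n}
    (hE : eisenstein k χ γ ≠ 0) {δ : Sp n} (hδ : δ ∈ Gamma0 n N)
    (hp : γ * δ * γ⁻¹ ∈ GammaInfPlus n) : charVal χ δ = 1 := by
  by_contra hne
  apply hE
  funext τ
  have hne' : starRingEnd ℂ (charVal χ δ) ≠ 1 := by
    intro h
    apply hne
    simpa using congrArg (starRingEnd ℂ) h
  have h1 := twistedSum_eq_mul (k := k) χ (one_mem (Gamma0 n N)) hδ (by simpa using hp) τ
  have h2 := twistedSum_eq_mul (k := k) χ gammaPM_mem_Gamma0 hδ (gammaPM_conj_mem hp) τ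
  have z : ∀ s t : ℂ, t ≠ 1 → s = t * s → s = 0 := by
    intro s t ht h
    have : (1 - t) * s = 0 := by linear_combination h
    rcases mul_eq_zero.1 this with h | h
    · exact absurd (by linear_combination -h) ht
    · exact h
  rw [eisenstein, Eprime_eq, z _ _ hne' h1, z _ _ hne' h2, add_zero, mul_zero]
  rfl

end Estar

/-! ### Local components of the character -/

section Component

variable {d N : ℕ}

theorem component_apply (χ : DirichletCharacter ℂ N) (h : ExactDvd d N) (u : (ZMod d)ˣ) :
    component χ h u = χ (unitsEmbed h u : (ZMod N)ˣ) := by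
  rw [component, MulChar.ofUnitHom_coe]
  rfl

theorem castHom_unitsEmbed (h : ExactDvd d N) (u : (ZMod d)ˣ) :
    ZMod.castHom h.1 (ZMod d) (unitsEmbed h u : (ZMod N)ˣ) = u := by
  have h1 : ((ZMod.castHom h.1 (ZMod d)).comp
        (ZMod.ringEquivCongr (Nat.mul_div_cancel' h.1)).toRingHom)
      = (RingHom.fst _ _).comp (ZMod.chineseRemainder h.2).toRingHom :=
    Subsingleton.elim _ _
  refine (RingHom.congr_fun h1 ((ZMod.chineseRemainder h.2).symm (↑u, 1))).trans ?_
  change (ZMod.chineseRemainder h.2 ((ZMod.chineseRemainder h.2).symm (↑u, 1))).1 = _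
  rw [RingEquiv.apply_symm_apply]

theorem castHom_unitsEmbed_compl (h : ExactDvd d N) (u : (ZMod d)ˣ) :
    ZMod.castHom (Nat.div_dvd_of_dvd h.1) (ZMod (N / d)) (unitsEmbed h u : (ZMod N)ˣ) = 1 := by
  have h1 : ((ZMod.castHom (Nat.div_dvd_of_dvd h.1) (ZMod (N / d))).comp
        (ZMod.ringEquivCongr (Nat.mul_div_cancel' h.1)).toRingHom)
      = (RingHom.snd _ _).comp (ZMod.chineseRemainder h.2).toRingHom :=
    Subsingleton.elim _ _
  refine (RingHom.congr_fun h1 ((ZMod.chineseRemainder h.2).symm (↑u, 1))).trans ?_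
  change (ZMod.chineseRemainder h.2 ((ZMod.chineseRemainder h.2).symm (↑u, 1))).2 = _
  rw [RingEquiv.apply_symm_apply]

theorem intCast_eq_of_exactDvd (h : ExactDvd d N) {a b : ℤ}
    (h1 : (a : ZMod d) = b) (h2 : (a : ZMod (N / d)) = b) : (a : ZMod N) = b := by
  rw [ZMod.intCast_eq_intCast_iff_dvd_sub] at *
  have h3 := (Nat.Coprime.isCoprime h.2).mul_dvd h1 h2
  rwa [← Nat.cast_mul, Nat.mul_div_cancel' h.1] at h3

end Component

/-! ### Diagonal matrices as products of transvections -/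

section Transvections

variable {n : ℕ} {R : Type*} [CommRing R]

/-- A product of transvections in the `(i, j)`-plane which is `diag(u, v)` as soon as `u v = 1`. -/
def torusElt (i j : Fin n) (u v : R) : Matrix (Fin n) (Fin n) R :=
  transvection i j u * (transvection j i (-v) * (transvection i j u *
    (transvection i j (-1) * (transvection j i 1 * transvection i j (-1)))))

theorem det_torusElt {i j : Fin n} (hij : i ≠ j) (u v : R) : (torusElt i j u v).det = 1 := by
  simp only [torusElt, det_mul, det_transvection_of_ne i j hij, det_transvection_of_ne j i hij.symm,
    mul_one]

theorem torusElt_eq_diagonal {i j : Fin n} (hij : i ≠ j) {u v : R} (huv : u * v = 1) :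
    torusElt i j u v = diagonal fun l => if l = i then u else if l = j then v else 1 := by
  have hji := hij.symm
  have key : ∀ (a b : Fin n) (X : Matrix (Fin n) (Fin n) R) (c : R), a ≠ b → ∀ x y,
      (transvection a b c * X) x y = if x = a then X a y + c * X b y else X x y := by
    intro a b X c hab x y
    split_ifs with h
    · subst h; rw [transvection_mul_apply_same]
    · rw [transvection_mul_apply_of_ne _ _ _ _ h]
  have hT : ∀ x y, transvection i j (-1 : R) x y
      = if x = i then (1 : Matrix _ _ R) i y + -1 * (1 : Matrix _ _ R) j y
        else (1 : Matrix _ _ R) x y := by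
    intro x y
    rw [← mul_one (transvection i j (-1 : R)), key _ _ _ _ hij]
  have hvu : v * u = 1 := by rw [mul_comm, huv]
  ext x y
  rw [torusElt]
  simp only [key _ _ _ _ hij, key _ _ _ _ hji, hT, if_neg hij, if_neg hji, if_true, diagonal_apply,
    Matrix.one_apply]
  by_cases hxi : x = i
  · subst hxi
    by_cases hy : x = y
    · subst hy
      simp [hji]
      linear_combination -u * huv
    · by_cases hy' : j = y
      · subst hy'
        simp [hij]
        linear_combination huv
      · simp [hy, hy']
  · by_cases hxj : x = j
    · subst hxj
      by_cases hy : x = y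
      · subst hy
        simp [hxi, Ne.symm hxi]
      · by_cases hy' : i = y
        · subst hy'
          simp [hxi]
          linear_combination -huv
        · simp [hy, hy', hxi]
    · simp [hxi, hxj]

theorem castMat_torusElt (S : Type*) [CommRing S] (i j : Fin n) (u v : ℤ) :
    castMat S (torusElt i j u v) = torusElt i j (u : S) (v : S) := by
  have h : ∀ (a b : Fin n) (c : ℤ), castMat S (transvection a b c) = transvection a b (c : S) := by
    intro a b c
    ext x y
    simp only [transvection, Matrix.map_apply, Matrix.add_apply, Matrix.one_apply,
      Matrix.single_apply]
    push_cast
    split_ifs <;> simp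
  simp only [torusElt, castMat_mul, h]
  push_cast
  rfl

end Transvections

/-! ### Elements of the stabiliser with prescribed character value -/

section Stabiliser

variable {n N : ℕ}

/-- The element `(A, A S; 0, A⁻ᵀ)` of `Γ_∞⁺`, for `S` symmetric and `det A = 1`. -/
noncomputable def parabolicElt (A S : Matrix (Fin n) (Fin n) ℤ) (hA : A.det = 1) (hS : S.IsSymm) : Sp n :=
  ⟨fromBlocks A (A * S) 0 (A⁻¹)ᵀ, by
    have h1 : Aᵀ * (A⁻¹)ᵀ = 1 := by
      rw [← transpose_mul, nonsing_inv_mul _ (by rw [hA]; exact isUnit_one), transpose_one]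
    have h2 : A⁻¹ * A = 1 := nonsing_inv_mul _ (by rw [hA]; exact isUnit_one)
    rw [SymplecticGroup.mem_iff', J, fromBlocks_transpose, fromBlocks_multiply,
      fromBlocks_multiply]
    simp [h1, h2, hS.eq, Matrix.mul_assoc, ← Matrix.mul_assoc (A⁻¹)]⟩

theorem parabolicElt_mem (A S : Matrix (Fin n) (Fin n) ℤ) (hA : A.det = 1) (hS : S.IsSymm) :
    parabolicElt A S hA hS ∈ GammaInfPlus n := by
  refine ⟨?_, ?_⟩
  · rw [blockC, parabolicElt, toBlocks_fromBlocks₂₁]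
  · rw [blockA, parabolicElt, toBlocks_fromBlocks₁₁, hA]

theorem blockA_gammaLower (M : Matrix (Fin n) (Fin n) ℤ) (hM : M.IsSymm) :
    blockA (gammaLower M hM) = 1 := by rw [blockA, gammaLower, toBlocks_fromBlocks₁₁]

theorem blockB_gammaLower (M : Matrix (Fin n) (Fin n) ℤ) (hM : M.IsSymm) :
    blockB (gammaLower M hM) = 0 := by rw [blockB, gammaLower, toBlocks_fromBlocks₁₂]

theorem blockC_gammaLower (M : Matrix (Fin n) (Fin n) ℤ) (hM : M.IsSymm) :
    blockC (gammaLower M hM) = M := by rw [blockC, gammaLower, toBlocks_fromBlocks₂₁]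

theorem blockD_gammaLower (M : Matrix (Fin n) (Fin n) ℤ) (hM : M.IsSymm) :
    blockD (gammaLower M hM) = 1 := by rw [blockD, gammaLower, toBlocks_fromBlocks₂₂]

theorem blockC_conj_gammaLower (M : Matrix (Fin n) (Fin n) ℤ) (hM : M.IsSymm) (p : Sp n) :
    blockC ((gammaLower M hM)⁻¹ * p * gammaLower M hM)
      = blockC p + blockD p * M - M * (blockA p + blockB p * M) := by
  rw [blockC_mul, blockC_mul, blockD_mul, blockC_inv, blockD_inv, blockA_gammaLower,
    blockC_gammaLower, transpose_one, hM.eq]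
  noncomm_ring

theorem blockD_conj_gammaLower (M : Matrix (Fin n) (Fin n) ℤ) (hM : M.IsSymm) (p : Sp n) :
    blockD ((gammaLower M hM)⁻¹ * p * gammaLower M hM) = blockD p - M * blockB p := by
  rw [blockD_mul, blockD_mul, blockC_inv, blockD_inv, blockA_gammaLower, blockB_gammaLower,
    blockD_gammaLower, blockC_gammaLower, transpose_one, hM.eq]
  noncomm_ring

theorem rankMod_eq {q d : ℕ} (hq : q.Prime) {M : Matrix (Fin n) (Fin n) ℤ} (hd : d ≤ n)
    (h : M.map (Int.cast : ℤ → ZMod q) = diagonal fun i : Fin n => if (i : ℕ) < d then 1 else 0) :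
    rankMod q M = d := by
  have := Fact.mk hq
  rw [rankMod, h, rank_diagonal]
  have e : {i : Fin n // (if (i : ℕ) < d then (1 : ZMod q) else 0) ≠ 0} ≃ Fin d :=
    { toFun := fun i => ⟨i.1, by
        by_contra hlt
        exact i.2 (if_neg hlt)⟩
      invFun := fun i => ⟨⟨i, i.2.trans_le hd⟩, by simp⟩
      left_inv := fun i => rfl
      right_inv := fun i => rfl }
  rw [Fintype.card_congr e, Fintype.card_fin]

/-- If `0 < rank_q M < n`, then every `u ∈ (ℤ/q)ˣ`, viewed modulo `N` as being `1` modulo `N / q`,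
has a square which is `det D` for some `δ ∈ Γ₀(N)` with `γ_σ δ γ_σ⁻¹ ∈ Γ_∞⁺`. The element is a
product of an element of `SL₂` in a plane where `M ≡ 1` and one in a plane where `M ≡ 0`; their
contributions to `det A` cancel, while those to `det D` add up. -/
theorem exists_mem_stabiliser {M : Matrix (Fin n) (Fin n) ℤ} (hM : IsRepMatrix N M)
    {q : ℕ} (hq : q.Prime) (hqN : ExactDvd q N) (h0 : 0 < rankMod q M) (hn : rankMod q M < n)
    (u : (ZMod q)ˣ) : ∃ δ ∈ Gamma0 n N,
      gammaLower M hM.isSymm * δ * (gammaLower M hM.isSymm)⁻¹ ∈ GammaInfPlus n ∧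
      ((blockD δ).det : ZMod N) = (unitsEmbed hqN u : (ZMod N)ˣ) ^ 2 := by
  obtain ⟨d, hd, hMd⟩ := hM.congr_mod q hq hqN
  rw [rankMod_eq hq hd hMd] at h0 hn
  obtain ⟨x, hx⟩ := ZMod.intCast_surjective ((unitsEmbed hqN u : (ZMod N)ˣ) : ZMod N)
  obtain ⟨y, hy⟩ := ZMod.intCast_surjective (((unitsEmbed hqN u)⁻¹ : (ZMod N)ˣ) : ZMod N)
  have hxy : (x : ZMod N) * y = 1 := by rw [hx, hy, Units.mul_inv]
  have hcast : ∀ {m : ℕ} (hm : m ∣ N), (x : ZMod m) * y = 1 := by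
    intro m hm
    have := congrArg (ZMod.castHom hm (ZMod m)) hxy
    rwa [map_mul, map_intCast, map_intCast, map_one] at this
  have hx1 : (x : ZMod (N / q)) = 1 := by
    rw [← castHom_unitsEmbed_compl hqN u, ← hx, map_intCast]
  have hy1 : (y : ZMod (N / q)) = 1 := by
    have := hcast (Nat.div_dvd_of_dvd hqN.1)
    rwa [hx1, one_mul] at this
  have hnpos : 0 < n := h0.trans hn
  let i : Fin n := ⟨0, hnpos⟩
  let j : Fin n := ⟨n - 1, by omega⟩
  have hij : i ≠ j := by
    intro h
    have := congrArg Fin.val h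
    simp only [i, j] at this
    omega
  set S : Matrix (Fin n) (Fin n) ℤ := diagonal fun l => if l = i then y ^ 2 - 1 else 0 with hSdef
  have hS : S.IsSymm := diagonal_transpose _
  set A : Matrix (Fin n) (Fin n) ℤ := torusElt i j x y with hAdef
  have hA : A.det = 1 := det_torusElt hij x y
  set p := parabolicElt A S hA hS with hp
  have hpA : blockA p = A := by rw [blockA, hp, parabolicElt, toBlocks_fromBlocks₁₁]
  have hpB : blockB p = A * S := by rw [blockB, hp, parabolicElt, toBlocks_fromBlocks₁₂]
  have hpC : blockC p = 0 := (parabolicElt_mem A S hA hS).1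
  have hcA : ∀ {m : ℕ} (_ : m ∣ N), castMat (ZMod m) A
      = diagonal fun l => if l = i then (x : ZMod m) else if l = j then (y : ZMod m) else 1 := by
    intro m hm
    rw [hAdef, castMat_torusElt, torusElt_eq_diagonal hij (hcast hm)]
  have hcD : ∀ {m : ℕ} (_ : m ∣ N), castMat (ZMod m) (blockD p)
      = diagonal fun l => if l = i then (y : ZMod m) else if l = j then (x : ZMod m) else 1 := by
    intro m hm
    have h1 := cast_DA (ZMod m) p
    rw [hpC, castMat_zero, zero_mul, sub_zero, hpA, hcA hm, diagonal_transpose] at h1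
    have h2 := congrArg (fun X => X * diagonal fun l => if l = i then (y : ZMod m) else
      if l = j then (x : ZMod m) else 1) h1
    simp only [Matrix.mul_assoc, diagonal_mul_diagonal, one_mul] at h2
    rw [← h2]
    conv_lhs => rw [← mul_one (castMat (ZMod m) (blockD p)), ← diagonal_one]
    congr 2
    funext l
    have := hcast hm
    split_ifs
    · exact this.symm
    · rw [mul_comm]; exact this.symm
    · rw [one_mul]
  have hcS : ∀ {m : ℕ}, castMat (ZMod m) S
      = diagonal fun l => if l = i then (y : ZMod m) ^ 2 - 1 else 0 := by
    intro m
    rw [hSdef]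
    ext a b
    simp only [Matrix.map_apply, diagonal_apply]
    split_ifs <;> simp
  -- Modulo `q` all blocks are diagonal.
  have hMq : castMat (ZMod q) M = diagonal fun l : Fin n => if (l : ℕ) < d then 1 else 0 := hMd
  have hxyq := hcast hqN.1
  have hCq : castMat (ZMod q) (blockC ((gammaLower M hM.isSymm)⁻¹ * p * gammaLower M hM.isSymm))
      = 0 := by
    rw [blockC_conj_gammaLower, hpC, hpA, hpB, zero_add, castMat_sub, castMat_mul, castMat_mul,
      castMat_add, castMat_mul, castMat_mul, hcA hqN.1, hcD hqN.1, hcS, hMq]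
    simp only [diagonal_mul_diagonal, diagonal_add, diagonal_sub]
    rw [← diagonal_zero]
    congr 1
    funext l
    by_cases hl : l = i
    · subst hl
      simp only [i, h0, if_true]
      linear_combination -y * hxyq
    · by_cases hl' : l = j
      · have : ¬ ((l : ℕ) < d) := by
          rw [hl']; simp only [j]; omega
        simp [this]
      · simp only [hl, hl', if_false]
        split_ifs <;> simp
  have hDq : castMat (ZMod q) (blockD ((gammaLower M hM.isSymm)⁻¹ * p * gammaLower M hM.isSymm))
      = diagonal fun l => if l = i then (x : ZMod q) else if l = j then (x : ZMod q) else 1 := by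
    rw [blockD_conj_gammaLower, hpB, castMat_sub, castMat_mul, castMat_mul, hcA hqN.1, hcD hqN.1,
      hcS, hMq]
    simp only [diagonal_mul_diagonal, diagonal_sub]
    congr 1
    funext l
    by_cases hl : l = i
    · subst hl
      simp only [i, h0, if_true]
      linear_combination -y * hxyq
    · simp [hl]
  -- Modulo `N / q` everything is trivial.
  have hdvd := Nat.div_dvd_of_dvd hqN.1
  have hA1 : castMat (ZMod (N / q)) A = 1 := by
    rw [hcA hdvd, ← diagonal_one]; congr 1; funext l; rw [hx1, hy1]; split_ifs <;> rfl
  have hD1 : castMat (ZMod (N / q)) (blockD p) = 1 := by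
    rw [hcD hdvd, ← diagonal_one]; congr 1; funext l; rw [hx1, hy1]; split_ifs <;> rfl
  have hS1 : castMat (ZMod (N / q)) S = 0 := by
    rw [hcS, ← diagonal_zero]; congr 1; funext l; rw [hy1]; split_ifs <;> ring
  have hC1 : castMat (ZMod (N / q))
      (blockC ((gammaLower M hM.isSymm)⁻¹ * p * gammaLower M hM.isSymm)) = 0 := by
    rw [blockC_conj_gammaLower, hpC, hpA, hpB, zero_add, castMat_sub, castMat_mul, castMat_mul,
      castMat_add, castMat_mul, castMat_mul, hA1, hD1, hS1]
    simp
  have hDD1 : castMat (ZMod (N / q))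
      (blockD ((gammaLower M hM.isSymm)⁻¹ * p * gammaLower M hM.isSymm)) = 1 := by
    rw [blockD_conj_gammaLower, hpB, castMat_sub, castMat_mul, castMat_mul, hD1, hS1]
    simp
  refine ⟨(gammaLower M hM.isSymm)⁻¹ * p * gammaLower M hM.isSymm, ?_, ?_, ?_⟩
  · rw [mem_Gamma0]
    ext a b
    have e1 := congrFun (congrFun hCq a) b
    have e2 := congrFun (congrFun hC1 a) b
    exact (intCast_eq_of_exactDvd hqN (b := 0) (e1.trans Int.cast_zero.symm)
      (e2.trans Int.cast_zero.symm)).trans Int.cast_zero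
  · have : gammaLower M hM.isSymm * ((gammaLower M hM.isSymm)⁻¹ * p * gammaLower M hM.isSymm)
        * (gammaLower M hM.isSymm)⁻¹ = p := by group
    rw [this]
    exact parabolicElt_mem A S hA hS
  · rw [← hx, ← Int.cast_pow]
    refine intCast_eq_of_exactDvd hqN ?_ ?_
    · rw [← castMat_det, hDq, det_diagonal, Finset.prod_ite, Finset.prod_const,
        Finset.filter_eq' Finset.univ i, if_pos (Finset.mem_univ _), Finset.card_singleton,
        Finset.prod_ite, Finset.prod_const_one, mul_one, Finset.prod_const]
      have : Finset.filter (fun l => l = j) (Finset.filter (fun l => ¬ l = i) Finset.univ)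
          = {j} := by
        ext l
        simp only [Finset.mem_filter, Finset.mem_univ, true_and, Finset.mem_singleton]
        exact ⟨fun h => h.2, fun h => ⟨h ▸ hij.symm, h⟩⟩
      rw [this, Finset.card_singleton]
      push_cast
      ring
    · rw [← castMat_det, hDD1, det_one]
      push_cast
      rw [hx1, one_pow]

theorem component_sq_eq_one_of_eisenstein_ne_zero {k : ℕ} {χ : DirichletCharacter ℂ N}
    {M : Matrix (Fin n) (Fin n) ℤ} (hM : IsRepMatrix N M)
    (hE : eisenstein k χ (gammaLower M hM.isSymm) ≠ 0) {q : ℕ} (hq : q.Prime)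
    (hqN : ExactDvd q N) (h0 : 0 < rankMod q M) (hn : rankMod q M < n) :
    component χ hqN ^ 2 = 1 := by
  refine MulChar.ext fun u => ?_
  obtain ⟨δ, hδ, hp, hdet⟩ := exists_mem_stabiliser hM hq hqN h0 hn u
  have h1 := charVal_eq_one_of_eisenstein_ne_zero hE hδ hp
  rw [charVal, hdet, map_pow] at h1
  rw [MulChar.pow_apply_coe, component_apply, h1, MulChar.one_apply_coe]

end Stabiliser

/-! ### The character on the stabiliser for square-free level -/

section SquarefreeLevel

variable {n N : ℕ}

theorem zmod_ext_of_squarefree (hN : Squarefree N) {a b : ZMod N}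
    (h : ∀ (q : ℕ) (_ : q.Prime) (hq : q ∣ N),
      ZMod.castHom hq (ZMod q) a = ZMod.castHom hq (ZMod q) b) : a = b := by
  obtain ⟨x, rfl⟩ := ZMod.intCast_surjective a
  obtain ⟨y, rfl⟩ := ZMod.intCast_surjective b
  rw [ZMod.intCast_eq_intCast_iff_dvd_sub, ← Nat.prod_primeFactors_of_squarefree hN,
    Int.natCast_dvd]
  refine Finset.prod_primes_dvd _ (fun q hq => (Nat.prime_of_mem_primeFactors hq).prime)
    fun q hq => ?_
  have := h q (Nat.prime_of_mem_primeFactors hq) (Nat.dvd_of_mem_primeFactors hq)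
  rwa [map_intCast, map_intCast, ZMod.intCast_eq_intCast_iff_dvd_sub, Int.natCast_dvd] at this

/-- A character of square-free conductor is trivial on a unit on which all of its local components
are trivial. -/
theorem apply_eq_one_of_components (hN : Squarefree N) (χ : DirichletCharacter ℂ N)
    (w : (ZMod N)ˣ)
    (h : ∀ (q : ℕ) (_ : q.Prime) (hq : q ∣ N),
      component χ (exactDvd_of_squarefree hN hq) (ZMod.castHom hq (ZMod q) w) = 1) :
    χ w = 1 := by
  have hdvd : ∀ q : N.primeFactors, (q : ℕ) ∣ N := fun q => Nat.dvd_of_mem_primeFactors q.2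
  have hprime : ∀ q : N.primeFactors, (q : ℕ).Prime := fun q => Nat.prime_of_mem_primeFactors q.2
  let W : N.primeFactors → (ZMod N)ˣ := fun q =>
    unitsEmbed (exactDvd_of_squarefree hN (hdvd q)) (ZMod.unitsMap (hdvd q) w)
  have hw : w = ∏ q, W q := by
    apply Units.ext
    apply zmod_ext_of_squarefree hN
    intro q hq hqN
    rw [Units.coe_prod, map_prod]
    let q0 : N.primeFactors := ⟨q, Nat.mem_primeFactors.2 ⟨hq, hqN, hN.ne_zero⟩⟩
    rw [Finset.prod_eq_single q0]
    · exact (castHom_unitsEmbed (exactDvd_of_squarefree hN hqN) (ZMod.unitsMap hqN w)).symm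
    · intro r _ hr
      have hrq : (r : ℕ) ≠ q := fun e => hr (Subtype.ext e)
      have hqr : q ∣ N / r := by
        have hcop : Nat.Coprime q r := (Nat.coprime_primes hq (hprime r)).2 hrq.symm
        refine hcop.dvd_of_dvd_mul_left ?_
        rwa [Nat.mul_div_cancel' (hdvd r)]
      have h1 := castHom_unitsEmbed_compl (exactDvd_of_squarefree hN (hdvd r))
        (ZMod.unitsMap (hdvd r) w)
      have h2 := congrArg (ZMod.castHom hqr (ZMod q)) h1
      rw [map_one, ← RingHom.comp_apply] at h2
      rw [← h2]
      exact RingHom.congr_fun (Subsingleton.elim _ _) _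
    · intro h; exact absurd (Finset.mem_univ _) h
  rw [hw, Units.coe_prod, map_prod]
  refine Finset.prod_eq_one fun q _ => ?_
  rw [← component_apply]
  exact h q (hprime q) (hdvd q)

/-- Linear algebra modulo a prime `q ∣ N`: if `(A, B; 0, D)` is conjugated by `(1, 0; E, 1)`, where
`E` is the diagonal matrix with entries `1` at `p` and `0` elsewhere, to an element with vanishing
lower left block, then all blocks are triangular with respect to `p`. -/
theorem det_sub_diagonal_mul {ι F : Type*} [Fintype ι] [DecidableEq ι] [CommRing F]
    (p : ι → Prop) [DecidablePred p] {A B D : Matrix ι ι F} {ε : F} (hε : ε ^ 2 = 1)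
    (hAD : A * Dᵀ = 1) (hA : A.det = ε)
    (hC : D * diagonal (fun i => if p i then 1 else 0)
      - diagonal (fun i => if p i then 1 else 0) *
        (A + B * diagonal (fun i => if p i then 1 else 0)) = 0) :
    ∃ x : Fˣ, (D - diagonal (fun i => if p i then 1 else 0) * B).det * ε = (x : F) ^ 2 ∧
      ((∀ i, p i) ∨ (∀ i, ¬ p i) → (x : F) ^ 2 = 1) := by
  have hC' : ∀ i j, D i j * (if p j then 1 else 0)
      = (if p i then 1 else 0) * (A i j + B i j * (if p j then 1 else 0)) := by
    intro i j
    have := congrFun (congrFun hC i) j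
    rw [Matrix.sub_apply, mul_diagonal, diagonal_mul, Matrix.add_apply, mul_diagonal,
      Matrix.zero_apply, sub_eq_zero] at this
    exact this
  have hD0 : ∀ i, ¬ p i → ∀ j, p j → D i j = 0 := by
    intro i hi j hj
    simpa [hi, hj] using hC' i j
  have hA0 : ∀ i, p i → ∀ j, ¬ p j → A i j = 0 := by
    intro i hi j hj
    simpa [hi, hj] using (hC' i j).symm
  have hDA : ∀ i, p i → ∀ j, p j → D i j = A i j + B i j := by
    intro i hi j hj
    simpa [hi, hj] using hC' i j
  set X := D - diagonal (fun i => if p i then 1 else 0) * B with hX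
  have hXij : ∀ i j, X i j = D i j - (if p i then 1 else 0) * B i j := by
    intro i j; rw [hX, Matrix.sub_apply, diagonal_mul]
  have hdetA := twoBlockTriangular_det' A p hA0
  have hdetX := twoBlockTriangular_det X p (by
    intro i hi j hj
    rw [hXij, hD0 i hi j hj]; simp [hi])
  have hXA : toSquareBlockProp X p = toSquareBlockProp A p := by
    ext ⟨i, hi⟩ ⟨j, hj⟩
    change X i j = A i j
    rw [hXij, hDA i hi j hj]; simp [hi]
  have hXD : toSquareBlockProp X (fun i => ¬ p i) = toSquareBlockProp D (fun i => ¬ p i) := by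
    ext ⟨i, hi⟩ ⟨j, hj⟩
    change X i j = D i j
    rw [hXij]; simp [hi]
  rw [hXA, hXD] at hdetX
  have hyz : (toSquareBlockProp A fun i => ¬ p i).det
      * (toSquareBlockProp D fun i => ¬ p i).det = 1 := by
    rw [← det_transpose (toSquareBlockProp D _), ← det_mul,
      ← det_one (n := {i // ¬ p i}) (R := F)]
    congr 1
    ext ⟨i, hi⟩ ⟨j, hj⟩
    have h1 := congrFun (congrFun hAD i) j
    rw [Matrix.mul_apply] at h1 ⊢
    have h2 : ∑ l, A i l * Dᵀ l j = ∑ l : {l // ¬ p l}, A i l * Dᵀ l j := by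
      rw [← Fintype.sum_subtype_add_sum_subtype p]
      rw [Finset.sum_eq_zero (s := (Finset.univ : Finset {l // p l})), zero_add]
      intro l _
      rw [transpose_apply, hD0 j hj l l.2, mul_zero]
    change ∑ l : {l // ¬ p l}, A i l * D j l = _
    simp only [transpose_apply] at h2 h1
    rw [← h2, h1, Matrix.one_apply, Matrix.one_apply]
    simp
  set x := (toSquareBlockProp A p).det with hx
  set y := (toSquareBlockProp A fun i => ¬ p i).det with hy
  set z := (toSquareBlockProp D fun i => ¬ p i).det with hz
  rw [hA] at hdetA
  have hxu : x * (y * ε) = 1 := by rw [← mul_assoc, ← hdetA, ← sq, hε]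
  refine ⟨Units.mkOfMulEqOne x (y * ε) hxu, ?_, ?_⟩
  · rw [hdetX, Units.val_mkOfMulEqOne]
    linear_combination x * z * hdetA + x ^ 2 * hyz
  · rw [Units.val_mkOfMulEqOne]
    rintro (hp | hp)
    · have : IsEmpty {i // ¬ p i} := ⟨fun i => i.2 (hp i)⟩
      have hy1 : y = 1 := by rw [hy, det_isEmpty]
      rw [hy1, mul_one] at hdetA
      rw [← hdetA, hε]
    · have : IsEmpty {i // p i} := ⟨fun i => hp i i.2⟩
      rw [hx, det_isEmpty, one_pow]

/-- If `γ_σ δ γ_σ⁻¹` is, modulo `N`, of the form `(A, B; 0, D)` with `det A = ε = ±1`, then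
`χ(δ) = χ(ε)`, provided that `χ_q² = 1` at the primes where `M` is neither invertible nor zero. -/
theorem charVal_eq_of_conj (hN : Squarefree N) (χ : DirichletCharacter ℂ N)
    {M : Matrix (Fin n) (Fin n) ℤ} (hM : IsRepMatrix N M)
    (hχ : ∀ (q : ℕ) (_ : q.Prime) (hqN : q ∣ N), 0 < rankMod q M → rankMod q M < n →
      component χ (exactDvd_of_squarefree hN hqN) ^ 2 = 1)
    {δ : Sp n} (hδ : δ ∈ Gamma0 n N) {ε : ℤ} (hε : ε ^ 2 = 1)
    (hC : castMat (ZMod N)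
      (blockC (gammaLower M hM.isSymm * δ * (gammaLower M hM.isSymm)⁻¹)) = 0)
    (hA : ((blockA (gammaLower M hM.isSymm * δ * (gammaLower M hM.isSymm)⁻¹)).det : ZMod N) = ε) :
    charVal χ δ = χ (ε : ZMod N) := by
  set σ := gammaLower M hM.isSymm * δ * (gammaLower M hM.isSymm)⁻¹ with hσ
  have hδσ : δ = (gammaLower M hM.isSymm)⁻¹ * σ * gammaLower M hM.isSymm := by
    rw [hσ]; group
  have hε' : ∀ m : ℕ, ((ε : ZMod m)) ^ 2 = 1 := fun m => by
    rw [← Int.cast_pow, hε, Int.cast_one]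
  have hunit : ((blockD δ).det * ε : ZMod N) * ((blockA δ).det * ε) = 1 := by
    linear_combination (ε : ZMod N) ^ 2 * cast_det_mul_of_blockC (ZMod N) δ hδ + hε' N
  let w : (ZMod N)ˣ := Units.mkOfMulEqOne _ _ hunit
  have hw : (w : ZMod N) = (blockD δ).det * ε := rfl
  have h1 : χ w = 1 := by
    refine apply_eq_one_of_components hN χ w fun q hq hqN => ?_
    have hcast : ∀ {X Y : Matrix (Fin n) (Fin n) ℤ}, castMat (ZMod N) X = castMat (ZMod N) Y →
        castMat (ZMod q) X = castMat (ZMod q) Y := by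
      intro X Y h
      ext i j
      have := congrArg (ZMod.castHom hqN (ZMod q)) (congrFun (congrFun h i) j)
      change ZMod.castHom hqN (ZMod q) ((X i j : ℤ) : ZMod N)
        = ZMod.castHom hqN (ZMod q) ((Y i j : ℤ) : ZMod N) at this
      rwa [map_intCast, map_intCast] at this
    have hCq : castMat (ZMod q) (blockC σ) = 0 := by
      rw [← castMat_zero]; apply hcast; rw [hC, castMat_zero]
    have hCδq : castMat (ZMod q) (blockC δ) = 0 := by
      rw [← castMat_zero]; apply hcast; rw [castMat_zero]; exact hδ
    have hAq : (castMat (ZMod q) (blockA σ)).det = ε := by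
      have := congrArg (ZMod.castHom hqN (ZMod q)) hA
      rwa [map_intCast, map_intCast, ← castMat_det] at this
    obtain ⟨d, hd, hMd⟩ := hM.congr_mod q hq (exactDvd_of_squarefree hN hqN)
    have hMq : castMat (ZMod q) M = diagonal fun l : Fin n => if (l : ℕ) < d then 1 else 0 := hMd
    have hAD := cast_AD (ZMod q) σ
    rw [hCq, transpose_zero, mul_zero, sub_zero] at hAD
    have hC2 := hCδq
    rw [hδσ, blockC_conj_gammaLower, castMat_sub, castMat_add, castMat_mul, castMat_mul,
      castMat_add, castMat_mul, hCq, zero_add, hMq] at hC2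
    obtain ⟨x, hx, hx1⟩ := det_sub_diagonal_mul (fun l : Fin n => (l : ℕ) < d) (hε' q) hAD hAq hC2
    have hwx : ZMod.castHom hqN (ZMod q) w = ((x ^ 2 : (ZMod q)ˣ) : ZMod q) := by
      rw [hw, map_mul, map_intCast, map_intCast, ← castMat_det, Units.val_pow_eq_pow_val, ← hx,
        ← hMq, ← castMat_mul, ← castMat_sub, ← blockD_conj_gammaLower M hM.isSymm, ← hδσ]
    rw [hwx]
    by_cases hmid : 0 < d ∧ d < n
    · have h2 := hχ q hq hqN (by rw [rankMod_eq hq hd hMd]; exact hmid.1)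
        (by rw [rankMod_eq hq hd hMd]; exact hmid.2)
      rw [Units.val_pow_eq_pow_val, map_pow, ← MulChar.pow_apply_coe, h2, MulChar.one_apply_coe]
    · have h3 : (x : ZMod q) ^ 2 = 1 := by
        apply hx1
        rcases Nat.eq_zero_or_pos d with h0 | h0
        · right; intro i; rw [h0]; exact Nat.not_lt_zero _
        · left; intro i
          have : ¬ d < n := fun h => hmid ⟨h0, h⟩
          have := i.2
          omega
      rw [Units.val_pow_eq_pow_val, h3, map_one]
  rw [hw, map_mul] at h1
  have h2 : χ (ε : ZMod N) * χ (ε : ZMod N) = 1 := by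
    rw [← map_mul, ← sq, hε' N, map_one]
  calc charVal χ δ = χ ((blockD δ).det : ZMod N) * (χ (ε : ZMod N) * χ (ε : ZMod N)) := by
        rw [h2, mul_one]; rfl
    _ = χ (ε : ZMod N) := by rw [← mul_assoc, h1, one_mul]

end SquarefreeLevel

open scoped ComplexOrder ENNReal

/-! ### The automorphy factor on the imaginary axis -/

section ImaginaryAxis

variable {n : ℕ}

theorem one_add_sum_le_prod_one_add {ι : Type*} (s : Finset ι) {f : ι → ℝ} (hf : ∀ i, 0 ≤ f i) :
    1 + ∑ i ∈ s, f i ≤ ∏ i ∈ s, (1 + f i) := by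
  classical
  induction s using Finset.induction_on with
  | empty => simp
  | insert a s ha ih =>
    rw [Finset.sum_insert ha, Finset.prod_insert ha]
    have h1 : 0 ≤ ∑ i ∈ s, f i := Finset.sum_nonneg fun i _ => hf i
    nlinarith [hf a, mul_nonneg (hf a) h1]

/-- `det (1 + S) ≥ 1 + tr S` for `S` positive semidefinite. -/
theorem one_add_trace_le_det {ι : Type*} [Fintype ι] [DecidableEq ι] {S : Matrix ι ι ℂ}
    (hS : S.PosSemidef) : 1 + S.trace.re ≤ ‖(1 + S).det‖ := by
  have h1 : (1 + S).det = (-1) ^ Fintype.card ι * S.charpoly.eval (-1) := by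
    rw [Matrix.eval_charpoly, ← det_neg]
    congr 1
    ext i j
    simp [Matrix.scalar_apply, ← smul_one_eq_diagonal]
    ring
  have h2 : ‖(1 + S).det‖ = ∏ i, (1 + hS.isHermitian.eigenvalues i) := by
    rw [h1, norm_mul, norm_pow, norm_neg, norm_one, one_pow, one_mul, hS.isHermitian.charpoly_eq,
      Polynomial.eval_prod, norm_prod]
    refine Finset.prod_congr rfl fun i _ => ?_
    have h3 : (Polynomial.eval (-1 : ℂ) (Polynomial.X
        - Polynomial.C ((hS.isHermitian.eigenvalues i : ℝ) : ℂ)))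
        = -((1 + hS.isHermitian.eigenvalues i : ℝ) : ℂ) := by
      simp; ring
    refine (congrArg norm h3).trans ?_
    rw [norm_neg, Complex.norm_real, Real.norm_of_nonneg]
    linarith [hS.eigenvalues_nonneg i]
  have h4 : S.trace.re = ∑ i, hS.isHermitian.eigenvalues i := by
    rw [hS.isHermitian.trace_eq_sum_eigenvalues]
    simp
  rw [h2, h4]
  exact one_add_sum_le_prod_one_add _ fun i => hS.eigenvalues_nonneg i

/-- The point `i y I` of the half-space. -/
noncomputable def imagPoint (n : ℕ) (y : ℝ) (hy : 0 < y) : HalfSpace n :=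
  ⟨(Complex.I * y) • 1, by
    refine ⟨?_, ?_⟩
    · rw [Matrix.IsSymm, transpose_smul, transpose_one]
    · have h : (((Complex.I * y) • (1 : Matrix (Fin n) (Fin n) ℂ)).map Complex.im)
          = diagonal fun _ => y := by
        ext i j
        by_cases hij : i = j
        · subst hij; simp
        · simp [hij]
      rw [h]
      exact Matrix.PosDef.diagonal fun _ => hy⟩

/-- The point `i I` of the half-space. -/
noncomputable abbrev basePoint (n : ℕ) : HalfSpace n := imagPoint n 1 one_pos

theorem denom_imagPoint (γ : Sp n) (y : ℝ) (hy : 0 < y) :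
    denom γ (imagPoint n y hy).1
      = (Complex.I * y) • castMat ℂ (blockC γ) + castMat ℂ (blockD γ) := by
  change castMat ℂ (blockC γ) * ((Complex.I * y) • 1) + _ = _
  rw [Matrix.mul_smul, mul_one]

theorem denom_basePoint (γ : Sp n) :
    denom γ (basePoint n).1 = Complex.I • castMat ℂ (blockC γ) + castMat ℂ (blockD γ) := by
  rw [denom_imagPoint, Complex.ofReal_one, mul_one]

theorem denom_mul_conjTranspose (γ : Sp n) (y : ℝ) (hy : 0 < y) :
    denom γ (imagPoint n y hy).1 * (denom γ (imagPoint n y hy).1)ᴴ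
      = ((y : ℂ) ^ 2) • (castMat ℂ (blockC γ) * (castMat ℂ (blockC γ))ᵀ)
        + castMat ℂ (blockD γ) * (castMat ℂ (blockD γ))ᵀ := by
  rw [denom_imagPoint, conjTranspose_add, conjTranspose_smul, castMat_conjTranspose,
    castMat_conjTranspose, add_mul, mul_add, mul_add, smul_mul_smul_comm, Matrix.smul_mul,
    Matrix.mul_smul, cast_CD ℂ γ]
  have h1 : star (Complex.I * (y : ℂ)) = -(Complex.I * y) := by
    simp
  have h2 : Complex.I * (y : ℂ) * -(Complex.I * y) = (y : ℂ) ^ 2 := by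
    linear_combination (-(y : ℂ) ^ 2) * Complex.I_sq
  rw [h1, h2, neg_smul]
  abel

/-- The comparison of the automorphy factors at `i y I` and `i I`. -/
theorem norm_detFactor_imagPoint_sq (γ : Sp n) (y : ℝ) (hy : 0 < y) :
    ‖detFactor γ (imagPoint n y hy).1‖ ^ 2 = ‖detFactor γ (basePoint n).1‖ ^ 2 *
      ‖(1 + ((y : ℂ) ^ 2 - 1) • (((denom γ (basePoint n).1)⁻¹ * castMat ℂ (blockC γ)) *
        ((denom γ (basePoint n).1)⁻¹ * castMat ℂ (blockC γ))ᴴ)).det‖ := by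
  have hu : IsUnit (denom γ (basePoint n).1).det := (detFactor_ne_zero γ (basePoint n)).isUnit
  have hG := denom_mul_conjTranspose γ 1 one_pos
  have hy2 := denom_mul_conjTranspose γ y hy
  rw [detFactor_eq, detFactor_eq]
  set P := denom γ (basePoint n).1 with hP
  set C := castMat ℂ (blockC γ)
  have hPP : P * (P⁻¹ * C) = C := by rw [← Matrix.mul_assoc, mul_nonsing_inv _ hu, one_mul]
  have key : denom γ (imagPoint n y hy).1 * (denom γ (imagPoint n y hy).1)ᴴ
      = P * (1 + ((y : ℂ) ^ 2 - 1) • ((P⁻¹ * C) * (P⁻¹ * C)ᴴ)) * Pᴴ := by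
    rw [hy2, mul_add, mul_one, add_mul, Matrix.mul_smul, Matrix.smul_mul, ← Matrix.mul_assoc P,
      hPP, Matrix.mul_assoc C, ← conjTranspose_mul, hPP, castMat_conjTranspose, hG]
    rw [Complex.ofReal_one, one_pow, one_smul, sub_smul, one_smul]
    abel
  have h := congrArg (fun X => ‖X.det‖) key
  simp only [det_mul, det_conjTranspose, norm_mul, norm_star] at h
  rw [sq, h]
  ring

theorem posSemidef_smul_mul_conjTranspose {ι κ : Type*} [Fintype ι] [Fintype κ]
    {t : ℝ} (ht : 0 ≤ t) (K : Matrix ι κ ℂ) : ((t : ℂ) • (K * Kᴴ)).PosSemidef :=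
  (posSemidef_self_mul_conjTranspose K).smul (by exact_mod_cast ht)

theorem norm_detFactor_imagPoint_sq_ge (γ : Sp n) {y : ℝ} (hy : 1 ≤ y) :
    ‖detFactor γ (basePoint n).1‖ ^ 2 * (1 + (y ^ 2 - 1) *
        ((((denom γ (basePoint n).1)⁻¹ * castMat ℂ (blockC γ)) *
        ((denom γ (basePoint n).1)⁻¹ * castMat ℂ (blockC γ))ᴴ).trace).re)
      ≤ ‖detFactor γ (imagPoint n y (one_pos.trans_le hy)).1‖ ^ 2 := by
  rw [norm_detFactor_imagPoint_sq γ y]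
  refine mul_le_mul_of_nonneg_left ?_ (sq_nonneg _)
  have ht : 0 ≤ y ^ 2 - 1 := by nlinarith
  have h := one_add_trace_le_det (posSemidef_smul_mul_conjTranspose ht
    ((denom γ (basePoint n).1)⁻¹ * castMat ℂ (blockC γ)))
  rw [trace_smul, smul_eq_mul, Complex.re_ofReal_mul] at h
  push_cast at h
  exact h

theorem trace_mul_conjTranspose_re_nonneg {ι κ : Type*} [Fintype ι] [Fintype κ]
    (K : Matrix ι κ ℂ) : 0 ≤ (K * Kᴴ).trace.re :=
  (Complex.nonneg_iff.1 (posSemidef_self_mul_conjTranspose K).trace_nonneg).1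

theorem trace_mul_conjTranspose_re_pos {ι κ : Type*} [Fintype ι] [Fintype κ]
    {K : Matrix ι κ ℂ} (hK : K ≠ 0) : 0 < (K * Kᴴ).trace.re := by
  refine lt_of_le_of_ne (trace_mul_conjTranspose_re_nonneg K) fun h => hK ?_
  have h1 := Complex.nonneg_iff.1 (posSemidef_self_mul_conjTranspose K).trace_nonneg
  rw [← trace_mul_conjTranspose_self_eq_zero_iff]
  exact Complex.ext h.symm h1.2.symm

theorem norm_detFactor_le_imagPoint (γ : Sp n) {y : ℝ} (hy : 1 ≤ y) :
    ‖detFactor γ (basePoint n).1‖ ≤ ‖detFactor γ (imagPoint n y (one_pos.trans_le hy)).1‖ := by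
  refine le_of_sq_le_sq ?_ (norm_nonneg _)
  refine le_trans ?_ (norm_detFactor_imagPoint_sq_ge γ hy)
  have h := trace_mul_conjTranspose_re_nonneg
    ((denom γ (basePoint n).1)⁻¹ * castMat ℂ (blockC γ))
  have ht : 0 ≤ y ^ 2 - 1 := by nlinarith
  exact le_mul_of_one_le_right (sq_nonneg _) (by linarith [mul_nonneg ht h])

/-- The sequence of points `i (m + 1) I` along which the constant term is computed. -/
noncomputable abbrev seqPoint (n m : ℕ) : HalfSpace n :=
  imagPoint n ((m : ℝ) + 1) (by positivity)

theorem tendsto_norm_detFactor (γ : Sp n) (hC : blockC γ ≠ 0) :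
    Filter.Tendsto (fun m : ℕ => ‖detFactor γ (seqPoint n m).1‖) Filter.atTop Filter.atTop := by
  set K := (denom γ (basePoint n).1)⁻¹ * castMat ℂ (blockC γ) with hK
  have hu : IsUnit (denom γ (basePoint n).1).det := (detFactor_ne_zero γ (basePoint n)).isUnit
  have hK0 : K ≠ 0 := by
    intro h
    apply hC
    have h1 : castMat ℂ (blockC γ) = 0 := by
      rw [← one_mul (castMat ℂ (blockC γ)), ← mul_nonsing_inv _ hu, Matrix.mul_assoc, ← hK, h,
        mul_zero]
    ext i j
    have := congrFun (congrFun h1 i) j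
    change ((blockC γ i j : ℤ) : ℂ) = 0 at this
    exact_mod_cast this
  have ht := trace_mul_conjTranspose_re_pos hK0
  set t := (K * Kᴴ).trace.re
  set H := ‖detFactor γ (basePoint n).1‖ with hH
  have hHpos : 0 < H := norm_pos_iff.2 (detFactor_ne_zero γ _)
  have hlow : ∀ m : ℕ, H ^ 2 * t * m ≤ ‖detFactor γ (seqPoint n m).1‖ ^ 2 := by
    intro m
    have hm : (0 : ℝ) ≤ m := Nat.cast_nonneg m
    have h1 := norm_detFactor_imagPoint_sq_ge γ (y := (m : ℝ) + 1) (by linarith)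
    refine le_trans ?_ h1
    rw [mul_assoc]
    refine mul_le_mul_of_nonneg_left ?_ (sq_nonneg _)
    change t * m ≤ 1 + (((m : ℝ) + 1) ^ 2 - 1) * t
    nlinarith [mul_nonneg ht.le hm, mul_nonneg ht.le (mul_nonneg hm hm)]
  have h2 : Filter.Tendsto (fun m : ℕ => ‖detFactor γ (seqPoint n m).1‖ ^ 2)
      Filter.atTop Filter.atTop := by
    refine Filter.tendsto_atTop_mono hlow ?_
    exact Filter.Tendsto.const_mul_atTop (by positivity) tendsto_natCast_atTop_atTop
  have h3 := Real.tendsto_sqrt_atTop.comp h2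
  refine h3.congr fun m => ?_
  simp [Real.sqrt_sq]

theorem detFactor_of_blockC_eq_zero {γ : Sp n} (hC : blockC γ = 0)
    (τ : Matrix (Fin n) (Fin n) ℂ) : detFactor γ τ = ((blockD γ).det : ℤ) := by
  rw [detFactor_eq, denom, hC, castMat_zero, zero_mul, zero_add, castMat_det]

end ImaginaryAxis

/-! ### Counting lattice points by integer parts -/

section Counting

variable {n : ℕ}

theorem tsum_pi_prod (n : ℕ) (G : ℤ → ℝ≥0∞) :
    ∑' z : Fin n → ℤ, ∏ i, G (z i) = (∑' m, G m) ^ n := by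
  induction n with
  | zero => rw [tsum_eq_single (default : Fin 0 → ℤ) (fun b hb => absurd (Subsingleton.elim _ _) hb)]
            simp
  | succ n ih =>
    rw [← (Fin.consEquiv (fun _ : Fin (n + 1) => ℤ)).tsum_eq, ENNReal.tsum_prod', pow_succ', ← ih,
      ← ENNReal.tsum_mul_right]
    refine tsum_congr fun m => ?_
    rw [← ENNReal.tsum_mul_left]
    refine tsum_congr fun z => ?_
    rw [Fin.prod_univ_succ]
    rfl

/-- If `W` is a nonsingular integral matrix, each unit cube contains `|det W|` points of
`W⁻¹ ℤⁿ`. -/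
theorem tsum_floor_le {W : Matrix (Fin n) (Fin n) ℤ} (hW : W.det ≠ 0)
    {y : (Fin n → ℤ) → Fin n → ℝ}
    (hy : ∀ a, castMat ℝ W *ᵥ y a = fun i => (a i : ℝ)) (F : (Fin n → ℤ) → ℝ≥0∞) :
    ∑' a : Fin n → ℤ, F (fun i => ⌊y a i⌋) ≤ W.det.natAbs * ∑' z, F z := by
  have hinj : Function.Injective W.mulVecLin := by
    intro v w hvw
    have : W *ᵥ v = W *ᵥ w := hvw
    exact mulVec_injective_of_det_ne_zero hW this
  set N : Submodule ℤ (Fin n → ℤ) := LinearMap.range W.mulVecLin with hN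
  let e : (Fin n → ℤ) ≃ₗ[ℤ] N := LinearEquiv.ofInjective W.mulVecLin hinj
  have hcard : Nat.card ((Fin n → ℤ) ⧸ N) = W.det.natAbs := by
    rw [← Submodule.natAbs_det_equiv N e]
    congr 1
    rw [← LinearMap.det_toLin' W]
    congr 1
  have hfin : Finite ((Fin n → ℤ) ⧸ N) :=
    Nat.finite_of_card_ne_zero (by rw [hcard]; exact Int.natAbs_ne_zero.2 hW)
  have hWR : (castMat ℝ W).det ≠ 0 := by
    rw [castMat_det]; exact_mod_cast hW
  let φ : (Fin n → ℤ) → ((Fin n → ℤ) ⧸ N) × (Fin n → ℤ) := fun a =>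
    (Submodule.Quotient.mk a, fun i => ⌊y a i⌋)
  have hφ : Function.Injective φ := by
    intro a b hab
    obtain ⟨h1, h2⟩ := Prod.ext_iff.1 hab
    obtain ⟨z, hz⟩ := (Submodule.Quotient.eq N).1 h1
    have hz' : W *ᵥ z = a - b := hz
    have h3 : y a = y b + fun i => (z i : ℝ) := by
      apply mulVec_injective_of_det_ne_zero hWR
      rw [mulVec_add, hy, hy]
      ext i
      have := congrFun hz' i
      rw [Pi.sub_apply, eq_sub_iff_add_eq'] at this
      rw [← this]
      simp [mulVec, dotProduct]
    have h4 : z = 0 := by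
      ext i
      have h5 := congrFun h2 i
      change ⌊y a i⌋ = ⌊y b i⌋ at h5
      rw [h3, Pi.add_apply, Int.floor_add_intCast] at h5
      simpa using h5
    rw [h4, mulVec_zero] at hz'
    exact (sub_eq_zero.1 hz'.symm)
  calc ∑' a : Fin n → ℤ, F (fun i => ⌊y a i⌋) = ∑' a, (fun p : _ × (Fin n → ℤ) => F p.2) (φ a) := rfl
    _ ≤ ∑' p : ((Fin n → ℤ) ⧸ N) × (Fin n → ℤ), F p.2 :=
      ENNReal.tsum_comp_le_tsum_of_injective hφ _
    _ = W.det.natAbs * ∑' z, F z := by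
      rw [ENNReal.tsum_prod']
      simp only [ENNReal.tsum_const]
      rw [ENat.card_eq_coe_natCard, hcard]
      rfl

theorem inv_one_add_sq_le_floor (y : ℝ) :
    (1 + y ^ 2)⁻¹ ≤ 3 * (1 + (⌊y⌋ : ℝ) ^ 2)⁻¹ := by
  rw [← div_eq_mul_inv, le_div_iff₀ (by positivity), inv_mul_le_iff₀ (by positivity)]
  have h1 := Int.floor_le y
  have h2 := Int.lt_floor_add_one y
  nlinarith [sq_nonneg (y + (y - ⌊y⌋)), sq_nonneg (y - ⌊y⌋)]

/-- The value of `3 ∑_{m ∈ ℤ} 1 / (1 + m²)`. -/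
noncomputable def floorConst : ℝ≥0∞ := ∑' m : ℤ, ENNReal.ofReal (3 * (1 + (m : ℝ) ^ 2)⁻¹)

theorem floorConst_ne_top : floorConst ≠ ∞ := by
  have h : Summable fun m : ℤ => 3 * (1 + (m : ℝ) ^ 2)⁻¹ := by
    refine Summable.mul_left 3 ?_
    refine Summable.of_norm_bounded_eventually (g := fun m : ℤ => 1 / (m : ℝ) ^ 2)
      (Real.summable_one_div_int_pow.2 (by norm_num)) ?_
    rw [Filter.eventually_cofinite]
    refine (Set.finite_singleton (0 : ℤ)).subset ?_
    intro m hm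
    by_contra h0
    apply hm
    have : (m : ℝ) ≠ 0 := by exact_mod_cast h0
    rw [Real.norm_of_nonneg (by positivity), one_div]
    exact inv_anti₀ (by positivity) (by linarith)
  exact h.tsum_ofReal_ne_top

/-- A Riemann sum estimate: `∑_j (1 / Q) / (1 + (j / Q + x)²)` is bounded uniformly in `Q` and
`x`. -/
theorem tsum_shift_le (Q : ℕ) (x : ℝ) :
    ∑' j : ℤ, ENNReal.ofReal ((Q : ℝ)⁻¹ * (1 + ((j : ℝ) / Q + x) ^ 2)⁻¹) ≤ floorConst := by
  rcases Nat.eq_zero_or_pos Q with rfl | hQ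
  · simp
  have : NeZero Q := ⟨hQ.ne'⟩
  have hQR : (0 : ℝ) < Q := by exact_mod_cast hQ
  let φ : ℤ → ZMod Q × ℤ := fun j => ((j : ZMod Q), ⌊(j : ℝ) / Q + x⌋)
  have hφ : Function.Injective φ := by
    intro a b hab
    obtain ⟨h1, h2⟩ := Prod.ext_iff.1 hab
    obtain ⟨z, hz⟩ := (ZMod.intCast_eq_intCast_iff_dvd_sub b a Q).1 h1.symm
    have h3 : (a : ℝ) / Q + x = (b : ℝ) / Q + x + z := by
      have : (a : ℝ) = b + Q * z := by
        have := congrArg (Int.cast : ℤ → ℝ) hz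
        push_cast at this
        linarith
      rw [this]
      field_simp
      ring
    change ⌊(a : ℝ) / Q + x⌋ = ⌊(b : ℝ) / Q + x⌋ at h2
    rw [h3, Int.floor_add_intCast] at h2
    have hz0 : z = 0 := by simpa using h2
    rw [hz0, mul_zero] at hz
    linarith
  calc ∑' j : ℤ, ENNReal.ofReal ((Q : ℝ)⁻¹ * (1 + ((j : ℝ) / Q + x) ^ 2)⁻¹)
      ≤ ∑' j : ℤ, (fun p : ZMod Q × ℤ =>
          ENNReal.ofReal (Q : ℝ)⁻¹ * ENNReal.ofReal (3 * (1 + (p.2 : ℝ) ^ 2)⁻¹)) (φ j) := by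
        refine ENNReal.tsum_le_tsum fun j => ?_
        rw [ENNReal.ofReal_mul (by positivity)]
        exact mul_le_mul_right (ENNReal.ofReal_le_ofReal (inv_one_add_sq_le_floor _)) _
    _ ≤ ∑' p : ZMod Q × ℤ,
          ENNReal.ofReal (Q : ℝ)⁻¹ * ENNReal.ofReal (3 * (1 + (p.2 : ℝ) ^ 2)⁻¹) :=
        ENNReal.tsum_comp_le_tsum_of_injective hφ _
    _ = floorConst := by
      rw [ENNReal.tsum_mul_left, ENNReal.tsum_prod']
      simp only [ENNReal.tsum_const]
      rw [ENat.card_eq_coe_natCard, Nat.card_zmod, ← mul_assoc, ENNReal.ofReal_inv_of_pos hQR,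
        ENNReal.ofReal_natCast]
      have : ((Q : ℝ≥0∞))⁻¹ * (((Q : ℕ) : ℕ∞) : ℝ≥0∞) = 1 :=
        ENNReal.inv_mul_cancel (by exact_mod_cast hQ.ne') (ENNReal.natCast_ne_top Q)
      rw [this, one_mul]
      rfl

end Counting

/-! ### Comparison of the Gram form with a maximal minor -/

section MaximalMinor

variable {n : ℕ}

/-- The bottom rows `(C, D)` of a symplectic matrix. -/
def bottomRows (g : Sp n) : Matrix (Fin n) (Fin n ⊕ Fin n) ℤ := fromCols (blockC g) (blockD g)

theorem exists_minor_ne_zero (g : Sp n) :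
    ∃ f : Fin n → Fin n ⊕ Fin n, ((bottomRows g).submatrix id f).det ≠ 0 := by
  by_contra! h
  apply detFactor_ne_zero g (basePoint n)
  rw [detFactor_eq, denom_basePoint, ← det_transpose, transpose_add, transpose_smul]
  have h1 := (detRowAlternating (R := ℂ) (n := Fin n)).toMultilinearMap.map_add_univ
    (Complex.I • (castMat ℂ (blockC g))ᵀ) (castMat ℂ (blockD g))ᵀ
  refine h1.trans (Finset.sum_eq_zero fun s _ => ?_)
  set f : Fin n → Fin n ⊕ Fin n := fun j => if j ∈ s then Sum.inl j else Sum.inr j with hf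
  have h2 : s.piecewise (Complex.I • (castMat ℂ (blockC g))ᵀ) (castMat ℂ (blockD g))ᵀ
      = Matrix.of fun i j => (if i ∈ s then Complex.I else 1) *
        (castMat ℂ ((bottomRows g).submatrix id f))ᵀ i j := by
    funext i j
    by_cases hi : i ∈ s
    · simp [hi, hf, bottomRows, Finset.piecewise]
    · simp [hi, hf, bottomRows, Finset.piecewise]
  rw [h2]
  change det (Matrix.of fun i j => (if i ∈ s then Complex.I else 1) *
        (castMat ℂ ((bottomRows g).submatrix id f))ᵀ i j) = 0
  rw [det_mul_column, det_transpose, castMat_det, h f, Int.cast_zero, mul_zero]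

/-- The quadratic form `|(iC + D)⁻¹ a|²` attached to a symplectic matrix. -/
noncomputable def gramForm (g : Sp n) (a : Fin n → ℂ) : ℝ :=
  ∑ j, ‖((denom g (basePoint n).1)⁻¹ *ᵥ a) j‖ ^ 2

theorem gramForm_nonneg (g : Sp n) (a : Fin n → ℂ) : 0 ≤ gramForm g a :=
  Finset.sum_nonneg fun _ _ => sq_nonneg _

theorem exists_maximal_minor (g : Sp n) : ∃ W : Matrix (Fin n) (Fin n) ℤ, W.det ≠ 0 ∧
    (W.det.natAbs : ℝ) ≤ ‖detFactor g (basePoint n).1‖ ∧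
    ∀ (a y : Fin n → ℝ), castMat ℝ W *ᵥ y = a →
      ∀ i, 1 + y i ^ 2 ≤ (4 * n + 1) * (1 + gramForm g fun i => (a i : ℂ)) := by
  obtain ⟨f, hf⟩ := Finite.exists_max fun f : Fin n → Fin n ⊕ Fin n =>
    ((bottomRows g).submatrix id f).det.natAbs
  set W := (bottomRows g).submatrix id f with hWdef
  have hW : W.det ≠ 0 := by
    obtain ⟨f0, hf0⟩ := exists_minor_ne_zero g
    intro h0
    have := hf f0
    rw [h0, Int.natAbs_zero, Nat.le_zero, Int.natAbs_eq_zero] at this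
    exact hf0 this
  have hWC : (castMat ℂ W).det ≠ 0 := by rw [castMat_det]; exact_mod_cast hW
  have huW : IsUnit (castMat ℂ W).det := hWC.isUnit
  set P := denom g (basePoint n).1 with hP
  have huP : IsUnit P.det := (detFactor_ne_zero g (basePoint n)).isUnit
  -- Cramer's rule: the coordinates of the columns of `(C, D)` in terms of `W` are quotients of
  -- minors.
  have hadj : ∀ i c, ((W.adjugate * bottomRows g) i c).natAbs ≤ W.det.natAbs := by
    intro i c
    have h1 : (W.adjugate * bottomRows g) i c
        = ((bottomRows g).submatrix id (Function.update f i c)).det := by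
      have h2 : (W.adjugate * bottomRows g) i c
          = (W.adjugate *ᵥ fun l => bottomRows g l c) i := rfl
      rw [h2, ← cramer_eq_adjugate_mulVec, cramer_apply]
      congr 1
      ext l m
      by_cases hm : m = i
      · subst hm; simp
      · simp [hm, hWdef]
    rw [h1]
    exact hf _
  have hK : ∀ i j, ‖((castMat ℂ W)⁻¹ * P) i j‖ ≤ 2 := by
    intro i j
    have h1 : ((castMat ℂ W)⁻¹ * P) i j = ((W.det : ℤ) : ℂ)⁻¹ *
        (Complex.I * (((W.adjugate * bottomRows g) i (Sum.inl j) : ℤ) : ℂ)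
          + (((W.adjugate * bottomRows g) i (Sum.inr j) : ℤ) : ℂ)) := by
      have h2 : (W.adjugate * bottomRows g) i (Sum.inl j) = (W.adjugate * blockC g) i j := by
        simp [Matrix.mul_apply, bottomRows]
      have h3 : (W.adjugate * bottomRows g) i (Sum.inr j) = (W.adjugate * blockD g) i j := by
        simp [Matrix.mul_apply, bottomRows]
      have h4 : castMat ℂ W.adjugate = (castMat ℂ W).adjugate :=
        RingHom.map_adjugate (Int.castRingHom ℂ) W
      have h5 : ∀ X : Matrix (Fin n) (Fin n) ℤ,
          (((W.adjugate * X) i j : ℤ) : ℂ) = ((castMat ℂ W).adjugate * castMat ℂ X) i j := by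
        intro X
        rw [← h4, ← castMat_mul]
        rfl
      rw [h2, h3, h5, h5, inv_def, Ring.inverse_eq_inv', castMat_det, hP, denom_basePoint,
        Matrix.smul_mul, mul_add, Matrix.mul_smul]
      simp
    have hpos : 0 < (W.det.natAbs : ℝ) := by exact_mod_cast Int.natAbs_pos.2 hW
    have hn : ∀ z : ℤ, ‖(z : ℂ)‖ = (z.natAbs : ℝ) := fun z => by
      rw [Complex.norm_intCast, Nat.cast_natAbs, Int.cast_abs]
    rw [h1, norm_mul, norm_inv, hn, inv_mul_le_iff₀ hpos]
    refine (norm_add_le _ _).trans ?_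
    rw [norm_mul, Complex.norm_I, one_mul, hn, hn]
    have e1 : (((W.adjugate * bottomRows g) i (Sum.inl j)).natAbs : ℝ) ≤ W.det.natAbs := by
      exact_mod_cast hadj i _
    have e2 : (((W.adjugate * bottomRows g) i (Sum.inr j)).natAbs : ℝ) ≤ W.det.natAbs := by
      exact_mod_cast hadj i _
    linarith
  refine ⟨W, hW, ?_, ?_⟩
  · -- `P Pᴴ = (C, D) (C, D)ᵀ` dominates `W Wᵀ`.
    have hinj : Function.Injective f := by
      intro a b hab
      by_contra hne
      apply hW
      refine det_zero_of_column_eq hne fun l => ?_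
      simp [hWdef, hab]
    set Z : Matrix (Fin n) {c : Fin n ⊕ Fin n // c ∉ Set.range f} ℂ :=
      Matrix.of fun l c => ((bottomRows g l c : ℤ) : ℂ) with hZ
    have hPP : P * Pᴴ = castMat ℂ W * (castMat ℂ W)ᴴ + Z * Zᴴ := by
      rw [hP, denom_mul_conjTranspose g 1 one_pos]
      ext i j
      have e1 : ∀ c : Fin n ⊕ Fin n → ℂ, ∑ x, c x
          = ∑ l, c (f l) + ∑ x : {x // x ∉ Set.range f}, c x := by
        classical
        intro c
        rw [← Fintype.sum_subtype_add_sum_subtype (fun x => x ∈ Set.range f) c]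
        congr 1
        convert (Fintype.sum_equiv (Equiv.ofInjective f hinj) (fun l => c (f l))
          (fun x => c x.1) (fun l => rfl)).symm
      have e2 := e1 fun x => ((bottomRows g i x : ℤ) : ℂ) * ((bottomRows g j x : ℤ) : ℂ)
      rw [Fintype.sum_sum_type] at e2
      simp only [Matrix.add_apply, Matrix.mul_apply, conjTranspose_apply,
        transpose_apply, Complex.ofReal_one, one_pow, one_smul, hZ, Matrix.of_apply]
      simpa [bottomRows, hWdef] using e2
    have hfac : P * Pᴴ = castMat ℂ W * (1 + ((castMat ℂ W)⁻¹ * Z) * ((castMat ℂ W)⁻¹ * Z)ᴴ)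
        * (castMat ℂ W)ᴴ := by
      have e : castMat ℂ W * ((castMat ℂ W)⁻¹ * Z) = Z := by
        rw [← Matrix.mul_assoc, mul_nonsing_inv _ huW, Matrix.one_mul]
      rw [hPP, mul_add, mul_one, add_mul, ← Matrix.mul_assoc (castMat ℂ W), e, Matrix.mul_assoc Z,
        ← conjTranspose_mul, e]
    have h1 := congrArg (fun X => ‖X.det‖) hfac
    simp only [det_mul, det_conjTranspose, norm_mul, norm_star] at h1
    have h2 := one_add_trace_le_det
      (posSemidef_self_mul_conjTranspose ((castMat ℂ W)⁻¹ * Z))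
    have h3 := trace_mul_conjTranspose_re_nonneg ((castMat ℂ W)⁻¹ * Z)
    have h4 : ‖(castMat ℂ W).det‖ = (W.det.natAbs : ℝ) := by
      rw [castMat_det, Complex.norm_intCast, Nat.cast_natAbs, Int.cast_abs]
    rw [h4] at h1
    rw [detFactor_eq, ← hP]
    refine le_of_sq_le_sq ?_ (norm_nonneg _)
    rw [sq ‖P.det‖, h1, mul_right_comm, ← sq]
    exact le_mul_of_one_le_right (sq_nonneg _) (by linarith)
  · intro a y hy i
    have hyC : castMat ℂ W *ᵥ (fun i => (y i : ℂ)) = fun i => (a i : ℂ) := by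
      rw [← hy]
      ext i
      simp [mulVec, dotProduct]
    set b := P⁻¹ *ᵥ (fun i => (a i : ℂ)) with hb
    have h1 : (fun i => (y i : ℂ)) = ((castMat ℂ W)⁻¹ * P) *ᵥ b := by
      rw [hb, mulVec_mulVec, Matrix.mul_assoc, mul_nonsing_inv _ huP, mul_one, ← hyC,
        mulVec_mulVec, nonsing_inv_mul _ huW, one_mulVec]
    have h2 : |y i| ≤ 2 * ∑ j, ‖b j‖ := by
      have h3 := congrFun h1 i
      have h4 : |y i| = ‖(y i : ℂ)‖ := by rw [Complex.norm_real, Real.norm_eq_abs]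
      rw [h4, h3, mulVec, dotProduct, Finset.mul_sum]
      refine (norm_sum_le _ _).trans (Finset.sum_le_sum fun j _ => ?_)
      rw [norm_mul]
      exact mul_le_mul_of_nonneg_right (hK i j) (norm_nonneg _)
    have h5 : (∑ j, ‖b j‖) ^ 2 ≤ n * gramForm g fun i => (a i : ℂ) := by
      have := sq_sum_le_card_mul_sum_sq (s := (Finset.univ : Finset (Fin n))) (f := fun j => ‖b j‖)
      simpa [gramForm, hb] using this
    have h6 : y i ^ 2 ≤ (2 * ∑ j, ‖b j‖) ^ 2 := by
      rw [← sq_abs]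
      exact pow_le_pow_left₀ (abs_nonneg _) h2 2
    have h7 := gramForm_nonneg g fun i => (a i : ℂ)
    have h8 : (0 : ℝ) ≤ n := Nat.cast_nonneg n
    nlinarith

/-- The sum over `a ∈ ℤⁿ` of `(1 + |(iC + D)⁻¹ a|²)^{-m}` is at most a constant times the
covolume `|det (iC + D)|`. -/
theorem tsum_gramForm_le (g : Sp n) {m : ℕ} (hm : n ≤ m) :
    ∑' a : Fin n → ℤ, ENNReal.ofReal ((1 + gramForm g fun i => (a i : ℂ)) ^ m)⁻¹
      ≤ ENNReal.ofReal ((4 * n + 1) ^ n) * floorConst ^ n *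
        ENNReal.ofReal ‖detFactor g (basePoint n).1‖ := by
  obtain ⟨W, hW, hdet, hbound⟩ := exists_maximal_minor g
  have hWR : IsUnit (castMat ℝ W).det := by
    rw [castMat_det]
    exact (Int.cast_ne_zero.2 hW).isUnit
  set y : (Fin n → ℤ) → Fin n → ℝ := fun a => (castMat ℝ W)⁻¹ *ᵥ fun i => (a i : ℝ) with hydef
  have hy : ∀ a, castMat ℝ W *ᵥ y a = fun i => (a i : ℝ) := by
    intro a
    rw [hydef, mulVec_mulVec, mul_nonsing_inv _ hWR, one_mulVec]
  have hterm : ∀ a : Fin n → ℤ, ((1 + gramForm g fun i => (a i : ℂ)) ^ m)⁻¹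
      ≤ (4 * n + 1) ^ n * ∏ i, (3 * (1 + (⌊y a i⌋ : ℝ) ^ 2)⁻¹) := by
    intro a
    have h1 : ∀ i, 1 + y a i ^ 2 ≤ (4 * n + 1) * (1 + gramForm g fun i => (a i : ℂ)) := by
      intro i
      simpa using hbound _ _ (hy a) i
    set A := 1 + gramForm g fun i => (a i : ℂ) with hA
    have hA1 : 1 ≤ A := by
      have := gramForm_nonneg g fun i => (a i : ℂ)
      linarith
    have h2 : ∏ i, (1 + y a i ^ 2) ≤ (4 * n + 1) ^ n * A ^ m := by
      calc ∏ i, (1 + y a i ^ 2) ≤ ∏ _i : Fin n, (4 * n + 1) * A :=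
            Finset.prod_le_prod (fun i _ => by positivity) fun i _ => h1 i
        _ = (4 * n + 1) ^ n * A ^ n := by simp [mul_pow]
        _ ≤ (4 * n + 1) ^ n * A ^ m :=
            mul_le_mul_of_nonneg_left (pow_le_pow_right₀ hA1 hm) (by positivity)
    calc (A ^ m)⁻¹ ≤ (4 * n + 1) ^ n * (∏ i, (1 + y a i ^ 2))⁻¹ := by
          rw [← div_eq_mul_inv, le_div_iff₀ (Finset.prod_pos fun i _ => by positivity),
            inv_mul_le_iff₀ (by positivity), mul_comm (A ^ m)]
          exact h2
      _ = (4 * n + 1) ^ n * ∏ i, (1 + y a i ^ 2)⁻¹ := by rw [Finset.prod_inv_distrib]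
      _ ≤ _ := mul_le_mul_of_nonneg_left (Finset.prod_le_prod (fun i _ => by positivity)
            fun i _ => inv_one_add_sq_le_floor _) (by positivity)
  calc ∑' a : Fin n → ℤ, ENNReal.ofReal ((1 + gramForm g fun i => (a i : ℂ)) ^ m)⁻¹
      ≤ ∑' a : Fin n → ℤ, ENNReal.ofReal ((4 * n + 1) ^ n) *
          (fun z : Fin n → ℤ => ∏ i, ENNReal.ofReal (3 * (1 + (z i : ℝ) ^ 2)⁻¹))
            (fun i => ⌊y a i⌋) := by
        refine ENNReal.tsum_le_tsum fun a => ?_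
        refine (ENNReal.ofReal_le_ofReal (hterm a)).trans_eq ?_
        rw [ENNReal.ofReal_mul (by positivity),
          ENNReal.ofReal_prod_of_nonneg fun i _ => by positivity]
    _ ≤ ENNReal.ofReal ((4 * n + 1) ^ n) * (W.det.natAbs * floorConst ^ n) := by
        rw [ENNReal.tsum_mul_left]
        refine mul_le_mul_right ((tsum_floor_le hW hy
          (fun z => ∏ i, ENNReal.ofReal (3 * (1 + (z i : ℝ) ^ 2)⁻¹))).trans_eq ?_) _
        rw [tsum_pi_prod n fun m => ENNReal.ofReal (3 * (1 + (m : ℝ) ^ 2)⁻¹)]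
        rfl
    _ ≤ _ := by
        rw [mul_assoc, mul_comm (floorConst ^ n)]
        refine mul_le_mul_right (mul_le_mul_left ?_ _) _
        rw [← ENNReal.ofReal_natCast]
        exact ENNReal.ofReal_le_ofReal hdet

end MaximalMinor

/-! ### Lagrangian sublattices and symplectic bases -/

section Lagrangian

variable {n : ℕ}

/-- The standard symplectic form on `ℤ²ⁿ`. -/
def sympForm (x y : Fin n ⊕ Fin n → ℤ) : ℤ :=
  ∑ i, (x (Sum.inl i) * y (Sum.inr i) - x (Sum.inr i) * y (Sum.inl i))

theorem sympForm_self (x : Fin n ⊕ Fin n → ℤ) : sympForm x x = 0 :=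
  Finset.sum_eq_zero fun i _ => by ring

theorem sympForm_swap (x y : Fin n ⊕ Fin n → ℤ) : sympForm x y = -sympForm y x := by
  rw [sympForm, sympForm, ← Finset.sum_neg_distrib]
  exact Finset.sum_congr rfl fun i _ => by ring

theorem sympForm_add_left (x x' y : Fin n ⊕ Fin n → ℤ) :
    sympForm (x + x') y = sympForm x y + sympForm x' y := by
  rw [sympForm, sympForm, sympForm, ← Finset.sum_add_distrib]
  exact Finset.sum_congr rfl fun i _ => by simp only [Pi.add_apply]; ring

theorem sympForm_smul_left (a : ℤ) (x y : Fin n ⊕ Fin n → ℤ) :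
    sympForm (a • x) y = a * sympForm x y := by
  rw [sympForm, sympForm, Finset.mul_sum]
  exact Finset.sum_congr rfl fun i _ => by simp only [Pi.smul_apply, smul_eq_mul]; ring

/-- The functional `x ↦ ω(x, y)`. -/
def sympFunctional (y : Fin n ⊕ Fin n → ℤ) : (Fin n ⊕ Fin n → ℤ) →ₗ[ℤ] ℤ where
  toFun x := sympForm x y
  map_add' x x' := sympForm_add_left x x' y
  map_smul' a x := sympForm_smul_left a x y

theorem sympForm_sum_smul_left {ι : Type*} (s : Finset ι) (a : ι → ℤ)
    (x : ι → Fin n ⊕ Fin n → ℤ) (y : Fin n ⊕ Fin n → ℤ) :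
    sympForm (∑ i ∈ s, a i • x i) y = ∑ i ∈ s, a i * sympForm (x i) y := by
  have := map_sum (sympFunctional y) (fun i => a i • x i) s
  simp only [map_smul, smul_eq_mul] at this
  exact this

theorem sympForm_sum_smul_right {ι : Type*} (s : Finset ι) (a : ι → ℤ)
    (x : ι → Fin n ⊕ Fin n → ℤ) (y : Fin n ⊕ Fin n → ℤ) :
    sympForm y (∑ i ∈ s, a i • x i) = ∑ i ∈ s, a i * sympForm y (x i) := by
  rw [sympForm_swap, sympForm_sum_smul_left, ← Finset.sum_neg_distrib]
  refine Finset.sum_congr rfl fun i _ => ?_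
  rw [sympForm_swap (x i) y]; ring

/-- The symplectic form is unimodular: every functional on `ℤ²ⁿ` is `ω(x, ·)` for some `x`. -/
theorem exists_sympForm_eq (ℓ : (Fin n ⊕ Fin n → ℤ) →ₗ[ℤ] ℤ) :
    ∃ x : Fin n ⊕ Fin n → ℤ, ∀ y, sympForm x y = ℓ y := by
  refine ⟨Sum.elim (fun i => ℓ (Pi.single (Sum.inr i) 1))
    (fun i => -ℓ (Pi.single (Sum.inl i) 1)), fun y => ?_⟩
  have hy : y = ∑ c, y c • (Pi.single c 1 : Fin n ⊕ Fin n → ℤ) := by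
    ext d
    simp [Finset.sum_apply, Pi.single_apply]
  conv_rhs => rw [hy, map_sum, Fintype.sum_sum_type]
  rw [← Finset.sum_add_distrib]
  refine Finset.sum_congr rfl fun i _ => ?_
  simp only [map_smul, smul_eq_mul, Sum.elim_inl, Sum.elim_inr]
  ring

theorem mem_symplecticGroup_of_rows {g : Matrix (Fin n ⊕ Fin n) (Fin n ⊕ Fin n) ℤ}
    (h1 : ∀ i j, sympForm (g (Sum.inl i)) (g (Sum.inl j)) = 0)
    (h2 : ∀ i j, sympForm (g (Sum.inr i)) (g (Sum.inr j)) = 0)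
    (h3 : ∀ i j, sympForm (g (Sum.inl i)) (g (Sum.inr j)) = if i = j then 1 else 0) :
    g ∈ symplecticGroup (Fin n) ℤ := by
  have key : ∀ r s, (g * J (Fin n) ℤ * gᵀ) r s = -sympForm (g r) (g s) := by
    intro r s
    have e1 : ∀ i, (g * J (Fin n) ℤ) r (Sum.inl i) = g r (Sum.inr i) := by
      intro i
      simp [Matrix.mul_apply, J, Matrix.one_apply]
    have e2 : ∀ i, (g * J (Fin n) ℤ) r (Sum.inr i) = -g r (Sum.inl i) := by
      intro i
      simp [Matrix.mul_apply, J, Matrix.one_apply]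
    rw [Matrix.mul_apply, Fintype.sum_sum_type, ← Finset.sum_add_distrib, sympForm,
      ← Finset.sum_neg_distrib]
    refine Finset.sum_congr rfl fun i _ => ?_
    rw [e1, e2, transpose_apply, transpose_apply]
    ring
  rw [SymplecticGroup.mem_iff]
  ext r s
  rw [key]
  rcases r with i | i <;> rcases s with j | j
  · rw [h1]; simp [J]
  · rw [h3]; simp [J, Matrix.one_apply]
  · rw [sympForm_swap, h3]; simp [J, Matrix.one_apply, eq_comm]
  · rw [h2]; simp [J]

/-- `Sp_n(ℤ)` acts transitively on Lagrangian sublattices: a sublattice of `ℤ²ⁿ` that is its own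
orthogonal complement contains the bottom rows of a symplectic matrix. -/
theorem exists_bottomRows_mem (Λ : Submodule ℤ (Fin n ⊕ Fin n → ℤ))
    (hΛ : ∀ x, x ∈ Λ ↔ ∀ y ∈ Λ, sympForm x y = 0) :
    ∃ g : Sp n, ∀ i, bottomRows g i ∈ Λ := by
  obtain ⟨m, snf⟩ := Λ.smithNormalForm (Pi.basisFun ℤ (Fin n ⊕ Fin n))
  have ha : ∀ i, snf.a i ≠ 0 := by
    intro i h
    have h1 := snf.snf i
    rw [h, zero_smul] at h1
    exact snf.bN.ne_zero i (Subtype.ext h1)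
  set c : Fin m → Fin n ⊕ Fin n → ℤ := fun i => snf.bM (snf.f i) with hc
  have hcΛ : ∀ i, c i ∈ Λ := by
    intro i
    rw [hΛ]
    intro y hy
    have h1 := (hΛ _).1 (snf.bN i).2 y hy
    rw [snf.snf, sympForm_smul_left] at h1
    exact (mul_eq_zero.1 h1).resolve_left (ha i)
  have hspan : ∀ v, (∀ j, sympForm v (c j) = 0) → v ∈ Λ := by
    intro v hv
    rw [hΛ]
    intro y hy
    have h1 : y = ∑ i, snf.bN.repr ⟨y, hy⟩ i • ((snf.bN i : Λ) : Fin n ⊕ Fin n → ℤ) := by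
      have := congrArg (Subtype.val) (snf.bN.sum_repr ⟨y, hy⟩)
      rw [Submodule.coe_sum] at this
      exact this.symm
    rw [h1, sympForm_sum_smul_right]
    refine Finset.sum_eq_zero fun i _ => ?_
    rw [snf.snf, sympForm_swap, sympForm_smul_left, sympForm_swap, hv i]
    simp
  choose x hx using fun i : Fin m => exists_sympForm_eq (snf.bM.coord (snf.f i))
  have hxc : ∀ i j, sympForm (x i) (c j) = if i = j then 1 else 0 := by
    intro i j
    rw [hx, hc]
    simp only [Module.Basis.coord_apply, Module.Basis.repr_self, Finsupp.single_apply]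
    simp [eq_comm]
  have hmn : m = n := by
    let T : (Fin n ⊕ Fin n → ℤ) →ₗ[ℤ] (Fin m → ℤ) := LinearMap.pi fun j => sympFunctional (c j)
    have hT : ∀ v j, T v j = sympForm v (c j) := fun _ _ => rfl
    have hrange : LinearMap.range T = ⊤ := by
      rw [LinearMap.range_eq_top]
      intro t
      refine ⟨∑ i, t i • x i, ?_⟩
      ext j
      rw [hT, sympForm_sum_smul_left]
      simp [hxc]
    have hker : LinearMap.ker T = Λ := by
      ext v
      rw [LinearMap.mem_ker]
      constructor
      · intro h
        exact hspan v fun j => by rw [← hT, h]; rfl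
      · intro h
        ext j
        rw [hT]
        exact (hΛ v).1 h _ (hcΛ j)
    have h1 := (LinearMap.ker T).finrank_quotient_add_finrank
    rw [(T.quotKerEquivOfSurjective (LinearMap.range_eq_top.1 hrange)).finrank_eq, hker,
      Module.finrank_fin_fun, Module.finrank_eq_card_basis snf.bN,
      Fintype.card_fin, Module.finrank_pi, Fintype.card_sum, Fintype.card_fin] at h1
    omega
  subst hmn
  have hcc : ∀ i j, sympForm (c i) (c j) = 0 := fun i j => (hΛ _).1 (hcΛ i) _ (hcΛ j)
  -- The dual vectors `x` are made isotropic by adding multiples of the `c j`.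
  set x' : Fin m → Fin m ⊕ Fin m → ℤ := fun i =>
    x i + ∑ j, (if i < j then sympForm (x i) (x j) else 0) • c j with hx'
  have hsumc : ∀ i j, sympForm (∑ l, (if i < l then sympForm (x i) (x l) else 0) • c l) (c j)
      = 0 := by
    intro i j
    rw [sympForm_sum_smul_left]
    exact Finset.sum_eq_zero fun l _ => by rw [hcc, mul_zero]
  have hx'c : ∀ i j, sympForm (x' i) (c j) = if i = j then 1 else 0 := by
    intro i j
    rw [hx', sympForm_add_left, hsumc, hxc, add_zero]
  have hx'x' : ∀ i j, sympForm (x' i) (x' j) = 0 := by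
    intro i j
    have e1 : sympForm (x' i) (x' j) = sympForm (x' i) (x j)
        + if j < i then sympForm (x j) (x i) else 0 := by
      conv_lhs => rw [sympForm_swap, hx', sympForm_add_left, ← hx', sympForm_sum_smul_left]
      rw [neg_add, ← sympForm_swap, ← Finset.sum_neg_distrib]
      congr 1
      rw [Finset.sum_eq_single i]
      · rw [sympForm_swap (c i), hx'c]; simp
      · intro l _ hl
        rw [sympForm_swap (c l), hx'c, if_neg hl.symm]; simp
      · simp
    have e2 : sympForm (x' i) (x j) = sympForm (x i) (x j)
        - if i < j then sympForm (x i) (x j) else 0 := by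
      conv_lhs => rw [hx', sympForm_add_left, sympForm_sum_smul_left]
      rw [sub_eq_add_neg]
      congr 1
      rw [Finset.sum_eq_single j]
      · rw [sympForm_swap (c j), hxc]; simp
      · intro l _ hl
        rw [sympForm_swap (c l), hxc, if_neg hl.symm]; simp
      · simp
    rw [e1, e2]
    rcases lt_trichotomy i j with h | h | h
    · simp [h, h.not_gt]
    · subst h; simp [sympForm_self]
    · rw [if_neg h.not_gt, if_pos h, sympForm_swap (x j)]; ring
  refine ⟨⟨Matrix.of (Sum.elim x' c), mem_symplecticGroup_of_rows hx'x' hcc hx'c⟩, fun i => ?_⟩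
  have : bottomRows (⟨Matrix.of (Sum.elim x' c),
      mem_symplecticGroup_of_rows hx'x' hcc hx'c⟩ : Sp m) i = c i := by
    ext r
    rcases r with r | r <;> simp [bottomRows, blockC, blockD, toBlocks₂₁, toBlocks₂₂]
  rw [this]
  exact hcΛ i

end Lagrangian

/-! ### Denominators -/

section Denominators

variable {n : ℕ}

theorem exists_common_multiple {ι : Type*} [Finite ι] (y : ι → ℚ) :
    ∃ K : ℤ, K ≠ 0 ∧ ∃ w : ι → ℤ, ∀ i, (w i : ℚ) = K * y i := by
  obtain ⟨b, hb⟩ := IsLocalization.exist_integer_multiples_of_finite (nonZeroDivisors ℤ) y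
  choose w hw using hb
  refine ⟨b, nonZeroDivisors.coe_ne_zero b, w, fun i => ?_⟩
  have := hw i
  simpa [Algebra.smul_def] using this

theorem den_dvd_of_mul_eq_int {r : ℚ} {m z : ℤ} (h : (m : ℚ) * r = z) : (r.den : ℤ) ∣ m := by
  have h1 : m * r.num = z * r.den := by
    have h2 : (m : ℚ) * (r.num / r.den) = z := by rw [Rat.num_div_den, h]
    have h3 : (r.den : ℚ) ≠ 0 := by exact_mod_cast r.den_ne_zero
    field_simp at h2
    rw [mul_comm z]
    exact_mod_cast h2
  have h4 : (r.den : ℤ) ∣ r.num * m := ⟨z, by linarith⟩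
  exact (IsCoprime.dvd_of_dvd_mul_left
    (Int.isCoprime_iff_nat_coprime.2 (by simpa using r.reduced.symm)) h4)

/-- The common denominator of a rational vector. -/
def vecDen (φ : Fin n → ℚ) : ℕ := Finset.univ.lcm fun l => (φ l).den

theorem vecDen_pos (φ : Fin n → ℚ) : 0 < vecDen φ := by
  refine Nat.pos_of_ne_zero fun h => ?_
  obtain ⟨l, _, hl⟩ := Finset.lcm_eq_zero_iff.1 h
  exact (φ l).den_ne_zero hl

theorem vecDen_dvd {φ : Fin n → ℚ} {m : ℤ} (h : ∀ l, ∃ z : ℤ, (m : ℚ) * φ l = z) :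
    (vecDen φ : ℤ) ∣ m := by
  rw [Int.natCast_dvd]
  refine Finset.lcm_dvd fun l _ => ?_
  obtain ⟨z, hz⟩ := h l
  exact Int.natCast_dvd.1 (den_dvd_of_mul_eq_int hz)

theorem exists_vecDen_mul (φ : Fin n → ℚ) : ∃ a : Fin n → ℤ, ∀ l, φ l = a l / vecDen φ := by
  have h : ∀ l, ∃ z : ℤ, φ l = z / vecDen φ := by
    intro l
    obtain ⟨e, he⟩ : (φ l).den ∣ vecDen φ := Finset.dvd_lcm (Finset.mem_univ l)
    have h0 : (vecDen φ : ℚ) ≠ 0 := by exact_mod_cast (vecDen_pos φ).ne'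
    refine ⟨(φ l).num * e, ?_⟩
    have h1 : ((φ l).den : ℚ) ≠ 0 := by exact_mod_cast (φ l).den_ne_zero
    have h2 : (vecDen φ : ℚ) = (φ l).den * e := by exact_mod_cast he
    have h3 : (e : ℚ) ≠ 0 := by
      intro h; rw [h2, h, mul_zero] at h0; exact h0 rfl
    conv_lhs => rw [← Rat.num_div_den (φ l)]
    rw [h2]
    push_cast
    field_simp
  choose a ha using h
  exact ⟨a, ha⟩

/-- If an integral matrix `V` clears the denominators of `φ` and `t` as below, its determinant is
divisible by `q² b`, where `q` is the denominator of `φ` and `b` that of `q² t`. The zeroth column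
of `V` is divisible by `q b`; after dividing, `V (j, a)ᵀ ≡ 0 (mod q)` with `φ = a / q`, so that
multiplying by the adjugate gives another factor `q`. -/
theorem dvd_det_of_denominators (V : Matrix (Fin (n + 1)) (Fin (n + 1)) ℤ) (φ : Fin n → ℚ) (t : ℚ)
    (h1 : ∀ i l, ∃ z : ℤ, (V i 0 : ℚ) * φ l = z)
    (h2 : ∀ i, ∃ z : ℤ, (V i 0 : ℚ) * t + ∑ l, (V i (Fin.succ l) : ℚ) * φ l = z) :
    ((vecDen φ ^ 2 * ((vecDen φ : ℚ) ^ 2 * t).den : ℕ) : ℤ) ∣ V.det := by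
  set q := vecDen φ with hq
  set b := ((q : ℚ) ^ 2 * t).den with hb
  set j := ((q : ℚ) ^ 2 * t).num with hj
  have hq0 : (q : ℚ) ≠ 0 := by exact_mod_cast (vecDen_pos φ).ne'
  have hb0 : (b : ℚ) ≠ 0 := by exact_mod_cast Rat.den_ne_zero _
  have hjb : (q : ℚ) ^ 2 * t = j / b := (Rat.num_div_den _).symm
  obtain ⟨a, ha⟩ := exists_vecDen_mul φ
  have hcol : ∀ i, ∃ y : ℤ, V i 0 = q * b * y := by
    intro i
    obtain ⟨x, hx⟩ := vecDen_dvd (h1 i)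
    obtain ⟨z, hz⟩ := h2 i
    have hbx : (b : ℤ) ∣ x := by
      refine den_dvd_of_mul_eq_int (z := q * z - ∑ l, V i (Fin.succ l) * a l) ?_
      have e1 : ∑ l, (V i (Fin.succ l) : ℚ) * φ l = (∑ l, (V i (Fin.succ l) : ℚ) * a l) / q := by
        rw [Finset.sum_div]
        exact Finset.sum_congr rfl fun l _ => by rw [ha l, mul_div_assoc]
      rw [e1, hx] at hz
      push_cast at hz ⊢
      field_simp at hz ⊢
      linear_combination hz
    obtain ⟨y, hy⟩ := hbx
    exact ⟨y, by rw [hx, hy]; ring⟩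
  choose y hy using hcol
  choose z hz using h2
  let V' : Matrix (Fin (n + 1)) (Fin (n + 1)) ℤ := V.updateCol 0 y
  have hdet : V.det = q * b * V'.det := by
    have e : V = V.updateCol 0 ((q * b : ℤ) • y) := by
      ext i l
      refine Fin.cases ?_ (fun l => ?_) l
      · rw [updateCol_self, hy]; rfl
      · rw [updateCol_ne (Fin.succ_ne_zero l)]
    conv_lhs => rw [e, det_updateCol_smul]
  have hv : V' *ᵥ (Fin.cons j a : Fin (n + 1) → ℤ) = fun i => q * z i := by
    ext i
    have e1 : (V' *ᵥ (Fin.cons j a : Fin (n + 1) → ℤ)) i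
        = y i * j + ∑ l, V i (Fin.succ l) * a l := by
      rw [mulVec, dotProduct, Fin.sum_univ_succ]
      simp [V']
    rw [e1]
    have e2 := hz i
    have e3 : ∑ l, (V i (Fin.succ l) : ℚ) * φ l = (∑ l, (V i (Fin.succ l) : ℚ) * a l) / q := by
      rw [Finset.sum_div]
      exact Finset.sum_congr rfl fun l _ => by rw [ha l, mul_div_assoc]
    rw [e3, hy] at e2
    have e4 : (y i : ℚ) * j = q * (q * b * y i * t) := by
      have : (j : ℚ) = q ^ 2 * t * b := by rw [hjb]; field_simp
      rw [this]; ring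
    have e5 : (y i : ℚ) * j + ∑ l, (V i (Fin.succ l) : ℚ) * a l = q * z i := by
      rw [e4, ← e2]
      push_cast
      field_simp
    exact_mod_cast e5
  have hadj : ∀ l, (q : ℤ) ∣ V'.det * a l := by
    intro l
    have e := congrArg (fun v => (V'.adjugate *ᵥ v) (Fin.succ l)) hv
    simp only [mulVec_mulVec, adjugate_mul, smul_mulVec, one_mulVec, Pi.smul_apply, Fin.cons_succ,
      smul_eq_mul] at e
    rw [e, mulVec, dotProduct]
    exact Finset.dvd_sum fun i _ => (Dvd.intro _ rfl).mul_left _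
  have hqV : (q : ℤ) ∣ V'.det := by
    refine vecDen_dvd fun l => ?_
    obtain ⟨w, hw⟩ := hadj l
    refine ⟨w, ?_⟩
    have hw' : (V'.det : ℚ) * a l = q * w := by exact_mod_cast hw
    rw [ha l, ← hq]
    field_simp
    exact hw'
  obtain ⟨w, hw⟩ := hqV
  exact ⟨w, by rw [hdet, hw]; push_cast; ring⟩

end Denominators

/-! ### The Lagrangian subspace of a symplectic matrix and its reduction to lower degree -/

section RationalLagrangian

variable {m n : ℕ}

/-- The vector `(x_C, x_D)` lies in the rational Lagrangian subspace spanned by the bottom rows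
of `γ`. -/
def InLag (γ : Sp m) (xc xd : Fin m → ℚ) : Prop :=
  castMat ℚ (blockC γ) *ᵥ xd = castMat ℚ (blockD γ) *ᵥ xc

theorem inLag_vecMul (γ : Sp m) (z : Fin m → ℚ) :
    InLag γ (z ᵥ* castMat ℚ (blockC γ)) (z ᵥ* castMat ℚ (blockD γ)) := by
  rw [InLag, ← mulVec_transpose, ← mulVec_transpose, mulVec_mulVec, mulVec_mulVec, cast_CD]

theorem InLag.eq_vecMul {γ : Sp m} {xc xd : Fin m → ℚ} (h : InLag γ xc xd) :
    ∃ z, xc = z ᵥ* castMat ℚ (blockC γ) ∧ xd = z ᵥ* castMat ℚ (blockD γ) := by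
  refine ⟨castMat ℚ (blockA γ) *ᵥ xd - castMat ℚ (blockB γ) *ᵥ xc, ?_, ?_⟩
  · have h1 : (castMat ℚ (blockC γ))ᵀ * castMat ℚ (blockB γ)
        = (castMat ℚ (blockA γ))ᵀ * castMat ℚ (blockD γ) - 1 := by
      rw [← cast_AtD ℚ γ]; abel
    rw [← mulVec_transpose, mulVec_sub, mulVec_mulVec, mulVec_mulVec, ← cast_AtC, h1, sub_mulVec,
      one_mulVec, ← mulVec_mulVec, ← mulVec_mulVec, h]
    abel
  · have h1 : (castMat ℚ (blockD γ))ᵀ * castMat ℚ (blockA γ)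
        = (castMat ℚ (blockB γ))ᵀ * castMat ℚ (blockC γ) + 1 := by
      rw [← cast_DtA ℚ γ]; abel
    rw [← mulVec_transpose, mulVec_sub, mulVec_mulVec, mulVec_mulVec, ← cast_BtD, h1, add_mulVec,
      one_mulVec, ← mulVec_mulVec, ← mulVec_mulVec, h]
    abel

theorem InLag.isotropic {γ : Sp m} {xc xd yc yd : Fin m → ℚ} (hx : InLag γ xc xd)
    (hy : InLag γ yc yd) : xc ⬝ᵥ yd = xd ⬝ᵥ yc := by
  obtain ⟨z, rfl, rfl⟩ := hx.eq_vecMul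
  rw [← dotProduct_mulVec, ← dotProduct_mulVec, hy]

theorem InLag.add {γ : Sp m} {xc xd yc yd : Fin m → ℚ} (hx : InLag γ xc xd)
    (hy : InLag γ yc yd) : InLag γ (xc + yc) (xd + yd) := by
  rw [InLag, mulVec_add, mulVec_add, hx, hy]

theorem InLag.smul {γ : Sp m} {xc xd : Fin m → ℚ} (a : ℚ) (hx : InLag γ xc xd) :
    InLag γ (a • xc) (a • xd) := by
  rw [InLag, mulVec_smul, mulVec_smul, hx]

theorem inLag_zero (γ : Sp m) : InLag γ 0 0 := by
  rw [InLag, mulVec_zero, mulVec_zero]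

theorem InLag.sum {γ : Sp m} {ι : Type*} (s : Finset ι) {xc xd : ι → Fin m → ℚ}
    (hx : ∀ i ∈ s, InLag γ (xc i) (xd i)) : InLag γ (∑ i ∈ s, xc i) (∑ i ∈ s, xd i) := by
  classical
  induction s using Finset.induction_on with
  | empty => simpa using inLag_zero γ
  | insert a s ha ih =>
    rw [Finset.sum_insert ha, Finset.sum_insert ha]
    exact (hx a (Finset.mem_insert_self a s)).add
      (ih fun i hi => hx i (Finset.mem_insert_of_mem hi))

/-- Rational vectors in the Lagrangian of `γ`, written as the rows of `(X_C, X_D)`, are linear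
combinations of the bottom rows of `γ`. -/
theorem exists_rows_eq_mul (γ : Sp m) {Xc Xd : Matrix (Fin m) (Fin m) ℚ}
    (h : ∀ i, InLag γ (Xc i) (Xd i)) :
    ∃ U : Matrix (Fin m) (Fin m) ℚ, Xc = U * castMat ℚ (blockC γ) ∧
      Xd = U * castMat ℚ (blockD γ) := by
  choose U hU using fun i => (h i).eq_vecMul
  exact ⟨U, by ext i j; rw [(hU i).1]; rfl, by ext i j; rw [(hU i).2]; rfl⟩

/-- The integral vectors whose lift to degree `n + 1`, with zeroth `C`-coordinate `0` and suitable
zeroth `D`-coordinate, lies in the Lagrangian of `γ`. -/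
def reducedLattice (γ : Sp (n + 1)) : Submodule ℤ (Fin n ⊕ Fin n → ℤ) where
  carrier := {v | ∃ e : ℚ, InLag γ (Fin.cons 0 fun i => (v (Sum.inl i) : ℚ))
    (Fin.cons e fun i => (v (Sum.inr i) : ℚ))}
  zero_mem' := ⟨0, by
    convert inLag_zero γ using 1 <;>
    · ext i; refine Fin.cases ?_ (fun i => ?_) i <;> simp⟩
  add_mem' := by
    rintro v w ⟨e, he⟩ ⟨f, hf⟩
    refine ⟨e + f, ?_⟩
    convert he.add hf using 1 <;>
    · ext i; refine Fin.cases ?_ (fun i => ?_) i <;> simp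
  smul_mem' := by
    rintro a v ⟨e, he⟩
    refine ⟨a * e, ?_⟩
    convert he.smul (a : ℚ) using 1 <;>
    · ext i; refine Fin.cases ?_ (fun i => ?_) i <;> simp

theorem mem_reducedLattice {γ : Sp (n + 1)} {v : Fin n ⊕ Fin n → ℤ} :
    v ∈ reducedLattice γ ↔ ∃ e : ℚ, InLag γ (Fin.cons 0 fun i => (v (Sum.inl i) : ℚ))
      (Fin.cons e fun i => (v (Sum.inr i) : ℚ)) := Iff.rfl

theorem sympForm_cast (v w : Fin n ⊕ Fin n → ℤ) : ((sympForm v w : ℤ) : ℚ)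
    = (fun i => (v (Sum.inl i) : ℚ)) ⬝ᵥ (fun i => (w (Sum.inr i) : ℚ))
      - (fun i => (v (Sum.inr i) : ℚ)) ⬝ᵥ (fun i => (w (Sum.inl i) : ℚ)) := by
  simp only [sympForm, dotProduct, ← Finset.sum_sub_distrib]
  push_cast
  rfl

theorem dotProduct_cons (a b : ℚ) (v w : Fin n → ℚ) :
    (Fin.cons a v : Fin (n + 1) → ℚ) ⬝ᵥ (Fin.cons b w : Fin (n + 1) → ℚ) = a * b + v ⬝ᵥ w := by
  simp [dotProduct, Fin.sum_univ_succ]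

theorem eq_smul_of_orthogonal {c r : Fin m → ℚ}
    (h : ∀ z : Fin m → ℚ, z ⬝ᵥ c = 0 → z ⬝ᵥ r = 0) : ∃ e : ℚ, r = e • c := by
  by_cases hc : ∃ k, c k ≠ 0
  · obtain ⟨k, hk⟩ := hc
    refine ⟨r k / c k, ?_⟩
    ext i
    have h1 := h (c k • Pi.single i 1 - c i • Pi.single k 1) (by
      simp only [sub_dotProduct, smul_dotProduct, single_one_dotProduct, smul_eq_mul]; ring)
    simp only [sub_dotProduct, smul_dotProduct, single_one_dotProduct, smul_eq_mul] at h1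
    rw [Pi.smul_apply, smul_eq_mul]
    field_simp
    linarith
  · push Not at hc
    refine ⟨0, ?_⟩
    ext i
    have h1 := h (Pi.single i 1) (by rw [single_one_dotProduct, hc i])
    rw [single_one_dotProduct] at h1
    rw [h1]; simp

/-- The reduced lattice is Lagrangian. -/
theorem mem_reducedLattice_iff (γ : Sp (n + 1)) (v : Fin n ⊕ Fin n → ℤ) :
    v ∈ reducedLattice γ ↔ ∀ w ∈ reducedLattice γ, sympForm v w = 0 := by
  constructor
  · rintro ⟨e, he⟩ w ⟨f, hf⟩
    have h1 := he.isotropic hf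
    rw [dotProduct_cons, dotProduct_cons, zero_mul, mul_zero, zero_add, zero_add] at h1
    have h2 := sympForm_cast v w
    rw [h1, sub_self] at h2
    exact_mod_cast h2
  · intro h
    set C := castMat ℚ (blockC γ)
    set D := castMat ℚ (blockD γ)
    set xc : Fin (n + 1) → ℚ := Fin.cons 0 fun i => (v (Sum.inl i) : ℚ) with hxc
    set xd : Fin (n + 1) → ℚ := Fin.cons 0 fun i => (v (Sum.inr i) : ℚ) with hxd
    obtain ⟨e, he⟩ := eq_smul_of_orthogonal (c := fun i => C i 0) (r := D *ᵥ xc - C *ᵥ xd) (by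
      intro z hz
      obtain ⟨K, hK, w, hw⟩ := exists_common_multiple (Sum.elim
        (fun i : Fin n => (z ᵥ* C) i.succ) (fun i : Fin n => (z ᵥ* D) i.succ))
      have hyC0 : (z ᵥ* C) 0 = 0 := hz
      have hcons : ∀ y : Fin (n + 1) → ℚ, y = Fin.cons (y 0) fun i => y i.succ := fun y =>
        (Fin.cons_self_tail y).symm
      have hwc : (K : ℚ) • (z ᵥ* C) = Fin.cons 0 fun i => (w (Sum.inl i) : ℚ) := by
        rw [hcons ((K : ℚ) • (z ᵥ* C))]
        congr 1
        · rw [Pi.smul_apply, hyC0, smul_zero]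
        · funext i; rw [hw]; rfl
      have hwd : (K : ℚ) • (z ᵥ* D)
          = Fin.cons (((K : ℚ) • (z ᵥ* D)) 0) fun i => (w (Sum.inr i) : ℚ) := by
        rw [hcons ((K : ℚ) • (z ᵥ* D))]
        congr 1
        funext i; rw [hw]; rfl
      have hmem : w ∈ reducedLattice γ := by
        refine ⟨((K : ℚ) • (z ᵥ* D)) 0, ?_⟩
        have := (inLag_vecMul γ z).smul (K : ℚ)
        rw [hwc, hwd] at this
        exact this
      have h1 := sympForm_cast v w
      rw [h w hmem, Int.cast_zero] at h1
      have h2 : xc ⬝ᵥ ((K : ℚ) • (z ᵥ* D)) - xd ⬝ᵥ ((K : ℚ) • (z ᵥ* C)) = 0 := by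
        rw [hwc, hwd, hxc, hxd, dotProduct_cons, dotProduct_cons, zero_mul, zero_mul, zero_add,
          zero_add, ← h1]
      rw [dotProduct_smul, dotProduct_smul, ← smul_sub, smul_eq_zero] at h2
      have h3 := h2.resolve_left (by exact_mod_cast hK)
      rw [dotProduct_sub, dotProduct_mulVec, dotProduct_mulVec, dotProduct_comm _ xc,
        dotProduct_comm _ xd, h3])
    refine ⟨e, ?_⟩
    have h1 : (Fin.cons e fun i => (v (Sum.inr i) : ℚ) : Fin (n + 1) → ℚ)
        = xd + e • Pi.single 0 1 := by
      ext i
      refine Fin.cases ?_ (fun i => ?_) i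
      · simp [hxd]
      · simp [hxd, Fin.succ_ne_zero]
    have h2 : C *ᵥ (Pi.single 0 1) = fun i => C i 0 := by
      ext i; simp
    rw [InLag, h1, mulVec_add, mulVec_smul]
    change C *ᵥ xd + e • (C *ᵥ Pi.single 0 1) = D *ᵥ xc
    rw [h2, ← he]
    abel

/-- The stabiliser `Γ_∞` of the standard Lagrangian. -/
def GammaInf (n : ℕ) : Subgroup (Sp n) where
  carrier := {γ | blockC γ = 0}
  one_mem' := blockC_one
  mul_mem' := by
    intro a b ha hb
    change blockC _ = 0 at *
    rw [blockC_mul, ha, hb, zero_mul, mul_zero, add_zero]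
  inv_mem' := by
    intro a ha
    change blockC _ = 0 at *
    rw [blockC_inv, ha, transpose_zero, neg_zero]

/-- The set `Γ_∞ \ Sp_n(ℤ)`, which parametrises the Lagrangian subspaces of `ℚ²ⁿ`. -/
abbrev Lagrangians (n : ℕ) : Type := Quotient (QuotientGroup.rightRel (GammaInf n))

theorem mk_eq_mk_iff {γ δ : Sp n} :
    (Quotient.mk (QuotientGroup.rightRel (GammaInf n)) γ : Lagrangians n) = Quotient.mk _ δ ↔
      blockC (γ * δ⁻¹) = 0 := by
  rw [eq_comm, Quotient.eq, QuotientGroup.rightRel_apply]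
  rfl

/-- Every Lagrangian in degree `n + 1` reduces to one in degree `n`. -/
theorem exists_reduction (γ : Sp (n + 1)) : ∃ c : Lagrangians n, ∃ φ : Fin n → ℚ,
    ∀ i, InLag γ (Fin.cons 0 (castMat ℚ (blockC (Quotient.out c)) i))
      (Fin.cons (φ i) (castMat ℚ (blockD (Quotient.out c)) i)) := by
  obtain ⟨g, hg⟩ := exists_bottomRows_mem (reducedLattice γ) (mem_reducedLattice_iff γ)
  set c : Lagrangians n := Quotient.mk _ g with hc
  set g' : Sp n := Quotient.out c with hg'
  have h1 : blockC (g' * g⁻¹) = 0 := mk_eq_mk_iff.1 (Quotient.out_eq c)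
  set p := g' * g⁻¹ with hp
  have hpg : g' = p * g := by rw [hp]; group
  have hrow : ∀ i, bottomRows g' i = ∑ j, blockD p i j • bottomRows g j := by
    intro i
    ext r
    rw [Finset.sum_apply]
    rcases r with r | r
    · simp [bottomRows, hpg, blockC_mul, h1, Matrix.mul_apply]
    · simp [bottomRows, hpg, blockD_mul, h1, Matrix.mul_apply]
  have hmem : ∀ i, bottomRows g' i ∈ reducedLattice γ := by
    intro i
    rw [hrow]
    exact Submodule.sum_mem _ fun j _ => Submodule.smul_mem _ _ (hg j)
  choose φ hφ using fun i => mem_reducedLattice.1 (hmem i)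
  exact ⟨c, φ, hφ⟩

end RationalLagrangian

/-! ### Bordered matrices and the shape of a Lagrangian in degree `n + 1` -/

section Border

variable {n : ℕ} {R : Type*}

/-- The matrix with corner `a`, remaining first row `r`, remaining first column `c`, and lower
right block `P`. -/
def border (a : R) (r c : Fin n → R) (P : Matrix (Fin n) (Fin n) R) :
    Matrix (Fin (n + 1)) (Fin (n + 1)) R :=
  Matrix.of (Fin.cons (Fin.cons a r) fun i => Fin.cons (c i) (P i))

theorem border_zero (a : R) (r c : Fin n → R) (P : Matrix (Fin n) (Fin n) R) :
    border a r c P 0 = Fin.cons a r := rfl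

theorem border_succ (a : R) (r c : Fin n → R) (P : Matrix (Fin n) (Fin n) R) (i : Fin n) :
    border a r c P i.succ = Fin.cons (c i) (P i) := rfl

theorem mul_border_zero [CommRing R] (V : Matrix (Fin (n + 1)) (Fin (n + 1)) R) (a : R)
    (r c : Fin n → R) (P : Matrix (Fin n) (Fin n) R) (i : Fin (n + 1)) :
    (V * border a r c P) i 0 = V i 0 * a + ∑ l : Fin n, V i l.succ * c l := by
  rw [Matrix.mul_apply, Fin.sum_univ_succ]
  rfl

theorem mul_border_succ [CommRing R] (V : Matrix (Fin (n + 1)) (Fin (n + 1)) R) (a : R)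
    (r c : Fin n → R) (P : Matrix (Fin n) (Fin n) R) (i : Fin (n + 1)) :
    (fun l : Fin n => (V * border a r c P) i l.succ)
      = V i 0 • r + (fun l : Fin n => V i l.succ) ᵥ* P := by
  ext l
  rw [Matrix.mul_apply, Fin.sum_univ_succ]
  rfl

theorem border_map {S : Type*} (f : R → S) (a : R) (r c : Fin n → R)
    (P : Matrix (Fin n) (Fin n) R) :
    (border a r c P).map f = border (f a) (f ∘ r) (f ∘ c) (P.map f) := by
  ext i j
  refine Fin.cases ?_ (fun i => ?_) i <;> refine Fin.cases ?_ (fun j => ?_) j <;> rfl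

theorem smul_border_add [CommRing R] (s a a' : R) (r r' c c' : Fin n → R)
    (P P' : Matrix (Fin n) (Fin n) R) : s • border a r c P + border a' r' c' P'
      = border (s * a + a') (s • r + r') (s • c + c') (s • P + P') := by
  ext i j
  refine Fin.cases ?_ (fun i => ?_) i <;> refine Fin.cases ?_ (fun j => ?_) j <;> rfl

/-- The Schur complement formula for a bordered matrix. -/
theorem det_border {K : Type*} [Field K] (a : K) (r c : Fin n → K) {P : Matrix (Fin n) (Fin n) K}
    (hP : P.det ≠ 0) : (border a r c P).det = P.det * (a - r ⬝ᵥ (P⁻¹ *ᵥ c)) := by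
  let e : Unit ⊕ Fin n ≃ Fin (n + 1) :=
    (Equiv.sumComm _ _).trans ((Equiv.optionEquivSumPUnit (Fin n)).symm.trans
      (finSuccEquiv n).symm)
  have h1 : (border a r c P).submatrix e e
      = fromBlocks (Matrix.of fun _ _ => a) (Matrix.of fun _ l => r l)
        (Matrix.of fun i _ => c i) P := by
    ext i j
    rcases i with i | i <;> rcases j with j | j <;> simp [e, border]
  have : Invertible P := P.invertibleOfIsUnitDet hP.isUnit
  rw [← det_submatrix_equiv_self e, h1, det_fromBlocks₂₂, det_unique (n := Unit), invOf_eq_nonsing_inv,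
    Matrix.mul_assoc]
  rfl

end Border

section Frame

variable {n m : ℕ}

/-- The rational rows `(X_C, X_D)` are a basis of the Lagrangian of `γ`. -/
def IsFrame (γ : Sp m) (Xc Xd : Matrix (Fin m) (Fin m) ℚ) : Prop :=
  Xc * Xdᵀ = Xd * Xcᵀ ∧ ∃ V : Matrix (Fin m) (Fin m) ℚ,
    castMat ℚ (blockC γ) = V * Xc ∧ castMat ℚ (blockD γ) = V * Xd

/-- A Lagrangian is determined by a basis. -/
theorem IsFrame.mk_eq_mk {γ δ : Sp m} {Xc Xd : Matrix (Fin m) (Fin m) ℚ} (hγ : IsFrame γ Xc Xd)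
    (hδ : IsFrame δ Xc Xd) :
    (Quotient.mk (QuotientGroup.rightRel (GammaInf m)) γ : Lagrangians m) = Quotient.mk _ δ := by
  obtain ⟨hX, V, h1, h2⟩ := hγ
  obtain ⟨-, W, h3, h4⟩ := hδ
  rw [mk_eq_mk_iff, blockC_mul_inv]
  have h : castMat ℚ (blockC γ * (blockD δ)ᵀ - blockD γ * (blockC δ)ᵀ) = 0 := by
    rw [castMat_sub, castMat_mul, castMat_mul, castMat_transpose, castMat_transpose, h1, h2, h3,
      h4, transpose_mul, transpose_mul, Matrix.mul_assoc, Matrix.mul_assoc V,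
      ← Matrix.mul_assoc Xc, ← Matrix.mul_assoc Xd, hX, sub_self]
  ext i j
  have h5 := congrFun (congrFun h i) j
  change (((blockC γ * (blockD δ)ᵀ - blockD γ * (blockC δ)ᵀ) i j : ℤ) : ℚ) = 0 at h5
  exact_mod_cast h5

/-- The complex matrix `i X_C + X_D`. -/
noncomputable def frameDenom (Xc Xd : Matrix (Fin m) (Fin m) ℚ) : Matrix (Fin m) (Fin m) ℂ :=
  Complex.I • Xc.map (Rat.cast : ℚ → ℂ) + Xd.map (Rat.cast : ℚ → ℂ)

theorem map_ratCast_mul (X Y : Matrix (Fin m) (Fin m) ℚ) :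
    (X * Y).map (Rat.cast : ℚ → ℂ) = X.map (Rat.cast : ℚ → ℂ) * Y.map (Rat.cast : ℚ → ℂ) :=
  (Rat.castHom ℂ).mapMatrix.map_mul X Y

theorem map_ratCast_castMat (X : Matrix (Fin m) (Fin m) ℤ) :
    (castMat ℚ X).map (Rat.cast : ℚ → ℂ) = castMat ℂ X := by
  ext i j; simp

theorem det_map_ratCast (X : Matrix (Fin m) (Fin m) ℚ) :
    (X.map (Rat.cast : ℚ → ℂ)).det = ((X.det : ℚ) : ℂ) :=
  ((Rat.castHom ℂ).map_det X).symm

/-- Linearly independent vectors of the Lagrangian form a basis of it. -/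
theorem exists_frame {γ : Sp m} {Xc Xd : Matrix (Fin m) (Fin m) ℚ}
    (h : ∀ i, InLag γ (Xc i) (Xd i)) (hdet : (frameDenom Xc Xd).det ≠ 0) :
    Xc * Xdᵀ = Xd * Xcᵀ ∧ ∃ V : Matrix (Fin m) (Fin m) ℚ, castMat ℚ (blockC γ) = V * Xc ∧
      castMat ℚ (blockD γ) = V * Xd ∧
      detFactor γ (basePoint m).1 = (V.det : ℂ) * (frameDenom Xc Xd).det := by
  obtain ⟨U, h1, h2⟩ := exists_rows_eq_mul γ h
  have h3 : frameDenom Xc Xd = U.map (Rat.cast : ℚ → ℂ) * denom γ (basePoint m).1 := by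
    rw [frameDenom, h1, h2, map_ratCast_mul, map_ratCast_mul, map_ratCast_castMat,
      map_ratCast_castMat, denom_basePoint, mul_add, Matrix.mul_smul]
  have hU : IsUnit U.det := by
    rw [isUnit_iff_ne_zero]
    intro h0
    rw [h3, det_mul, det_map_ratCast, h0, Rat.cast_zero, zero_mul] at hdet
    exact hdet rfl
  refine ⟨?_, U⁻¹, ?_, ?_, ?_⟩
  · rw [h1, h2, transpose_mul, transpose_mul, Matrix.mul_assoc, Matrix.mul_assoc U,
      ← Matrix.mul_assoc _ _ Uᵀ, ← Matrix.mul_assoc _ _ Uᵀ, cast_CD]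
    simp only [Matrix.mul_assoc]
  · rw [h1, ← Matrix.mul_assoc, nonsing_inv_mul _ hU, one_mul]
  · rw [h2, ← Matrix.mul_assoc, nonsing_inv_mul _ hU, one_mul]
  · rw [h3, det_mul, det_map_ratCast, ← mul_assoc, ← Rat.cast_mul, ← det_mul,
      nonsing_inv_mul _ hU, det_one, Rat.cast_one, one_mul, detFactor_eq]

/-- If `v₀ (-φA, -φB) + v (C, D)` is integral for `g = (A B; C D)`, then so are `v` and `v₀ φ`. -/
theorem exists_int_coords (g : Sp n) {v₀ : ℚ} {v φ : Fin n → ℚ} {c d : Fin n → ℤ}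
    (hc : (fun l => (c l : ℚ)) = v₀ • (-(φ ᵥ* castMat ℚ (blockA g))) + v ᵥ* castMat ℚ (blockC g))
    (hd : (fun l => (d l : ℚ)) = v₀ • (-(φ ᵥ* castMat ℚ (blockB g))) + v ᵥ* castMat ℚ (blockD g)) :
    (∀ l, ∃ z : ℤ, v l = z) ∧ ∀ l, ∃ z : ℤ, v₀ * φ l = z := by
  have e1 := cast_AB ℚ g
  have e2 := cast_CD ℚ g
  have e3 := cast_AD ℚ g
  have e4 := cast_DA ℚ g
  have h1 : v = (fun l => (d l : ℚ)) ᵥ* (castMat ℚ (blockA g))ᵀ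
      - (fun l => (c l : ℚ)) ᵥ* (castMat ℚ (blockB g))ᵀ := by
    rw [hc, hd, add_vecMul, add_vecMul, vecMul_vecMul, vecMul_vecMul, smul_vecMul, smul_vecMul,
      neg_vecMul, neg_vecMul, vecMul_vecMul, vecMul_vecMul, ← e1, add_sub_add_left_eq_sub,
      ← vecMul_sub, e4, vecMul_one]
  have h2 : v₀ • φ = (fun l => (d l : ℚ)) ᵥ* (castMat ℚ (blockC g))ᵀ
      - (fun l => (c l : ℚ)) ᵥ* (castMat ℚ (blockD g))ᵀ := by
    rw [hc, hd, add_vecMul, add_vecMul, vecMul_vecMul, vecMul_vecMul, smul_vecMul, smul_vecMul,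
      neg_vecMul, neg_vecMul, vecMul_vecMul, vecMul_vecMul, e2, add_sub_add_right_eq_sub,
      ← smul_sub, ← sub_eq_zero, neg_sub_neg, ← vecMul_sub, e3, vecMul_one, sub_self]
  constructor
  · intro l
    refine ⟨(d ᵥ* (blockA g)ᵀ - c ᵥ* (blockB g)ᵀ) l, ?_⟩
    rw [h1]
    simp [vecMul, dotProduct]
  · intro l
    refine ⟨(d ᵥ* (blockC g)ᵀ - c ᵥ* (blockD g)ᵀ) l, ?_⟩
    rw [← smul_eq_mul, ← Pi.smul_apply, h2]
    simp [vecMul, dotProduct]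

/-- The value `φᵀ τ φ` at `τ = g (i I)`. -/
noncomputable def quadValue (g : Sp n) (φ : Fin n → ℂ) : ℂ :=
  (φ ᵥ* numer g (basePoint n).1) ⬝ᵥ ((denom g (basePoint n).1)⁻¹ *ᵥ φ)

theorem quadValue_im (g : Sp n) {φ : Fin n → ℂ} (hφ : star φ = φ) :
    (quadValue g φ).im = gramForm g φ := by
  set P := denom g (basePoint n).1 with hP
  set Nm := numer g (basePoint n).1 with hN
  have hu : IsUnit P.det := (detFactor_ne_zero g (basePoint n)).isUnit
  set w := P⁻¹ *ᵥ φ with hw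
  have hφw : φ = P *ᵥ w := by rw [hw, mulVec_mulVec, mul_nonsing_inv _ hu, one_mulVec]
  have h1 : quadValue g φ = star w ⬝ᵥ ((Pᴴ * Nm) *ᵥ w) := by
    rw [quadValue, ← hP, ← hN, ← hw, ← dotProduct_mulVec]
    nth_rewrite 1 [← hφ]
    nth_rewrite 1 [hφw]
    rw [star_mulVec, ← dotProduct_mulVec, mulVec_mulVec]
  have h2 : star (quadValue g φ) = star w ⬝ᵥ ((Nmᴴ * P) *ᵥ w) := by
    rw [h1, star_dotProduct, star_star, star_mulVec, ← dotProduct_mulVec, conjTranspose_mul,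
      conjTranspose_conjTranspose]
  have h3 : quadValue g φ - star (quadValue g φ) = star w ⬝ᵥ ((2 * Complex.I) • w) := by
    rw [h2, h1, ← dotProduct_sub, ← sub_mulVec, denom_conj_mul_numer]
    congr 1
    have : (basePoint n).1 - (basePoint n).1ᴴ = (2 * Complex.I) • (1 : Matrix (Fin n) (Fin n) ℂ) := by
      change ((Complex.I * ((1 : ℝ) : ℂ)) • (1 : Matrix (Fin n) (Fin n) ℂ))
        - ((Complex.I * ((1 : ℝ) : ℂ)) • (1 : Matrix (Fin n) (Fin n) ℂ))ᴴ = _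
      rw [conjTranspose_smul, conjTranspose_one, ← sub_smul]
      congr 1
      simp
      ring
    rw [this, smul_mulVec, one_mulVec]
  have h4 : star w ⬝ᵥ w = ((gramForm g φ : ℝ) : ℂ) := by
    rw [gramForm, ← hP, ← hw, dotProduct, Complex.ofReal_sum]
    refine Finset.sum_congr rfl fun j _ => ?_
    rw [Pi.star_apply, Complex.ofReal_pow]
    exact Complex.conj_mul' _
  rw [dotProduct_smul, h4, smul_eq_mul] at h3
  have h5 := congrArg Complex.im h3
  simp at h5
  linarith

end Frame

/-! ### The reduction step and the growth of the height -/

section Step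

variable {n : ℕ}

theorem exists_castMat_eq {m : ℕ} (V : Matrix (Fin m) (Fin m) ℚ) (h : ∀ i j, ∃ z : ℤ, V i j = z) :
    ∃ W : Matrix (Fin m) (Fin m) ℤ, V = castMat ℚ W := by
  choose W hW using h
  exact ⟨Matrix.of W, by ext i j; exact hW i j⟩

/-- The size of the automorphy factor at the point `i I`. -/
noncomputable def height {m : ℕ} (γ : Sp m) : ℝ := ‖detFactor γ (basePoint m).1‖

theorem height_pos {m : ℕ} (γ : Sp m) : 0 < height γ := norm_pos_iff.2 (detFactor_ne_zero γ _)

theorem castMat_ratCast_vecMul (φ : Fin n → ℚ) (X : Matrix (Fin n) (Fin n) ℤ) :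
    (Rat.cast : ℚ → ℂ) ∘ (-(φ ᵥ* castMat ℚ X)) = -((fun l => (φ l : ℂ)) ᵥ* castMat ℂ X) := by
  ext l
  simp [vecMul, dotProduct]

theorem numer_basePoint (g : Sp n) : numer g (basePoint n).1
    = Complex.I • castMat ℂ (blockA g) + castMat ℂ (blockB g) := by
  change castMat ℂ (blockA g) * ((Complex.I * ((1 : ℝ) : ℂ)) • 1) + _ = _
  rw [Matrix.mul_smul, mul_one, Complex.ofReal_one, mul_one]

theorem frameDenom_border (g : Sp n) (a t : ℚ) (ψ φ : Fin n → ℚ) :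
    frameDenom (border a (-(ψ ᵥ* castMat ℚ (blockA g))) 0 (castMat ℚ (blockC g)))
      (border t (-(ψ ᵥ* castMat ℚ (blockB g))) φ (castMat ℚ (blockD g)))
      = border (Complex.I * a + t) (-((fun l => (ψ l : ℂ)) ᵥ* numer g (basePoint n).1))
        (fun l => (φ l : ℂ)) (denom g (basePoint n).1) := by
  rw [frameDenom, border_map, border_map, smul_border_add, map_ratCast_castMat,
    map_ratCast_castMat, denom_basePoint, numer_basePoint, castMat_ratCast_vecMul,
    castMat_ratCast_vecMul, vecMul_add, vecMul_smul, neg_add, smul_neg]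
  congr 1
  ext l
  simp

/-- A divisor of the determinant of the change of basis bounds the height from below. -/
theorem norm_detFactor_ge_of_frame (γ : Sp (n + 1)) (W : Matrix (Fin (n + 1)) (Fin (n + 1)) ℤ)
    {Q : ℕ} {F : ℂ} (hQ : (Q : ℤ) ∣ W.det)
    (h : detFactor γ (basePoint (n + 1)).1 = (((castMat ℚ W).det : ℚ) : ℂ) * F) :
    Q * ‖F‖ ≤ height γ := by
  have hW : W.det ≠ 0 := by
    intro h0
    rw [castMat_det, h0, Int.cast_zero, Rat.cast_zero, zero_mul] at h
    exact detFactor_ne_zero γ _ h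
  rw [height, h, norm_mul]
  refine mul_le_mul_of_nonneg_right ?_ (norm_nonneg _)
  rw [castMat_det, Rat.cast_intCast, Complex.norm_intCast]
  have h1 : (Q : ℤ) ≤ |W.det| := Int.le_of_dvd (abs_pos.2 hW) ((dvd_abs _ _).2 hQ)
  exact_mod_cast h1

/-- The change of basis to the bordered frame has integral entries outside its zeroth column, and
the zeroth column becomes integral after multiplication by `ψ` or by `a`. -/
theorem exists_int_entries {γ : Sp (n + 1)} {g : Sp n} {V : Matrix (Fin (n + 1)) (Fin (n + 1)) ℚ}
    {a t : ℚ} {ψ φ : Fin n → ℚ}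
    (hC : castMat ℚ (blockC γ)
      = V * border a (-(ψ ᵥ* castMat ℚ (blockA g))) 0 (castMat ℚ (blockC g)))
    (hD : castMat ℚ (blockD γ)
      = V * border t (-(ψ ᵥ* castMat ℚ (blockB g))) φ (castMat ℚ (blockD g)))
    (i : Fin (n + 1)) :
    (∀ l : Fin n, ∃ z : ℤ, V i l.succ = z) ∧ (∀ l, ∃ z : ℤ, V i 0 * ψ l = z) ∧
      (∃ z : ℤ, V i 0 * a = z) ∧ ∃ z : ℤ, V i 0 * t + ∑ l : Fin n, V i l.succ * φ l = z := by
  have h1 := mul_border_succ V a (-(ψ ᵥ* castMat ℚ (blockA g))) 0 (castMat ℚ (blockC g)) i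
  have h2 := mul_border_succ V t (-(ψ ᵥ* castMat ℚ (blockB g))) φ (castMat ℚ (blockD g)) i
  rw [← hC] at h1
  rw [← hD] at h2
  obtain ⟨h3, h4⟩ := exists_int_coords g (c := fun l => blockC γ i l.succ)
    (d := fun l => blockD γ i l.succ) h1 h2
  refine ⟨h3, h4, ⟨blockC γ i 0, ?_⟩, ⟨blockD γ i 0, ?_⟩⟩
  · have h5 := mul_border_zero V a (-(ψ ᵥ* castMat ℚ (blockA g))) 0 (castMat ℚ (blockC g)) i
    rw [← hC] at h5
    simpa using h5.symm
  · have h5 := mul_border_zero V t (-(ψ ᵥ* castMat ℚ (blockB g))) φ (castMat ℚ (blockD g)) i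
    rw [← hD] at h5
    exact h5.symm

/-- The case of `exists_step` in which the zeroth column of `C` vanishes. -/
theorem step_degenerate {γ : Sp (n + 1)} {g : Sp n} {φ : Fin n → ℚ}
    (hφ : ∀ i, InLag γ (Fin.cons 0 (castMat ℚ (blockC g) i))
      (Fin.cons (φ i) (castMat ℚ (blockD g) i))) (hcol : ∀ i, blockC γ i 0 = 0) :
    IsFrame γ (border 0 0 0 (castMat ℚ (blockC g))) (border 1 0 0 (castMat ℚ (blockD g))) ∧
      height g ≤ height γ := by
  have he : InLag γ (0 : Fin (n + 1) → ℚ) (Fin.cons 1 0) := by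
    rw [InLag, mulVec_zero]
    ext i
    simp [mulVec, dotProduct, Fin.sum_univ_succ, hcol]
  have hrow : ∀ i, InLag γ (border (0 : ℚ) 0 0 (castMat ℚ (blockC g)) i)
      (border (1 : ℚ) 0 0 (castMat ℚ (blockD g)) i) := by
    intro i
    refine Fin.cases ?_ (fun i => ?_) i
    · have h0 : border (0 : ℚ) 0 0 (castMat ℚ (blockC g)) 0 = 0 := by
        rw [border_zero]
        ext j; refine Fin.cases ?_ (fun j => ?_) j <;> rfl
      rw [h0, border_zero]
      exact he
    · convert (hφ i).add (he.smul (-φ i)) using 1 <;> rw [border_succ] <;> ext j <;>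
        refine Fin.cases ?_ (fun j => ?_) j <;> simp
  have hA : border (0 : ℚ) 0 0 (castMat ℚ (blockC g))
      = border 0 (-(0 ᵥ* castMat ℚ (blockA g))) 0 (castMat ℚ (blockC g)) := by
    rw [zero_vecMul, neg_zero]
  have hB : border (1 : ℚ) 0 0 (castMat ℚ (blockD g))
      = border 1 (-(0 ᵥ* castMat ℚ (blockB g))) 0 (castMat ℚ (blockD g)) := by
    rw [zero_vecMul, neg_zero]
  have hdet : (frameDenom (border (0 : ℚ) 0 0 (castMat ℚ (blockC g)))
      (border (1 : ℚ) 0 0 (castMat ℚ (blockD g)))).det = detFactor g (basePoint n).1 := by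
    rw [hA, hB, frameDenom_border, det_border _ _ _ (detFactor_ne_zero g (basePoint n))]
    have h0 : (fun l : Fin n => (((0 : Fin n → ℚ) l : ℚ) : ℂ)) = 0 := by ext l; simp
    rw [h0, zero_vecMul, neg_zero, zero_dotProduct]
    simp [detFactor_eq]
  obtain ⟨h1, V, h2, h3, h4⟩ := exists_frame hrow (by rw [hdet]; exact detFactor_ne_zero g _)
  refine ⟨⟨h1, V, h2, h3⟩, ?_⟩
  rw [hA] at h2
  rw [hB] at h3
  obtain ⟨W, hW⟩ := exists_castMat_eq V fun i j => by
    obtain ⟨e1, -, -, e4⟩ := exists_int_entries h2 h3 i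
    refine Fin.cases ?_ (fun j => e1 j) j
    simpa using e4
  rw [hdet, hW] at h4
  simpa [height] using norm_detFactor_ge_of_frame γ W (Q := 1) (by simp) h4

/-- The case of `exists_step` in which the zeroth column of `C` does not vanish. -/
theorem step_generic {γ : Sp (n + 1)} {g : Sp n} {φ : Fin n → ℚ}
    (hφ : ∀ i, InLag γ (Fin.cons 0 (castMat ℚ (blockC g) i))
      (Fin.cons (φ i) (castMat ℚ (blockD g) i))) {k : Fin (n + 1)} (hk : blockC γ k 0 ≠ 0) :
    ∃ t : ℚ, IsFrame γ (border 1 (-(φ ᵥ* castMat ℚ (blockA g))) 0 (castMat ℚ (blockC g)))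
      (border t (-(φ ᵥ* castMat ℚ (blockB g))) φ (castMat ℚ (blockD g))) ∧
      ((vecDen φ ^ 2 * ((vecDen φ : ℚ) ^ 2 * t).den : ℕ) : ℝ) *
        (height g * ‖Complex.I + t + quadValue g fun l => (φ l : ℂ)‖) ≤ height γ := by
  set x := Pi.single k (castMat ℚ (blockC γ) k 0)⁻¹ ᵥ* castMat ℚ (blockC γ) with hx
  set y := Pi.single k (castMat ℚ (blockC γ) k 0)⁻¹ ᵥ* castMat ℚ (blockD γ) with hy
  have hxy : InLag γ x y := inLag_vecMul γ _
  have hx0 : x 0 = 1 := by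
    rw [hx, single_vecMul]
    exact inv_mul_cancel₀ (by simpa using hk)
  set α : Fin n → ℚ := fun l => x l.succ with hα
  set β : Fin n → ℚ := fun l => y l.succ with hβ
  have hxc : x = Fin.cons 1 α := by
    rw [← hx0]; exact (Fin.cons_self_tail x).symm
  have hyc : y = Fin.cons (y 0) β := (Fin.cons_self_tail y).symm
  have hφ' : φ = β ᵥ* (castMat ℚ (blockC g))ᵀ - α ᵥ* (castMat ℚ (blockD g))ᵀ := by
    ext i
    have h1 := (hφ i).isotropic hxy
    rw [hxc, hyc, dotProduct_cons, dotProduct_cons, zero_mul, zero_add, mul_one] at h1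
    rw [Pi.sub_apply, vecMul_transpose, vecMul_transpose]
    change φ i = castMat ℚ (blockC g) i ⬝ᵥ β - castMat ℚ (blockD g) i ⬝ᵥ α
    rw [h1]; ring
  set s : Fin n → ℚ := β ᵥ* (castMat ℚ (blockA g))ᵀ - α ᵥ* (castMat ℚ (blockB g))ᵀ with hs
  have hα' : α - s ᵥ* castMat ℚ (blockC g) = -(φ ᵥ* castMat ℚ (blockA g)) := by
    have e1 := cast_AtC ℚ g
    have e2 := cast_DtA ℚ g
    rw [sub_eq_iff_eq_add, hs, hφ', sub_vecMul, sub_vecMul, vecMul_vecMul, vecMul_vecMul,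
      vecMul_vecMul, vecMul_vecMul, e1, neg_sub, sub_add_sub_cancel, ← vecMul_sub, e2, vecMul_one]
  have hβ' : β - s ᵥ* castMat ℚ (blockD g) = -(φ ᵥ* castMat ℚ (blockB g)) := by
    have e1 := cast_BtD ℚ g
    have e2 := cast_AtD ℚ g
    rw [sub_eq_iff_eq_add, hs, hφ', sub_vecMul, sub_vecMul, vecMul_vecMul, vecMul_vecMul,
      vecMul_vecMul, vecMul_vecMul, e1, neg_sub, add_comm, sub_add_sub_cancel, ← vecMul_sub, e2,
      vecMul_one]
  set t : ℚ := y 0 - s ⬝ᵥ φ with ht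
  have hlift : ∀ (ψ : Fin n → ℚ) (X : Matrix (Fin n) (Fin n) ℚ),
      ∑ i, (-s i) • (Fin.cons (ψ i) (X i) : Fin (n + 1) → ℚ) = Fin.cons (-(s ⬝ᵥ ψ)) (-(s ᵥ* X)) := by
    intro ψ X
    ext j
    refine Fin.cases ?_ (fun j => ?_) j <;> simp [Finset.sum_apply, vecMul, dotProduct]
  have hrow : ∀ i, InLag γ
      (border (1 : ℚ) (-(φ ᵥ* castMat ℚ (blockA g))) 0 (castMat ℚ (blockC g)) i)
      (border t (-(φ ᵥ* castMat ℚ (blockB g))) φ (castMat ℚ (blockD g)) i) := by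
    intro i
    refine Fin.cases ?_ (fun i => hφ i) i
    have h1 := hxy.add (InLag.sum Finset.univ fun i _ => (hφ i).smul (-s i))
    have h2 := hlift (fun _ => 0) (castMat ℚ (blockC g))
    have h3 := hlift φ (castMat ℚ (blockD g))
    rw [h2, h3, hxc, hyc] at h1
    convert h1 using 1
    · rw [border_zero, ← hα']
      ext j
      refine Fin.cases ?_ (fun j => ?_) j <;> simp [dotProduct, sub_eq_add_neg]
    · rw [border_zero, ← hβ']
      ext j
      refine Fin.cases ?_ (fun j => ?_) j <;> simp [ht, sub_eq_add_neg]
  have hdet : (frameDenom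
      (border (1 : ℚ) (-(φ ᵥ* castMat ℚ (blockA g))) 0 (castMat ℚ (blockC g)))
      (border t (-(φ ᵥ* castMat ℚ (blockB g))) φ (castMat ℚ (blockD g)))).det
        = detFactor g (basePoint n).1 * (Complex.I + t + quadValue g fun l => (φ l : ℂ)) := by
    rw [frameDenom_border, det_border _ _ _ (detFactor_ne_zero g (basePoint n)), quadValue,
      detFactor_eq, neg_dotProduct, sub_neg_eq_add, Rat.cast_one, mul_one]
  have hne : Complex.I + t + quadValue g (fun l => (φ l : ℂ)) ≠ 0 := by
    intro h0
    have h1 := congrArg Complex.im h0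
    have h2 := quadValue_im g (φ := fun l => (φ l : ℂ)) (by ext l; simp)
    have h3 := gramForm_nonneg g fun l => (φ l : ℂ)
    simp [h2] at h1
    linarith
  obtain ⟨h1, V, h2, h3, h4⟩ := exists_frame hrow (by
    rw [hdet]; exact mul_ne_zero (detFactor_ne_zero g _) hne)
  refine ⟨t, ⟨h1, V, h2, h3⟩, ?_⟩
  obtain ⟨W, hW⟩ := exists_castMat_eq V fun i j => by
    obtain ⟨e1, -, e3, -⟩ := exists_int_entries h2 h3 i
    refine Fin.cases ?_ (fun j => e1 j) j
    simpa using e3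
  rw [hdet, hW] at h4
  have h5 := norm_detFactor_ge_of_frame γ W (dvd_det_of_denominators W φ t
    (fun i l => by
      obtain ⟨-, e2, -, -⟩ := exists_int_entries h2 h3 i
      rw [hW] at e2
      exact e2 l)
    (fun i => by
      obtain ⟨-, -, -, e4⟩ := exists_int_entries h2 h3 i
      rw [hW] at e4
      exact e4)) h4
  rwa [norm_mul] at h5

/-- A Lagrangian in degree `n + 1` comes from one in degree `n` and, in the generic case, from
rational parameters `φ ∈ ℚⁿ` and `t ∈ ℚ`; the height is controlled by the height in degree `n`
and the denominators of `φ` and `t`. -/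
theorem exists_step (γ : Sp (n + 1)) : ∃ c : Lagrangians n,
    (IsFrame γ (border 0 0 0 (castMat ℚ (blockC (Quotient.out c))))
        (border 1 0 0 (castMat ℚ (blockD (Quotient.out c)))) ∧
      height (Quotient.out c) ≤ height γ) ∨
    ∃ (φ : Fin n → ℚ) (t : ℚ),
      IsFrame γ (border 1 (-(φ ᵥ* castMat ℚ (blockA (Quotient.out c)))) 0
          (castMat ℚ (blockC (Quotient.out c))))
        (border t (-(φ ᵥ* castMat ℚ (blockB (Quotient.out c)))) φ
          (castMat ℚ (blockD (Quotient.out c)))) ∧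
      ((vecDen φ ^ 2 * ((vecDen φ : ℚ) ^ 2 * t).den : ℕ) : ℝ) * (height (Quotient.out c) *
        ‖Complex.I + t + quadValue (Quotient.out c) fun l => (φ l : ℂ)‖) ≤ height γ := by
  obtain ⟨c, φ, hφ⟩ := exists_reduction γ
  refine ⟨c, ?_⟩
  by_cases hcol : ∀ i, blockC γ i 0 = 0
  · exact Or.inl (step_degenerate hφ hcol)
  · push Not at hcol
    obtain ⟨k, hk⟩ := hcol
    exact Or.inr ⟨φ, step_generic hφ hk⟩

end Step

/-! ### Convergence of the sum of heights over Lagrangians -/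

section Convergence

variable {n : ℕ}

/-- The parameters `(c, a, q, b, j)` of a generic Lagrangian in degree `n + 1`: it reduces to `c`
and has `φ = a / q`, `t = j / (q² b)`. -/
abbrev StepIndex (n : ℕ) : Type := Lagrangians n × (Fin n → ℤ) × ℕ × ℕ × ℤ

/-- The basis of the Lagrangian attached to its parameters. -/
noncomputable def frameOf : Lagrangians n ⊕ StepIndex n →
    Matrix (Fin (n + 1)) (Fin (n + 1)) ℚ × Matrix (Fin (n + 1)) (Fin (n + 1)) ℚ
  | Sum.inl c => (border 0 0 0 (castMat ℚ (blockC (Quotient.out c))),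
      border 1 0 0 (castMat ℚ (blockD (Quotient.out c))))
  | Sum.inr (c, a, q, b, j) =>
      (border 1 (-((fun l => (a l : ℚ) / q) ᵥ* castMat ℚ (blockA (Quotient.out c)))) 0
          (castMat ℚ (blockC (Quotient.out c))),
        border ((j : ℚ) / b / (q : ℚ) ^ 2)
          (-((fun l => (a l : ℚ) / q) ᵥ* castMat ℚ (blockB (Quotient.out c))))
          (fun l => (a l : ℚ) / q) (castMat ℚ (blockD (Quotient.out c))))

/-- The upper bound for the inverse `k`-th power of the height in terms of the parameters. -/
noncomputable def stepBound (k : ℕ) : StepIndex n → ℝ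
  | (c, a, q, b, j) => (height (Quotient.out c) ^ k)⁻¹ *
      (((1 + gramForm (Quotient.out c) fun l => (a l : ℂ)) ^ (k - 2))⁻¹ * (((q : ℝ) ^ 2)⁻¹ *
        (((b : ℝ) ^ 2)⁻¹ * (((q ^ 2 * b : ℕ) : ℝ)⁻¹ * (1 + ((j : ℝ) / ((q ^ 2 * b : ℕ) : ℝ) +
          (quadValue (Quotient.out c) fun l => (a l : ℂ) / q).re) ^ 2)⁻¹))))

theorem inv_norm_pow_le {z : ℂ} {s G : ℝ} (hG : 0 ≤ G) (hre : z.re = s) (him : z.im = 1 + G)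
    (m : ℕ) : (‖z‖ ^ (m + 2))⁻¹ ≤ ((1 + G) ^ m)⁻¹ * (1 + s ^ 2)⁻¹ := by
  rw [← mul_inv]
  have h1 : ‖z‖ ^ 2 = s ^ 2 + (1 + G) ^ 2 := by
    rw [← Complex.normSq_eq_norm_sq, Complex.normSq_apply, hre, him]; ring
  have h2 : 1 + G ≤ ‖z‖ := by
    rw [← him]; exact (le_abs_self _).trans (Complex.abs_im_le_norm z)
  refine inv_anti₀ (by positivity) ?_
  rw [pow_add, h1]
  refine mul_le_mul (pow_le_pow_left₀ (by positivity) h2 m) ?_ (by positivity) (by positivity)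
  nlinarith

theorem gramForm_div (g : Sp n) (a : Fin n → ℂ) (q : ℕ) :
    gramForm g (fun l => a l / q) = gramForm g a / (q : ℝ) ^ 2 := by
  have h : (fun l => a l / (q : ℂ)) = ((q : ℂ)⁻¹) • a := by
    ext l; simp [div_eq_inv_mul]
  rw [h, gramForm, gramForm, Finset.sum_div]
  refine Finset.sum_congr rfl fun j _ => ?_
  rw [mulVec_smul, Pi.smul_apply, smul_eq_mul, norm_mul, mul_pow, norm_inv, Complex.norm_natCast,
    inv_pow, div_eq_inv_mul]

theorem inv_height_pow_le {γ : Sp (n + 1)} {c : Lagrangians n} {a : Fin n → ℤ} {q b : ℕ} {j : ℤ}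
    (hq : 0 < q) (hb : 0 < b)
    (h : ((q ^ 2 * b : ℕ) : ℝ) * (height (Quotient.out c) *
      ‖Complex.I + (((j : ℝ) / ((q ^ 2 * b : ℕ) : ℝ) : ℝ) : ℂ)
        + quadValue (Quotient.out c) fun l => (a l : ℂ) / q‖) ≤ height γ)
    {k : ℕ} (hk : 3 ≤ k) : (height γ ^ k)⁻¹ ≤ stepBound k (c, a, q, b, j) := by
  obtain ⟨m, rfl⟩ : ∃ m, k = m + 2 := ⟨k - 2, by omega⟩
  set g := Quotient.out c with hg
  set Q : ℝ := ((q ^ 2 * b : ℕ) : ℝ) with hQ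
  set z := Complex.I + (((j : ℝ) / Q : ℝ) : ℂ) + quadValue g fun l => (a l : ℂ) / q with hz
  set x := (quadValue g fun l => (a l : ℂ) / q).re with hx
  set G := gramForm g fun l => (a l : ℂ) with hG
  have hG0 : 0 ≤ G := gramForm_nonneg _ _
  have hq1 : (1 : ℝ) ≤ q := by exact_mod_cast hq
  have hb1 : (1 : ℝ) ≤ b := by exact_mod_cast hb
  have hQe : Q = (q : ℝ) ^ 2 * b := by rw [hQ]; push_cast; ring
  have hQ0 : 0 < Q := by rw [hQe]; positivity
  have hh := height_pos g
  have him : z.im = 1 + G / (q : ℝ) ^ 2 := by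
    rw [hz, Complex.add_im, quadValue_im, gramForm_div]
    · simp [hG]
    · ext l; simp
  have hre : z.re = (j : ℝ) / Q + x := by
    rw [hz, Complex.add_re]; simp [x]
  have hzpos : 0 < ‖z‖ := by
    refine norm_pos_iff.2 fun h0 => ?_
    rw [h0, Complex.zero_im] at him
    have : 0 ≤ G / (q : ℝ) ^ 2 := by positivity
    linarith
  have h1 := inv_norm_pow_le (G := G / (q : ℝ) ^ 2) (by positivity) hre him m
  have h2 : ((1 + G / (q : ℝ) ^ 2) ^ m)⁻¹ ≤ (q : ℝ) ^ (2 * m) * ((1 + G) ^ m)⁻¹ := by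
    have h3 : (1 + G) / (q : ℝ) ^ 2 ≤ 1 + G / (q : ℝ) ^ 2 := by
      rw [add_div]
      have : 1 / (q : ℝ) ^ 2 ≤ 1 := by
        rw [div_le_one (by positivity)]; exact one_le_pow₀ hq1
      linarith
    calc ((1 + G / (q : ℝ) ^ 2) ^ m)⁻¹ ≤ (((1 + G) / (q : ℝ) ^ 2) ^ m)⁻¹ :=
          inv_anti₀ (by positivity) (pow_le_pow_left₀ (by positivity) h3 m)
      _ = _ := by rw [div_pow, inv_div, pow_mul, div_eq_mul_inv]
  have h4 : (Q ^ (m + 2))⁻¹ * (q : ℝ) ^ (2 * m)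
      ≤ ((q : ℝ) ^ 2)⁻¹ * (((b : ℝ) ^ 2)⁻¹ * Q⁻¹) := by
    have hm : 1 ≤ m := by omega
    obtain ⟨p, rfl⟩ : ∃ p, m = p + 1 := ⟨m - 1, by omega⟩
    have h5 : (Q ^ (p + 1 + 2))⁻¹ * (q : ℝ) ^ (2 * (p + 1))
        = ((q : ℝ) ^ 2)⁻¹ * (((b : ℝ) ^ 2)⁻¹ * Q⁻¹) * ((b : ℝ) ^ p)⁻¹ := by
      rw [hQe]
      have hq0 : (q : ℝ) ≠ 0 := by positivity
      have hb0 : (b : ℝ) ≠ 0 := by positivity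
      field_simp
      ring
    rw [h5]
    exact mul_le_of_le_one_right (by positivity) (inv_le_one_of_one_le₀ (one_le_pow₀ hb1))
  calc (height γ ^ (m + 2))⁻¹ ≤ ((Q * (height g * ‖z‖)) ^ (m + 2))⁻¹ :=
        inv_anti₀ (by positivity) (pow_le_pow_left₀ (by positivity) h _)
    _ = (height g ^ (m + 2))⁻¹ * ((Q ^ (m + 2))⁻¹ * (‖z‖ ^ (m + 2))⁻¹) := by
        rw [mul_pow, mul_pow, mul_inv, mul_inv]; ring
    _ ≤ (height g ^ (m + 2))⁻¹ * ((Q ^ (m + 2))⁻¹ *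
          ((q : ℝ) ^ (2 * m) * ((1 + G) ^ m)⁻¹ * (1 + ((j : ℝ) / Q + x) ^ 2)⁻¹)) := by
        gcongr
        exact h1.trans (mul_le_mul_of_nonneg_right h2 (by positivity))
    _ = (height g ^ (m + 2))⁻¹ * (((1 + G) ^ m)⁻¹ * (((Q ^ (m + 2))⁻¹ * (q : ℝ) ^ (2 * m)) *
          (1 + ((j : ℝ) / Q + x) ^ 2)⁻¹)) := by ring
    _ ≤ (height g ^ (m + 2))⁻¹ * (((1 + G) ^ m)⁻¹ *
          ((((q : ℝ) ^ 2)⁻¹ * (((b : ℝ) ^ 2)⁻¹ * Q⁻¹)) * (1 + ((j : ℝ) / Q + x) ^ 2)⁻¹)) := by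
        gcongr
    _ = stepBound (m + 2) (c, a, q, b, j) := by
        rw [stepBound, Nat.add_sub_cancel]; ring

/-- Every Lagrangian in degree `n + 1` has parameters, which determine it and bound its height. -/
theorem exists_stepIndex {k : ℕ} (hk : 3 ≤ k) (γ : Sp (n + 1)) : ∃ p : Lagrangians n ⊕ StepIndex n,
    IsFrame γ (frameOf p).1 (frameOf p).2 ∧ (height γ ^ k)⁻¹ ≤
      Sum.elim (fun c => (height (Quotient.out c) ^ k)⁻¹) (stepBound k) p := by
  obtain ⟨c, ⟨h1, h2⟩ | ⟨φ, t, h1, h2⟩⟩ := exists_step γ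
  · refine ⟨Sum.inl c, h1, ?_⟩
    have := height_pos (Quotient.out c)
    exact inv_anti₀ (by positivity) (pow_le_pow_left₀ this.le h2 k)
  · obtain ⟨a, ha⟩ := exists_vecDen_mul φ
    set q := vecDen φ with hq
    have hq0 : 0 < q := vecDen_pos φ
    have hφ : φ = fun l => (a l : ℚ) / q := funext ha
    set b := ((q : ℚ) ^ 2 * t).den with hb
    set j := ((q : ℚ) ^ 2 * t).num with hj
    have hb0 : 0 < b := Rat.den_pos _
    have ht : t = (j : ℚ) / b / (q : ℚ) ^ 2 := by
      rw [hb, hj, Rat.num_div_den]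
      have : (q : ℚ) ≠ 0 := by exact_mod_cast hq0.ne'
      field_simp
    refine ⟨Sum.inr (c, a, q, b, j), ?_, ?_⟩
    · rw [frameOf, ← ht, ← hφ]
      exact h1
    · refine inv_height_pow_le hq0 hb0 ?_ hk
      convert h2 using 5
      · rw [ht]
        push_cast
        rw [div_div, mul_comm]
      · simp only [ha, Rat.cast_div, Rat.cast_intCast, Rat.cast_natCast]

/-- The sum of the inverse `k`-th powers of the heights of all Lagrangians. -/
noncomputable def heightZeta (n k : ℕ) : ℝ≥0∞ :=
  ∑' c : Lagrangians n, ENNReal.ofReal (height (Quotient.out c) ^ k)⁻¹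

theorem tsum_inv_sq_ne_top : ∑' b : ℕ, ENNReal.ofReal ((b : ℝ) ^ 2)⁻¹ ≠ ∞ :=
  (Real.summable_nat_pow_inv.2 (by norm_num)).tsum_ofReal_ne_top

theorem tsum_stepBound_le {k : ℕ} (hk : n + 2 ≤ k) (h1 : 1 ≤ k) :
    ∑' p : StepIndex n, ENNReal.ofReal (stepBound k p) ≤ heightZeta n (k - 1) *
      (ENNReal.ofReal ((4 * n + 1) ^ n) * floorConst ^ n *
        ((∑' b : ℕ, ENNReal.ofReal ((b : ℝ) ^ 2)⁻¹) *
          ((∑' b : ℕ, ENNReal.ofReal ((b : ℝ) ^ 2)⁻¹) * floorConst))) := by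
  set Z := ∑' b : ℕ, ENNReal.ofReal ((b : ℝ) ^ 2)⁻¹ with hZ
  rw [ENNReal.tsum_prod', heightZeta, ← ENNReal.tsum_mul_right]
  refine ENNReal.tsum_le_tsum fun c => ?_
  have hh := height_pos (Quotient.out c)
  have hpow : ENNReal.ofReal (height (Quotient.out c) ^ (k - 1))⁻¹
      = ENNReal.ofReal (height (Quotient.out c) ^ k)⁻¹ * ENNReal.ofReal (height (Quotient.out c)) := by
    rw [← ENNReal.ofReal_mul (by positivity)]
    congr 1
    obtain ⟨m, rfl⟩ : ∃ m, k = m + 1 := ⟨k - 1, by omega⟩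
    rw [Nat.add_sub_cancel, pow_succ]
    field_simp
  have h2 := tsum_gramForm_le (Quotient.out c) (m := k - 2) (by omega)
  have key : ∑' p : (Fin n → ℤ) × ℕ × ℕ × ℤ, ENNReal.ofReal (stepBound k (c, p))
      ≤ ENNReal.ofReal (height (Quotient.out c) ^ k)⁻¹ *
        ((∑' a : Fin n → ℤ, ENNReal.ofReal
          ((1 + gramForm (Quotient.out c) fun i => (a i : ℂ)) ^ (k - 2))⁻¹) *
          (Z * (Z * floorConst))) := by
    rw [ENNReal.tsum_prod', ← ENNReal.tsum_mul_right, ← ENNReal.tsum_mul_left]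
    refine ENNReal.tsum_le_tsum fun a => ?_
    have hG := gramForm_nonneg (Quotient.out c) fun i => (a i : ℂ)
    simp only [stepBound]
    have e : ∀ p : ℕ × ℕ × ℤ, _ = _ := fun p => ENNReal.ofReal_mul (p := (height (Quotient.out c) ^ k)⁻¹)
      (q := (((1 + gramForm (Quotient.out c) fun l => (a l : ℂ)) ^ (k - 2))⁻¹ * (((p.1 : ℝ) ^ 2)⁻¹ *
        (((p.2.1 : ℝ) ^ 2)⁻¹ * (((p.1 ^ 2 * p.2.1 : ℕ) : ℝ)⁻¹ *
          (1 + ((p.2.2 : ℝ) / ((p.1 ^ 2 * p.2.1 : ℕ) : ℝ) +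
          (quadValue (Quotient.out c) fun l => (a l : ℂ) / p.1).re) ^ 2)⁻¹))))) (by positivity)
    rw [tsum_congr e, ENNReal.tsum_mul_left]
    refine mul_le_mul_right ?_ _
    have e' : ∀ p : ℕ × ℕ × ℤ, _ = _ := fun p => ENNReal.ofReal_mul
      (p := ((1 + gramForm (Quotient.out c) fun l => (a l : ℂ)) ^ (k - 2))⁻¹)
      (q := (((p.1 : ℝ) ^ 2)⁻¹ *
        (((p.2.1 : ℝ) ^ 2)⁻¹ * (((p.1 ^ 2 * p.2.1 : ℕ) : ℝ)⁻¹ *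
          (1 + ((p.2.2 : ℝ) / ((p.1 ^ 2 * p.2.1 : ℕ) : ℝ) +
          (quadValue (Quotient.out c) fun l => (a l : ℂ) / p.1).re) ^ 2)⁻¹)))) (by positivity)
    rw [tsum_congr e', ENNReal.tsum_mul_left]
    refine mul_le_mul_right ?_ _
    rw [ENNReal.tsum_prod', hZ, ← ENNReal.tsum_mul_right]
    refine ENNReal.tsum_le_tsum fun q => ?_
    simp only
    rw [tsum_congr fun p : ℕ × ℤ => ENNReal.ofReal_mul (p := ((q : ℝ) ^ 2)⁻¹) (by positivity),
      ENNReal.tsum_mul_left]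
    refine mul_le_mul_right ?_ _
    rw [ENNReal.tsum_prod', ← ENNReal.tsum_mul_right]
    refine ENNReal.tsum_le_tsum fun b => ?_
    simp only
    rw [tsum_congr fun p : ℤ => ENNReal.ofReal_mul (p := ((b : ℝ) ^ 2)⁻¹) (by positivity),
      ENNReal.tsum_mul_left]
    exact mul_le_mul_right (tsum_shift_le _ _) _
  refine key.trans ?_
  rw [hpow, mul_assoc]
  refine mul_le_mul_right ?_ _
  refine (mul_le_mul_left h2 _).trans_eq ?_
  change _ * ENNReal.ofReal (height (Quotient.out c)) * _ = _
  ring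

/-- The sum of the inverse `k`-th powers of the heights converges for `k ≥ n + 2`. -/
theorem heightZeta_ne_top (n : ℕ) : ∀ k, n + 2 ≤ k → heightZeta n k ≠ ∞ := by
  induction n with
  | zero =>
    intro k _
    have h1 : Subsingleton (Sp 0) := ⟨fun a b => Subtype.ext (Matrix.ext fun i => by
      rcases i with i | i <;> exact i.elim0)⟩
    have h2 : Finite (Lagrangians 0) := Quotient.finite _
    have := Fintype.ofFinite (Lagrangians 0)
    rw [heightZeta, tsum_fintype]
    exact ENNReal.sum_ne_top.2 fun _ _ => ENNReal.ofReal_ne_top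
  | succ n ih =>
    intro k hk
    choose p hp hbound using fun c : Lagrangians (n + 1) =>
      exists_stepIndex (k := k) (by omega) (Quotient.out c)
    have hinj : Function.Injective p := by
      intro c c' h
      have h1 := hp c
      rw [h] at h1
      have h2 := h1.mk_eq_mk (hp c')
      rwa [Quotient.out_eq, Quotient.out_eq] at h2
    have h1 : heightZeta (n + 1) k ≤ heightZeta n k
        + ∑' i : StepIndex n, ENNReal.ofReal (stepBound k i) := by
      calc heightZeta (n + 1) k ≤ ∑' c, (fun i => ENNReal.ofReal
            (Sum.elim (fun c => (height (Quotient.out c) ^ k)⁻¹) (stepBound k) i)) (p c) :=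
            ENNReal.tsum_le_tsum fun c => ENNReal.ofReal_le_ofReal (hbound c)
        _ ≤ ∑' i, ENNReal.ofReal
            (Sum.elim (fun c => (height (Quotient.out c) ^ k)⁻¹) (stepBound k) i) :=
            ENNReal.tsum_comp_le_tsum_of_injective hinj _
        _ = _ := Summable.tsum_sum ENNReal.summable ENNReal.summable
    refine ne_top_of_le_ne_top (ENNReal.add_ne_top.2 ⟨ih k (by omega), ?_⟩) h1
    refine ne_top_of_le_ne_top ?_ (tsum_stepBound_le (by omega) (by omega))
    refine ENNReal.mul_ne_top (ih _ (by omega)) (ENNReal.mul_ne_top (ENNReal.mul_ne_top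
      ENNReal.ofReal_ne_top (ENNReal.pow_ne_top floorConst_ne_top)) ?_)
    exact ENNReal.mul_ne_top tsum_inv_sq_ne_top
      (ENNReal.mul_ne_top tsum_inv_sq_ne_top floorConst_ne_top)

end Convergence

/-! ### Convergence of `𝔼*` and its constant term -/

section ConstantTerm

variable {n k N : ℕ}

theorem det_blockA_sq {p : Sp n} (hp : blockC p = 0) :
    (blockA p).det ^ 2 = 1 ∧ (blockD p).det = (blockA p).det := by
  have h := cast_det_mul_of_blockC ℤ p (by rw [hp, castMat_zero])
  rw [Int.cast_id, Int.cast_id] at h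
  rcases Int.eq_one_or_neg_one_of_mul_eq_one h with h1 | h1 <;> rw [h1] at h ⊢
  · exact ⟨by norm_num, by linarith⟩
  · exact ⟨by norm_num, by linarith⟩

theorem height_mul_of_blockC {p : Sp n} (hp : blockC p = 0) (g : Sp n) :
    height (p * g) = height g := by
  obtain ⟨h1, h2⟩ := det_blockA_sq hp
  rw [height, detFactor_mul, detFactor_of_blockC_eq_zero hp, h2, norm_mul, height]
  rcases mul_self_eq_one_iff.1 (sq (blockA p).det ▸ h1) with h3 | h3 <;> simp [h3]

theorem mul_inv_mem_GammaInfPlus {p p' : Sp n} (hp : blockC p = 0) (hp' : blockC p' = 0)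
    (h : (blockA p).det = (blockA p').det) : p * p'⁻¹ ∈ GammaInfPlus n := by
  have h0 : blockC p'⁻¹ = 0 := by rw [blockC_inv, hp', transpose_zero, neg_zero]
  obtain ⟨h1, h2⟩ := det_blockA_sq hp'
  refine ⟨by rw [blockC_mul, hp, h0, zero_mul, mul_zero, add_zero], ?_⟩
  rw [blockA_mul, h0, mul_zero, add_zero, blockA_inv, det_mul, det_transpose, h2, h, ← sq, h1]

/-- Absolute convergence of `𝔼* | g` at the point `i I`. -/
theorem summable_inv_height_pow (hk : n + 2 ≤ k) (g : Sp n) :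
    Summable fun c : RightCosets (GammaInfPlus n) (GammaN n N) => (height (rep c * g) ^ k)⁻¹ := by
  classical
  let L : RightCosets (GammaInfPlus n) (GammaN n N) → Lagrangians n := fun c =>
    Quotient.mk _ (rep c * g)
  let p : RightCosets (GammaInfPlus n) (GammaN n N) → Sp n := fun c =>
    rep c * g * (Quotient.out (L c))⁻¹
  have hp : ∀ c, blockC (p c) = 0 := fun c => mk_eq_mk_iff.1 (Quotient.out_eq (L c)).symm
  have hpg : ∀ c, rep c * g = p c * Quotient.out (L c) := fun c => by simp [p]
  let ψ : RightCosets (GammaInfPlus n) (GammaN n N) → Bool × Lagrangians n := fun c =>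
    (decide ((blockA (p c)).det = 1), L c)
  -- A Lagrangian has two classes of bases modulo `SL_n(ℤ)`, which differ by the sign of `det A`.
  have hψ : Function.Injective ψ := by
    intro c c' h
    obtain ⟨h1, h2⟩ := Prod.ext_iff.1 h
    change L c = L c' at h2
    have h3 : (blockA (p c)).det = (blockA (p c')).det := by
      have h4 := decide_eq_decide.1 h1
      rcases mul_self_eq_one_iff.1 (sq (blockA (p c)).det ▸ (det_blockA_sq (hp c)).1) with h5 | h5 <;>
        rcases mul_self_eq_one_iff.1 (sq (blockA (p c')).det ▸ (det_blockA_sq (hp c')).1) with h6 | h6 <;>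
        rw [h5, h6] at h4 ⊢ <;> norm_num at h4
    have h5 := mul_inv_mem_GammaInfPlus (hp c) (hp c') h3
    rw [← cosetOf_rep c, ← cosetOf_rep c', cosetOf_eq_iff]
    have h6 : p c * (p c')⁻¹ = rep c * (rep c')⁻¹ := by
      simp only [p, h2]; group
    rwa [h6] at h5
  have hle : ∑' c : RightCosets (GammaInfPlus n) (GammaN n N),
      ENNReal.ofReal (height (rep c * g) ^ k)⁻¹ ≤ 2 * heightZeta n k := by
    calc _ = ∑' c, (fun x : Bool × Lagrangians n =>
          ENNReal.ofReal (height (Quotient.out x.2) ^ k)⁻¹) (ψ c) := by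
          refine tsum_congr fun c => ?_
          rw [hpg c, height_mul_of_blockC (hp c)]
      _ ≤ ∑' x : Bool × Lagrangians n, ENNReal.ofReal (height (Quotient.out x.2) ^ k)⁻¹ :=
          ENNReal.tsum_comp_le_tsum_of_injective hψ _
      _ = 2 * heightZeta n k := by
          rw [ENNReal.tsum_prod', tsum_fintype, Fintype.sum_bool, heightZeta, two_mul]
  have hne := ne_top_of_le_ne_top
    (ENNReal.mul_ne_top ENNReal.ofNat_ne_top (heightZeta_ne_top n k hk)) hle
  refine (ENNReal.summable_toReal hne).congr fun c => ?_
  have := height_pos (rep c * g)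
  rw [ENNReal.toReal_ofReal (by positivity)]

open Classical in
/-- The limit of `1 | δ` at infinity. -/
noncomputable def constTerm (k : ℕ) (δ : Sp n) : ℂ :=
  if blockC δ = 0 then ((((blockD δ).det : ℤ) : ℂ) ^ k)⁻¹ else 0

theorem norm_constTerm_le (δ : Sp n) : ‖constTerm k δ‖ ≤ (height δ ^ k)⁻¹ := by
  rw [constTerm]
  split_ifs with h
  · rw [height, detFactor_of_blockC_eq_zero h, norm_inv, norm_pow]
  · rw [norm_zero]
    have := height_pos δ
    positivity

theorem tendsto_constTerm (hk : k ≠ 0) (δ : Sp n) :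
    Filter.Tendsto (fun m : ℕ => (detFactor δ (seqPoint n m).1 ^ k)⁻¹) Filter.atTop
      (nhds (constTerm k δ)) := by
  rw [constTerm]
  split_ifs with h
  · simp only [detFactor_of_blockC_eq_zero h]
    exact tendsto_const_nhds
  · rw [tendsto_zero_iff_norm_tendsto_zero]
    simp only [norm_inv, norm_pow]
    exact ((Filter.tendsto_pow_atTop hk).comp (tendsto_norm_detFactor δ h)).inv_tendsto_atTop

/-- The limit of `𝔼* | g` at infinity, computed term by term. -/
theorem tendsto_slash_Estar (hk : n + 2 ≤ k) (g : Sp n) :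
    Filter.Tendsto (fun m : ℕ => slash k (Estar n k N) g (seqPoint n m).1) Filter.atTop
      (nhds (∑' c : RightCosets (GammaInfPlus n) (GammaN n N), constTerm k (rep c * g))) := by
  simp only [slash_Estar]
  refine tendsto_tsum_of_dominated_convergence (summable_inv_height_pow hk g)
    (fun c => tendsto_constTerm (by omega) _) (Filter.Eventually.of_forall fun m c => ?_)
  rw [norm_inv, norm_pow]
  have h := height_pos (rep c * g)
  refine inv_anti₀ (by positivity) (pow_le_pow_left₀ h.le ?_ k)
  exact norm_detFactor_le_imagPoint _ (by linarith [(Nat.cast_nonneg m : (0 : ℝ) ≤ m)])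

theorem summable_constTerm (hk : n + 2 ≤ k) (g : Sp n) :
    Summable fun c : RightCosets (GammaInfPlus n) (GammaN n N) => constTerm k (rep c * g) :=
  Summable.of_norm_bounded (summable_inv_height_pow hk g) fun _ => norm_constTerm_le _

theorem det_blockA_mul {a b : Sp n} (hb : b ∈ Gamma0 n N) :
    ((blockA (a * b)).det : ZMod N) = ((blockA a).det : ZMod N) * ((blockA b).det : ZMod N) := by
  rw [← castMat_det, ← castMat_det, ← castMat_det, blockA_mul, castMat_add, castMat_mul,
    castMat_mul, mem_Gamma0.1 hb, mul_zero, add_zero, det_mul]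

/-- If `χ_q² = 1` at the primes where `M` is neither invertible nor zero, no cancellation occurs
among the constant terms of `𝔼'_σ`: after multiplication by `χ̄`, each of them is `0` or `1`. -/
theorem conj_charVal_mul_constTerm (hN : Squarefree N) {χ : DirichletCharacter ℂ N}
    (hpar : χ (-1) = (-1) ^ k) {M : Matrix (Fin n) (Fin n) ℤ} (hM : IsRepMatrix N M)
    (hχ : ∀ (q : ℕ) (_ : q.Prime) (hqN : q ∣ N), 0 < rankMod q M → rankMod q M < n →
      component χ (exactDvd_of_squarefree hN hqN) ^ 2 = 1)
    {h β ν : Sp n} (hh : blockC h = 0) (hβ : β ∈ Gamma0 n N) (hν : ν ∈ GammaN n N)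
    (hC : blockC (ν * (h * gammaLower M hM.isSymm * β * (gammaLower M hM.isSymm)⁻¹)) = 0) :
    starRingEnd ℂ (charVal χ (h * β)) *
      constTerm k (ν * (h * gammaLower M hM.isSymm * β * (gammaLower M hM.isSymm)⁻¹)) = 1 := by
  set γ := gammaLower M hM.isSymm with hγ
  set σ := γ * β * γ⁻¹ with hσ
  have hρ : ν * (h * γ * β * γ⁻¹) = ν * (h * σ) := by rw [hσ]; group
  rw [hρ] at hC ⊢
  set ρ := ν * (h * σ) with hρd
  obtain ⟨he, heD⟩ := det_blockA_sq hC
  obtain ⟨hε, hεD⟩ := det_blockA_sq hh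
  set e := (blockA ρ).det with hed
  set ε := (blockA h).det with hεd
  have hh0 : h ∈ Gamma0 n N := by rw [mem_Gamma0, hh, castMat_zero]
  have hρ0 : ρ ∈ Gamma0 n N := by rw [mem_Gamma0, hC, castMat_zero]
  have hσ0 : σ ∈ Gamma0 n N := by
    have e1 : σ = h⁻¹ * (ν⁻¹ * ρ) := by rw [hρd]; group
    rw [e1]
    exact mul_mem (inv_mem hh0) (mul_mem (inv_mem (GammaN_le_Gamma0 hν)) hρ0)
  have hcast : ∀ z : ℤ, z ^ 2 = 1 → (z : ZMod N) * z = 1 := fun z hz => by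
    rw [← sq]; exact_mod_cast congrArg (Int.cast : ℤ → ZMod N) hz
  have hdetσ : ((blockA σ).det : ZMod N) = ((ε * e : ℤ) : ZMod N) := by
    have e2 : (e : ZMod N) = ε * ((blockA σ).det : ZMod N) := by
      rw [hed, hρd, det_blockA_mul (mul_mem hh0 hσ0), det_blockA_mul hσ0,
        ← castMat_det (ZMod N) (blockA ν), (mem_GammaN.1 hν).1, det_one, one_mul]
    rw [Int.cast_mul, e2, ← mul_assoc, hcast ε hε, one_mul]
  have h1 := charVal_eq_of_conj hN χ hM hχ hβ (ε := ε * e)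
    (by rw [mul_pow, hε, he, one_mul]) hσ0 hdetσ
  have h2 : charVal χ (h * β) = χ (e : ZMod N) := by
    rw [charVal_mul χ hh0, h1, charVal, hεD, ← map_mul, Int.cast_mul, ← mul_assoc, hcast ε hε,
      one_mul]
  rw [h2, constTerm, if_pos hC, heD]
  rcases mul_self_eq_one_iff.1 (sq e ▸ he) with h3 | h3
  · simp [h3]
  · rw [h3, Int.cast_neg, Int.cast_one, hpar]
    simp

end ConstantTerm

/-! ### Nonvanishing of `𝔼_σ` -/

section Nonvanishing

variable {n k N : ℕ}

/-- The limit of the twisted sums at the cusp of `γ`. -/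
noncomputable def twistedLimit (k : ℕ) (χ : DirichletCharacter ℂ N) (h γ : Sp n) : ℂ :=
  ∑ᶠ c : RightCosets (GammaN n N) (Gamma0 n N), starRingEnd ℂ (charVal χ (h * rep c)) *
    ∑' d : RightCosets (GammaInfPlus n) (GammaN n N), constTerm k (rep d * (h * γ * rep c * γ⁻¹))

theorem tendsto_twistedSum [NeZero N] (hk : n + 2 ≤ k) (χ : DirichletCharacter ℂ N) (h γ : Sp n) :
    Filter.Tendsto (fun m : ℕ => (detFactor γ⁻¹ (seqPoint n m).1 ^ k)⁻¹ *
      twistedSum k χ h γ (act γ⁻¹ (seqPoint n m)).1) Filter.atTop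
      (nhds (twistedLimit k χ h γ)) := by
  have := Fintype.ofFinite (RightCosets (GammaN n N) (Gamma0 n N))
  have h1 : ∀ m : ℕ, (detFactor γ⁻¹ (seqPoint n m).1 ^ k)⁻¹ *
      twistedSum k χ h γ (act γ⁻¹ (seqPoint n m)).1
      = ∑ c : RightCosets (GammaN n N) (Gamma0 n N), starRingEnd ℂ (charVal χ (h * rep c)) *
        slash k (Estar n k N) (h * γ * rep c * γ⁻¹) (seqPoint n m).1 := by
    intro m
    rw [twistedSum, finsum_eq_sum_of_fintype, Finset.mul_sum]
    refine Finset.sum_congr rfl fun c _ => ?_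
    rw [slash_mul k _ (h * γ * rep c) γ⁻¹]
    ring
  rw [twistedLimit, finsum_eq_sum_of_fintype]
  simp only [h1]
  exact tendsto_finsetSum _ fun c _ => (tendsto_slash_Estar hk _).const_mul _

/-- Sufficiency: the constant terms of the two twisted sums at the cusp of `γ_σ` are sums of terms
`0` and `1`, and the identity contributes a `1`. -/
theorem eisenstein_ne_zero [NeZero N] (hk : n + 2 ≤ k) (hN : Squarefree N)
    {χ : DirichletCharacter ℂ N} (hpar : χ (-1) = (-1) ^ k) {M : Matrix (Fin n) (Fin n) ℤ}
    (hM : IsRepMatrix N M)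
    (hχ : ∀ (q : ℕ) (_ : q.Prime) (hqN : q ∣ N), 0 < rankMod q M → rankMod q M < n →
      component χ (exactDvd_of_squarefree hN hqN) ^ 2 = 1) :
    eisenstein k χ (gammaLower M hM.isSymm) ≠ 0 := by
  classical
  have := Fintype.ofFinite (RightCosets (GammaN n N) (Gamma0 n N))
  set γ := gammaLower M hM.isSymm with hγ
  -- Each term of the limits is `0` or `1`.
  have hterm : ∀ (h : Sp n), blockC h = 0 → ∀ (c : RightCosets (GammaN n N) (Gamma0 n N))
      (d : RightCosets (GammaInfPlus n) (GammaN n N)),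
      starRingEnd ℂ (charVal χ (h * rep c)) * constTerm k (rep d * (h * γ * rep c * γ⁻¹))
        = if blockC (rep d * (h * γ * rep c * γ⁻¹)) = 0 then 1 else 0 := by
    intro h hh c d
    split_ifs with h0
    · exact conj_charVal_mul_constTerm hN hpar hM hχ hh (rep_mem c) (rep_mem d) h0
    · rw [constTerm, if_neg h0, mul_zero]
  have hnonneg : ∀ (h : Sp n), blockC h = 0 → ∀ c : RightCosets (GammaN n N) (Gamma0 n N),
      0 ≤ starRingEnd ℂ (charVal χ (h * rep c)) * ∑' d : RightCosets (GammaInfPlus n) (GammaN n N),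
        constTerm k (rep d * (h * γ * rep c * γ⁻¹)) := by
    intro h hh c
    rw [← tsum_mul_left]
    refine tsum_nonneg fun d => ?_
    rw [hterm h hh c d]
    split_ifs <;> norm_num
  have hpm : 0 ≤ twistedLimit k χ (gammaPM n) γ := by
    rw [twistedLimit, finsum_eq_sum_of_fintype]
    exact Finset.sum_nonneg fun c _ => hnonneg _ blockC_gammaPM c
  have hone : 0 < twistedLimit k χ 1 γ := by
    rw [twistedLimit, finsum_eq_sum_of_fintype]
    refine Finset.sum_pos' (fun c _ => hnonneg _ blockC_one c)
      ⟨cosetOf _ (1 : Gamma0 n N), Finset.mem_univ _, ?_⟩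
    set c := cosetOf (GammaN n N) (1 : Gamma0 n N) with hc
    have h1 : rep c ∈ GammaN n N := by
      have := cosetOf_eq_iff.1 (cosetOf_rep c)
      simpa using this
    have h2 : 1 * γ * rep c * γ⁻¹ ∈ GammaN n N := by
      rw [one_mul]; exact GammaN_normal.conj_mem _ h1 _
    set σ := 1 * γ * rep c * γ⁻¹ with hσ
    have hsum : Summable fun d : RightCosets (GammaInfPlus n) (GammaN n N) =>
        starRingEnd ℂ (charVal χ (1 * rep c)) * constTerm k (rep d * σ) :=
      (summable_constTerm hk σ).mul_left _
    rw [← tsum_mul_left]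
    refine hsum.tsum_pos (fun d => ?_) (cosetOf _ (⟨σ, h2⟩⁻¹ : GammaN n N)) ?_
    · rw [hterm 1 blockC_one c d]
      split_ifs <;> norm_num
    · rw [hterm 1 blockC_one c, if_pos]
      · exact one_pos
      · have := cosetOf_eq_iff.1 (cosetOf_rep (cosetOf (GammaInfPlus n) (⟨σ, h2⟩⁻¹ : GammaN n N)))
        simp only [Subgroup.coe_inv, inv_inv] at this
        exact this.1
  have hlim := (tendsto_twistedSum hk χ 1 γ).add (tendsto_twistedSum hk χ (gammaPM n) γ)
  have hne : twistedLimit k χ 1 γ + twistedLimit k χ (gammaPM n) γ ≠ 0 :=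
    (add_pos_of_pos_of_nonneg hone hpm).ne'
  intro hE
  apply hne
  refine tendsto_nhds_unique hlim ?_
  refine tendsto_const_nhds.congr fun m => ?_
  have h1 : eisenstein k χ γ (act γ⁻¹ (seqPoint n m)) = 0 := by rw [hE]; rfl
  rw [eisenstein, Eprime_eq, mul_eq_zero] at h1
  have h2 : (2 * ((GammaN n N).relIndex (GammaStab N γ) : ℂ))⁻¹ ≠ 0 :=
    inv_ne_zero (mul_ne_zero two_ne_zero (Nat.cast_ne_zero.2 (relIndex_ne_zero _)))
  rw [← mul_add, h1.resolve_left h2, mul_zero]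

end Nonvanishing

end SiegelEis

theorem proposition3p6 (n k N : ℕ) (hn : 0 < n) (hN : 0 < N) (hk : n + 1 < k)
    (χ : DirichletCharacter ℂ N) (hχ : χ (-1) = (-1) ^ k) (hNk : 2 < N ∨ Even k)
    (M : Matrix (Fin n) (Fin n) ℤ) (hM : SiegelEis.IsRepMatrix N M) :
    (SiegelEis.eisenstein k χ (SiegelEis.gammaLower M hM.isSymm) ≠ 0 →
      ∀ (q : ℕ) (_ : q.Prime) (hqN : SiegelEis.ExactDvd q N),
        0 < SiegelEis.rankMod q M → SiegelEis.rankMod q M < n →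
          SiegelEis.component χ hqN ^ 2 = 1) ∧
    (∀ hsq : Squarefree N,
      SiegelEis.eisenstein k χ (SiegelEis.gammaLower M hM.isSymm) ≠ 0 ↔
        ∀ (q : ℕ) (_ : q.Prime) (hqN : q ∣ N),
          0 < SiegelEis.rankMod q M → SiegelEis.rankMod q M < n →
            SiegelEis.component χ (SiegelEis.exactDvd_of_squarefree hsq hqN) ^ 2 = 1) := by
  have : NeZero N := ⟨hN.ne'⟩
  refine ⟨fun hE q hq hqN h0 h1 =>
    SiegelEis.component_sq_eq_one_of_eisenstein_ne_zero hM hE hq hqN h0 h1, fun hsq => ⟨?_, ?_⟩⟩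
  · exact fun hE q hq hqN h0 h1 =>
      SiegelEis.component_sq_eq_one_of_eisenstein_ne_zero hM hE hq _ h0 h1
  · exact SiegelEis.eisenstein_ne_zero hk hsq hχ hM
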